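/- **Setting.** Fix a well-formed signature $\Sigma$ of constants $a$ (each constant is declared once, by a closed type or kind over the earlier declarations). The raw syntax, with de Bruijn variables $x_n$ and meta-variables $X_n$ ($n\ge 1$), is $$s ::= \mathsf{kind}\mid\mathsf{type},\qquad E,F ::= s\mid a\mid \Pi A.E\mid x_n\mid X_n\mid\lambda M\mid E\,N\mid[\sigma]E\mid[\![\theta]\!]E,$$ $$\sigma ::= {\uparrow^n}\mid(\sigma,M)\mid[\sigma]\tau\mid[\![\theta]\!]\sigma,\qquad \theta ::= {\Uparrow^n}\mid(\theta,M)\mid[\![\theta]\!]\theta'.$$ Contexts $\Gamma,\Psi$ are lists of types, meta-contexts $\Delta$ are lists of declarations $A[\Psi]$, and $[\![\theta]\!]\Gamma$ is computed entrywise. The judgments are those of the dependently typed (LF) calculus with explicit substitutions and explicit meta-substitutions: well-formedness of $\Delta$ and of $\Gamma$; typing $\Delta;\Gamma\vdash E:F$, $\Delta;\Gamma\vdash\sigma:\Psi$, $\Delta\vdash\theta:\Delta'$; and typed definitional equality $\Delta;\Gamma\vdash E\equiv E':F$, $\Delta;\Gamma\vdash\sigma\equiv\sigma':\Psi$, $\Delta\vdash\theta\equiv\theta':\Delta'$.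 Definitional equality is the typed congruence generated by $\beta$, $\eta$ (for terms and for both kinds of substitutions), the laws propagating (meta-)substitutions into expressions and substitutions, and the reduction and category laws of (meta-)substitutions. Typing and equality are closed under conversion of the type, and definitionally equal contexts $\Delta\vdash\Gamma\equiv\Gamma'$ are interchangeable. If $E:\mathsf{kind}$ then $[\sigma]E$ and $[\![\theta]\!]E$ are classified by $\mathsf{kind}$; otherwise, if $E:F$, by $[\sigma]F$ and $[\![\theta]\!]F$ respectively. Write $\Delta;\Gamma\vdash F\equiv F'$ if $\Delta;\Gamma\vdash F\equiv F':s$ for some sort $s$. **Weak head normal forms.** Among the raw expressions and substitutions single out $$W ::= s\mid[\rho][\![\eta]\!](\Pi A.B)\mid[\rho][\![\eta]\!](\lambda M)\mid H,\quad H ::= a\mid x_n\mid[\rho]X_n\mid H\,L,\quad L ::= x_n\mid[\rho][\![\eta]\!]E,$$ $$\rho ::= {\uparrow^n}\mid(\rho,L)\mid[\uparrow^n]\rho,\qquad \eta ::= {\Uparrow^n}\mid(\eta,M).$$ Here $L$ are closures and $\rho$ environments. Let ${\uparrow^k}x_m=x_{k+m}$ and ${\uparrow^k}([\rho][\![\eta]\!]E)=[[\uparrow^k]\rho][\![\eta]\!]E$,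 extended to neutral $H$ by shifting each component; let $\rho^+=([\uparrow^1]\rho,x_1)$. The partial function $\mathsf{whnf}\,L$ evaluates a closure lazily to weak head normal form (looking up variables and meta-variables in $\rho$ and $\eta$, absorbing explicit substitutions into $\rho$ and $\eta$, and contracting head $\beta$-redexes). **Algorithmic equality** consists of three mutually inductive relations $H\overset{n}{\sim}H'$, $W\overset{w}{\sim}W'$, $\rho\sim^{k,k'}\rho'$. A premise that mentions $\mathsf{whnf}$ includes that it is defined. - $a\overset n\sim a$; $x_m\overset n\sim x_m$; $[\rho]X_m\overset n\sim[\rho']X_m$ if $\rho\sim^{0,0}\rho'$; $H\,L\overset n\sim H'\,L'$ if $H\overset n\sim H'$ and $\mathsf{whnf}\,L\overset w\sim\mathsf{whnf}\,L'$. - $s\overset w\sim s$; $H\overset w\sim H'$ if $H\overset n\sim H'$; $[\rho][\![\eta]\!](\Pi A.B)\overset w\sim[\rho'][\![\eta']\!](\Pi A'.B')$ if $\mathsf{whnf}\,[\rho][\![\eta]\!]A\overset w\sim\mathsf{whnf}\,[\rho'][\![\eta']\!]A'$ and $\mathsf{whnf}\,[\rho^+][\![\eta]\!]B\overset w\sim\mathsf{whnf}\,[\rho'^+][\![\eta']\!]B'$;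 $[\rho][\![\eta]\!](\lambda M)\overset w\sim[\rho'][\![\eta']\!](\lambda M')$ if $\mathsf{whnf}\,[\rho^+][\![\eta]\!]M\overset w\sim\mathsf{whnf}\,[\rho'^+][\![\eta']\!]M'$; $[\rho][\![\eta]\!](\lambda M)\overset w\sim H$ if $\mathsf{whnf}\,[\rho^+][\![\eta]\!]M\overset w\sim({\uparrow^1}H)\,x_1$, and symmetrically with the two sides exchanged. - ${\uparrow^n}\sim^{k,k'}{\uparrow^{n'}}$ if $k+n=k'+n'$; $[\uparrow^n]\rho\sim^{k,k'}\rho'$ if $\rho\sim^{k+n,k'}\rho'$; $\rho\sim^{k,k'}[\uparrow^{n'}]\rho'$ if $\rho\sim^{k,k'+n'}\rho'$; $(\rho,L)\sim^{k,k'}(\rho',L')$ if $\rho\sim^{k,k'}\rho'$ and $\mathsf{whnf}({\uparrow^k}L)\overset w\sim\mathsf{whnf}({\uparrow^{k'}}L')$; $(\rho,L)\sim^{k,k'}{\uparrow^{n'}}$ if $\rho\sim^{k,k'}{\uparrow^{n'+1}}$ and $\mathsf{whnf}({\uparrow^k}L)\overset w\sim x_{k'+n'+1}$; ${\uparrow^n}\sim^{k,k'}(\rho',L')$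 if ${\uparrow^{n+1}}\sim^{k,k'}\rho'$ and $x_{k+n+1}\overset w\sim\mathsf{whnf}({\uparrow^{k'}}L')$. **Theorem (Soundness of algorithmic equality).** For all $\Delta$, $\Gamma$: 1. If $H\overset n\sim H'$ and $\Delta;\Gamma\vdash H:F$ and $\Delta;\Gamma\vdash H':F'$, then $\Delta;\Gamma\vdash F\equiv F'$ and $\Delta;\Gamma\vdash H\equiv H':F$. 2. If $W\overset w\sim W'$ and $\Delta;\Gamma\vdash W:F$ and $\Delta;\Gamma\vdash W':F$, then $\Delta;\Gamma\vdash W\equiv W':F$. 3. If $\rho\sim^{k,k'}\rho'$ and $\Delta;\Gamma\vdash[\uparrow^k]\rho:\Psi$ and $\Delta;\Gamma\vdash[\uparrow^{k'}]\rho':\Psi$, then $\Delta;\Gamma\vdash[\uparrow^k]\rho\equiv[\uparrow^{k'}]\rho':\Psi$. -/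

import Mathlib

namespace CMTT

universe u

/-! ### Syntax

De Bruijn indices are counted from `0` here: `var n` is the variable `x_{n+1}` and `mvar n` is the
meta-variable `X_{n+1}`.  Contexts are snoc lists, so `Γ, A` is `A :: Γ` and `Γ, Γ'` is `Γ' ++ Γ`. -/

/-- The two sorts. -/
inductive Srt : Type
  | kind
  | type

mutual

/-- Raw expressions (terms, types and kinds) over a set `C` of constants. -/
inductive Expr (C : Type u) : Type u
  | sort (s : Srt)
  | const (a : C)
  | pi (A E : Expr C)
  | var (n : ℕ)
  | mvar (n : ℕ)
  | lam (M : Expr C)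
  | app (E N : Expr C)
  /-- the closure `[σ]E` -/
  | sub (σ : Sub C) (E : Expr C)
  /-- the closure `⟦θ⟧E` -/
  | msub (θ : MSub C) (E : Expr C)

/-- Raw ordinary substitutions. -/
inductive Sub (C : Type u) : Type u
  /-- the shift `↑ⁿ` -/
  | shift (n : ℕ)
  /-- the extension `(σ, M)` -/
  | cons (σ : Sub C) (M : Expr C)
  /-- the closure `[σ]τ` -/
  | sub (σ τ : Sub C)
  /-- the closure `⟦θ⟧σ` -/
  | msub (θ : MSub C) (σ : Sub C)

/-- Raw meta-substitutions. -/
inductive MSub (C : Type u) : Type u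
  /-- the meta-shift `⇑ⁿ` -/
  | shift (n : ℕ)
  /-- the extension `(θ, M)` -/
  | cons (θ : MSub C) (M : Expr C)
  /-- the closure `⟦θ⟧θ'` -/
  | msub (θ θ' : MSub C)

end

/-- Ordinary contexts. -/
abbrev Ctx (C : Type u) : Type u := List (Expr C)

/-- Meta-contexts; an entry `(Ψ, A)` declares a meta-variable of type `A` in context `Ψ`. -/
abbrev MCtx (C : Type u) : Type u := List (Ctx C × Expr C)

/-- Signatures, newest declaration first. -/
abbrev Sig (C : Type u) : Type u := List (C × Expr C)

variable {C : Type u}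

/-- `⟦θ⟧Γ`, computed by pushing `θ` to each declaration. -/
def Ctx.msub (θ : MSub C) (Γ : Ctx C) : Ctx C := List.map (Expr.msub θ) Γ

/-- `(σ lifted under a binder) = ([↑¹]σ, x₁)` -/
def Sub.lift (σ : Sub C) : Sub C := .cons (.sub (.shift 1) σ) (.var 0)

/-- The single substitution `(↑⁰, N)`. -/
def Sub.single (N : Expr C) : Sub C := .cons (.shift 0) N

/-- Classifier of a closure `[σ]E`, where `F` is the classifier of `E`: it is `kind` if `F` is
`kind`, and `[σ]F` otherwise (`kind` is not itself a typable expression). -/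
def Expr.subCls (σ : Sub C) : Expr C → Expr C
  | .sort .kind => .sort .kind
  | F => .sub σ F

/-- Classifier of a closure `⟦θ⟧E`, where `F` is the classifier of `E`: it is `kind` if `F` is
`kind`, and `⟦θ⟧F` otherwise. -/
def Expr.msubCls (θ : MSub C) : Expr C → Expr C
  | .sort .kind => .sort .kind
  | F => .msub θ F

/-! ### Typing and definitional equality -/

/-- The judgments of the calculus. -/
inductive Judgment (C : Type u) : Type u
  /-- `⊢ Δ mctx` -/
  | mctx (Δ : MCtx C)
  /-- `Δ ⊢ Γ ctx` -/
  | ctx (Δ : MCtx C) (Γ : Ctx C)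
  /-- `Δ; Γ ⊢ E : F` -/
  | ty (Δ : MCtx C) (Γ : Ctx C) (E F : Expr C)
  /-- `Δ; Γ ⊢ σ : Ψ` -/
  | tySub (Δ : MCtx C) (Γ : Ctx C) (σ : Sub C) (Ψ : Ctx C)
  /-- `Δ ⊢ θ : Δ'` -/
  | tyMSub (Δ : MCtx C) (θ : MSub C) (Δ' : MCtx C)
  /-- `Δ ⊢ Γ ≡ Γ' ctx` -/
  | eqCtx (Δ : MCtx C) (Γ Γ' : Ctx C)
  /-- `Δ; Γ ⊢ E ≡ E' : F` -/
  | eq (Δ : MCtx C) (Γ : Ctx C) (E E' F : Expr C)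
  /-- `Δ; Γ ⊢ σ ≡ σ' : Ψ` -/
  | eqSub (Δ : MCtx C) (Γ : Ctx C) (σ σ' : Sub C) (Ψ : Ctx C)
  /-- `Δ ⊢ θ ≡ θ' : Δ'` -/
  | eqMSub (Δ : MCtx C) (θ θ' : MSub C) (Δ' : MCtx C)

/-- Derivability of the judgments over a signature `Sg`. -/
inductive Der (Sg : Sig C) : Judgment C → Prop
  /- Meta-contexts and contexts. -/
  | mctx_nil : Der Sg (.mctx [])
  | mctx_cons {Δ Ψ A} : Der Sg (.ty Δ Ψ A (.sort .type)) → Der Sg (.mctx ((Ψ, A) :: Δ))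
  | ctx_nil {Δ} : Der Sg (.mctx Δ) → Der Sg (.ctx Δ [])
  | ctx_cons {Δ Ψ A} : Der Sg (.ty Δ Ψ A (.sort .type)) → Der Sg (.ctx Δ (A :: Ψ))
  /- Typing of expressions. -/
  | ty_type {Δ Γ} : Der Sg (.ctx Δ Γ) → Der Sg (.ty Δ Γ (.sort .type) (.sort .kind))
  | ty_const {Δ Γ a K} : Der Sg (.ctx Δ Γ) → (a, K) ∈ Sg → Der Sg (.ty Δ Γ (.const a) K)
  | ty_pi {Δ Γ A E s} : Der Sg (.ty Δ (A :: Γ) E (.sort s)) →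
      Der Sg (.ty Δ Γ (.pi A E) (.sort s))
  | ty_var_zero {Δ Γ A} : Der Sg (.ty Δ Γ A (.sort .type)) →
      Der Sg (.ty Δ (A :: Γ) (.var 0) (.sub (.shift 1) A))
  | ty_var_succ {Δ Γ A B n} : Der Sg (.ty Δ Γ (.var n) A) → Der Sg (.ty Δ Γ B (.sort .type)) →
      Der Sg (.ty Δ (B :: Γ) (.var (n + 1)) (.sub (.shift 1) A))
  | ty_mvar_zero {Δ Γ A} : Der Sg (.ty Δ Γ A (.sort .type)) →
      Der Sg (.ty ((Γ, A) :: Δ) (Ctx.msub (.shift 1) Γ) (.mvar 0) (.msub (.shift 1) A))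
  | ty_mvar_succ {Δ Γ A Γ' A' n} : Der Sg (.ty Δ Γ (.mvar n) A) →
      Der Sg (.ty Δ Γ' A' (.sort .type)) →
      Der Sg (.ty ((Γ', A') :: Δ) (Ctx.msub (.shift 1) Γ) (.mvar (n + 1)) (.msub (.shift 1) A))
  | ty_lam {Δ Γ A B M} : Der Sg (.ty Δ (A :: Γ) M B) → Der Sg (.ty Δ (A :: Γ) B (.sort .type)) →
      Der Sg (.ty Δ Γ (.lam M) (.pi A B))
  | ty_app {Δ Γ A F E N} : Der Sg (.ty Δ Γ E (.pi A F)) → Der Sg (.ty Δ Γ N A) →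
      Der Sg (.ty Δ Γ (.app E N) (.sub (.single N) F))
  | ty_sub {Δ Γ Ψ σ E F} : Der Sg (.tySub Δ Γ σ Ψ) → Der Sg (.ty Δ Ψ E F) →
      Der Sg (.ty Δ Γ (.sub σ E) (.subCls σ F))
  | ty_msub {Δ Δ' Γ θ E F} : Der Sg (.tyMSub Δ θ Δ') → Der Sg (.ty Δ' Γ E F) →
      Der Sg (.ty Δ (Ctx.msub θ Γ) (.msub θ E) (.msubCls θ F))
  | ty_conv {Δ Γ E F₁ F₂ s} : Der Sg (.ty Δ Γ E F₁) → Der Sg (.eq Δ Γ F₁ F₂ (.sort s)) →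
      Der Sg (.ty Δ Γ E F₂)
  /- Typing of ordinary substitutions. -/
  | tySub_shift {Δ Ψ Γ n} : Der Sg (.ctx Δ (Γ ++ Ψ)) → Γ.length = n →
      Der Sg (.tySub Δ (Γ ++ Ψ) (.shift n) Ψ)
  | tySub_cons {Δ Γ Ψ σ A M} : Der Sg (.tySub Δ Γ σ Ψ) → Der Sg (.ty Δ Ψ A (.sort .type)) →
      Der Sg (.ty Δ Γ M (.sub σ A)) → Der Sg (.tySub Δ Γ (.cons σ M) (A :: Ψ))
  | tySub_sub {Δ Γ Ψ' Ψ τ σ} : Der Sg (.tySub Δ Γ τ Ψ') → Der Sg (.tySub Δ Ψ' σ Ψ) →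
      Der Sg (.tySub Δ Γ (.sub τ σ) Ψ)
  | tySub_msub {Δ Δ' Γ Ψ θ σ} : Der Sg (.tyMSub Δ θ Δ') → Der Sg (.tySub Δ' Γ σ Ψ) →
      Der Sg (.tySub Δ (Ctx.msub θ Γ) (.msub θ σ) (Ctx.msub θ Ψ))
  /- Typing of meta-substitutions. -/
  | tyMSub_shift {Δ Δ' n} : Der Sg (.mctx (Δ' ++ Δ)) → Δ'.length = n →
      Der Sg (.tyMSub (Δ' ++ Δ) (.shift n) Δ)
  | tyMSub_cons {Δ Δ' Γ A θ M} : Der Sg (.tyMSub Δ θ Δ') → Der Sg (.ty Δ' Γ A (.sort .type)) →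
      Der Sg (.ty Δ (Ctx.msub θ Γ) M (.msub θ A)) →
      Der Sg (.tyMSub Δ (.cons θ M) ((Γ, A) :: Δ'))
  | tyMSub_msub {Δ Δ₀ Δ' θ θ'} : Der Sg (.tyMSub Δ θ Δ₀) → Der Sg (.tyMSub Δ₀ θ' Δ') →
      Der Sg (.tyMSub Δ (.msub θ θ') Δ')
  /- Definitionally equal contexts are interchangeable. -/
  | eqCtx_nil {Δ} : Der Sg (.mctx Δ) → Der Sg (.eqCtx Δ [] [])
  | eqCtx_cons {Δ Γ Γ' A A'} : Der Sg (.eqCtx Δ Γ Γ') → Der Sg (.ty Δ Γ A (.sort .type)) →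
      Der Sg (.ty Δ Γ' A' (.sort .type)) → Der Sg (.eq Δ Γ A A' (.sort .type)) →
      Der Sg (.eqCtx Δ (A :: Γ) (A' :: Γ'))
  | ty_ctx {Δ Γ Γ' E F} : Der Sg (.ty Δ Γ E F) → Der Sg (.eqCtx Δ Γ Γ') → Der Sg (.ty Δ Γ' E F)
  | tySub_ctx {Δ Γ Γ' σ Ψ Ψ'} : Der Sg (.tySub Δ Γ σ Ψ) → Der Sg (.eqCtx Δ Γ Γ') →
      Der Sg (.eqCtx Δ Ψ Ψ') → Der Sg (.tySub Δ Γ' σ Ψ')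
  | eq_ctx {Δ Γ Γ' E E' F} : Der Sg (.eq Δ Γ E E' F) → Der Sg (.eqCtx Δ Γ Γ') →
      Der Sg (.eq Δ Γ' E E' F)
  | eqSub_ctx {Δ Γ Γ' σ σ' Ψ Ψ'} : Der Sg (.eqSub Δ Γ σ σ' Ψ) → Der Sg (.eqCtx Δ Γ Γ') →
      Der Sg (.eqCtx Δ Ψ Ψ') → Der Sg (.eqSub Δ Γ' σ σ' Ψ')
  /- Equality of expressions: equivalence, conversion, congruence. -/
  | eq_refl {Δ Γ E F} : Der Sg (.ty Δ Γ E F) → Der Sg (.eq Δ Γ E E F)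
  | eq_symm {Δ Γ E E' F} : Der Sg (.eq Δ Γ E E' F) → Der Sg (.eq Δ Γ E' E F)
  | eq_trans {Δ Γ E₁ E₂ E₃ F} : Der Sg (.eq Δ Γ E₁ E₂ F) → Der Sg (.eq Δ Γ E₂ E₃ F) →
      Der Sg (.eq Δ Γ E₁ E₃ F)
  | eq_conv {Δ Γ E E' F F' s} : Der Sg (.eq Δ Γ E E' F) → Der Sg (.eq Δ Γ F F' (.sort s)) →
      Der Sg (.eq Δ Γ E E' F')
  | eq_pi {Δ Γ A A' E E' s} : Der Sg (.eq Δ Γ A A' (.sort .type)) →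
      Der Sg (.ty Δ Γ A (.sort .type)) → Der Sg (.eq Δ (A :: Γ) E E' (.sort s)) →
      Der Sg (.eq Δ Γ (.pi A E) (.pi A' E') (.sort s))
  | eq_lam {Δ Γ A B M M'} : Der Sg (.eq Δ (A :: Γ) M M' B) →
      Der Sg (.ty Δ (A :: Γ) B (.sort .type)) → Der Sg (.eq Δ Γ (.lam M) (.lam M') (.pi A B))
  | eq_app {Δ Γ A F E E' N N'} : Der Sg (.eq Δ Γ E E' (.pi A F)) → Der Sg (.eq Δ Γ N N' A) →
      Der Sg (.eq Δ Γ (.app E N) (.app E' N') (.sub (.single N) F))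
  | eq_sub {Δ Γ Ψ σ σ' E E' F} : Der Sg (.eqSub Δ Γ σ σ' Ψ) → Der Sg (.eq Δ Ψ E E' F) →
      Der Sg (.eq Δ Γ (.sub σ E) (.sub σ' E') (.subCls σ F))
  | eq_msub {Δ Δ' Γ θ θ' E E' F} : Der Sg (.eqMSub Δ θ θ' Δ') → Der Sg (.eq Δ' Γ E E' F) →
      Der Sg (.eq Δ (Ctx.msub θ Γ) (.msub θ E) (.msub θ' E') (.msubCls θ F))
  /- Beta and eta. -/
  | eq_beta {Δ Γ A B M N} : Der Sg (.ty Δ (A :: Γ) M B) →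
      Der Sg (.ty Δ (A :: Γ) B (.sort .type)) → Der Sg (.ty Δ Γ N A) →
      Der Sg (.eq Δ Γ (.app (.lam M) N) (.sub (.single N) M) (.sub (.single N) B))
  | eq_eta {Δ Γ A B M} : Der Sg (.ty Δ Γ M (.pi A B)) → Der Sg (.ty Δ (A :: Γ) B (.sort .type)) →
      Der Sg (.eq Δ Γ M (.lam (.app (.sub (.shift 1) M) (.var 0))) (.pi A B))
  /- Propagation of ordinary substitutions into expressions. -/
  | eq_sub_id {Δ Γ E F} : Der Sg (.ty Δ Γ E F) → Der Sg (.eq Δ Γ (.sub (.shift 0) E) E F)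
  | eq_sub_comp {Δ Γ Γ' Ψ σ τ E F} : Der Sg (.tySub Δ Γ σ Γ') → Der Sg (.tySub Δ Γ' τ Ψ) →
      Der Sg (.ty Δ Ψ E F) →
      Der Sg (.eq Δ Γ (.sub σ (.sub τ E)) (.sub (.sub σ τ) E) (.subCls (.sub σ τ) F))
  | eq_sub_type {Δ Γ Ψ σ} : Der Sg (.tySub Δ Γ σ Ψ) →
      Der Sg (.eq Δ Γ (.sub σ (.sort .type)) (.sort .type) (.sort .kind))
  | eq_sub_const {Δ Γ Ψ σ a K} : Der Sg (.tySub Δ Γ σ Ψ) → Der Sg (.ty Δ Ψ (.const a) K) →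
      Der Sg (.eq Δ Γ (.sub σ (.const a)) (.const a) (.sub σ K))
  | eq_sub_var_zero {Δ Γ Ψ σ A M} : Der Sg (.tySub Δ Γ σ Ψ) → Der Sg (.ty Δ Ψ A (.sort .type)) →
      Der Sg (.ty Δ Γ M (.sub σ A)) → Der Sg (.eq Δ Γ (.sub (.cons σ M) (.var 0)) M (.sub σ A))
  | eq_var_succ {Δ Γ A n} : Der Sg (.ty Δ Γ (.var (n + 1)) A) →
      Der Sg (.eq Δ Γ (.var (n + 1)) (.sub (.shift 1) (.var n)) A)
  | eq_sub_pi {Δ Γ Ψ σ A F s} : Der Sg (.tySub Δ Γ σ Ψ) → Der Sg (.ty Δ (A :: Ψ) F (.sort s)) →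
      Der Sg (.eq Δ Γ (.sub σ (.pi A F)) (.pi (.sub σ A) (.sub σ.lift F)) (.sort s))
  | eq_sub_lam {Δ Γ Ψ σ A B M} : Der Sg (.tySub Δ Γ σ Ψ) → Der Sg (.ty Δ (A :: Ψ) M B) →
      Der Sg (.ty Δ (A :: Ψ) B (.sort .type)) →
      Der Sg (.eq Δ Γ (.sub σ (.lam M)) (.lam (.sub σ.lift M)) (.pi (.sub σ A) (.sub σ.lift B)))
  | eq_sub_app {Δ Γ Ψ σ A F E N} : Der Sg (.tySub Δ Γ σ Ψ) → Der Sg (.ty Δ Ψ E (.pi A F)) →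
      Der Sg (.ty Δ Ψ N A) →
      Der Sg (.eq Δ Γ (.sub σ (.app E N)) (.app (.sub σ E) (.sub σ N))
        (.sub (.cons σ (.sub σ N)) F))
  /- Propagation of meta-substitutions into expressions. -/
  | eq_msub_id {Δ Γ E F} : Der Sg (.ty Δ Γ E F) → Der Sg (.eq Δ Γ (.msub (.shift 0) E) E F)
  | eq_msub_comp {Δ Δ' Δ'' Γ θ θ' E F} : Der Sg (.tyMSub Δ θ Δ') → Der Sg (.tyMSub Δ' θ' Δ'') →
      Der Sg (.ty Δ'' Γ E F) →
      Der Sg (.eq Δ (Ctx.msub (.msub θ θ') Γ) (.msub θ (.msub θ' E)) (.msub (.msub θ θ') E)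
        (.msubCls (.msub θ θ') F))
  | eq_msub_type {Δ Δ' Γ θ} : Der Sg (.tyMSub Δ θ Δ') → Der Sg (.ctx Δ' Γ) →
      Der Sg (.eq Δ (Ctx.msub θ Γ) (.msub θ (.sort .type)) (.sort .type) (.sort .kind))
  | eq_msub_const {Δ Δ' Γ θ a K} : Der Sg (.tyMSub Δ θ Δ') → Der Sg (.ty Δ' Γ (.const a) K) →
      Der Sg (.eq Δ (Ctx.msub θ Γ) (.msub θ (.const a)) (.const a) (.msub θ K))
  | eq_msub_var {Δ Δ' Γ θ n A} : Der Sg (.tyMSub Δ θ Δ') → Der Sg (.ty Δ' Γ (.var n) A) →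
      Der Sg (.eq Δ (Ctx.msub θ Γ) (.msub θ (.var n)) (.var n) (.msub θ A))
  | eq_msub_mvar_zero {Δ Δ' Γ θ A M} : Der Sg (.tyMSub Δ θ Δ') →
      Der Sg (.ty Δ' Γ A (.sort .type)) → Der Sg (.ty Δ (Ctx.msub θ Γ) M (.msub θ A)) →
      Der Sg (.eq Δ (Ctx.msub θ Γ) (.msub (.cons θ M) (.mvar 0)) M (.msub θ A))
  | eq_mvar_succ {Δ Γ A n} : Der Sg (.ty Δ Γ (.mvar (n + 1)) A) →
      Der Sg (.eq Δ Γ (.mvar (n + 1)) (.msub (.shift 1) (.mvar n)) A)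
  | eq_msub_pi {Δ Δ' Γ θ A F s} : Der Sg (.tyMSub Δ θ Δ') →
      Der Sg (.ty Δ' (A :: Γ) F (.sort s)) →
      Der Sg (.eq Δ (Ctx.msub θ Γ) (.msub θ (.pi A F)) (.pi (.msub θ A) (.msub θ F)) (.sort s))
  | eq_msub_lam {Δ Δ' Γ θ A B M} : Der Sg (.tyMSub Δ θ Δ') → Der Sg (.ty Δ' (A :: Γ) M B) →
      Der Sg (.ty Δ' (A :: Γ) B (.sort .type)) →
      Der Sg (.eq Δ (Ctx.msub θ Γ) (.msub θ (.lam M)) (.lam (.msub θ M))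
        (.pi (.msub θ A) (.msub θ B)))
  | eq_msub_app {Δ Δ' Γ θ A F E N} : Der Sg (.tyMSub Δ θ Δ') → Der Sg (.ty Δ' Γ E (.pi A F)) →
      Der Sg (.ty Δ' Γ N A) →
      Der Sg (.eq Δ (Ctx.msub θ Γ) (.msub θ (.app E N)) (.app (.msub θ E) (.msub θ N))
        (.sub (.single (.msub θ N)) (.msub θ F)))
  | eq_msub_sub {Δ Δ' Γ Ψ θ σ E F} : Der Sg (.tyMSub Δ θ Δ') → Der Sg (.tySub Δ' Γ σ Ψ) →
      Der Sg (.ty Δ' Ψ E F) →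
      Der Sg (.eq Δ (Ctx.msub θ Γ) (.msub θ (.sub σ E)) (.sub (.msub θ σ) (.msub θ E))
        (.subCls (.msub θ σ) (.msubCls θ F)))
  /- Equality of ordinary substitutions: equivalence and congruence. -/
  | eqSub_refl {Δ Γ σ Ψ} : Der Sg (.tySub Δ Γ σ Ψ) → Der Sg (.eqSub Δ Γ σ σ Ψ)
  | eqSub_symm {Δ Γ σ σ' Ψ} : Der Sg (.eqSub Δ Γ σ σ' Ψ) → Der Sg (.eqSub Δ Γ σ' σ Ψ)
  | eqSub_trans {Δ Γ σ₁ σ₂ σ₃ Ψ} : Der Sg (.eqSub Δ Γ σ₁ σ₂ Ψ) → Der Sg (.eqSub Δ Γ σ₂ σ₃ Ψ) →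
      Der Sg (.eqSub Δ Γ σ₁ σ₃ Ψ)
  | eqSub_cons {Δ Γ Ψ σ σ' A M M'} : Der Sg (.eq Δ Γ M M' (.sub σ A)) →
      Der Sg (.ty Δ Ψ A (.sort .type)) → Der Sg (.eqSub Δ Γ σ σ' Ψ) →
      Der Sg (.eqSub Δ Γ (.cons σ M) (.cons σ' M') (A :: Ψ))
  | eqSub_sub {Δ Γ Ψ' Ψ τ τ' σ σ'} : Der Sg (.eqSub Δ Γ τ τ' Ψ') → Der Sg (.eqSub Δ Ψ' σ σ' Ψ) →
      Der Sg (.eqSub Δ Γ (.sub τ σ) (.sub τ' σ') Ψ)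
  | eqSub_msub {Δ Δ' Γ Ψ θ θ' σ σ'} : Der Sg (.eqMSub Δ θ θ' Δ') →
      Der Sg (.eqSub Δ' Γ σ σ' Ψ) →
      Der Sg (.eqSub Δ (Ctx.msub θ Γ) (.msub θ σ) (.msub θ' σ') (Ctx.msub θ Ψ))
  /- Reductions of ordinary substitutions, category laws, eta. -/
  | eqSub_cons_shift {Δ Γ Ψ Ψ' σ A M n} : Der Sg (.tySub Δ Γ (.cons σ M) (A :: (Ψ' ++ Ψ))) →
      Ψ'.length = n →
      Der Sg (.eqSub Δ Γ (.sub (.cons σ M) (.shift (n + 1))) (.sub σ (.shift n)) Ψ)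
  | eqSub_sub_cons {Δ Γ Ψ' Ψ σ τ A M} : Der Sg (.tySub Δ Γ σ Ψ') →
      Der Sg (.tySub Δ Ψ' (.cons τ M) (A :: Ψ)) →
      Der Sg (.eqSub Δ Γ (.sub σ (.cons τ M)) (.cons (.sub σ τ) (.sub σ M)) (A :: Ψ))
  | eqSub_shift_shift {Δ Γ Γ₁ Γ₂ m n} : Der Sg (.ctx Δ (Γ₂ ++ (Γ₁ ++ Γ))) → Γ₁.length = m →
      Γ₂.length = n →
      Der Sg (.eqSub Δ (Γ₂ ++ (Γ₁ ++ Γ)) (.sub (.shift n) (.shift m)) (.shift (n + m)) Γ)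
  | eqSub_id_left {Δ Γ σ Ψ} : Der Sg (.tySub Δ Γ σ Ψ) →
      Der Sg (.eqSub Δ Γ (.sub (.shift 0) σ) σ Ψ)
  | eqSub_id_right {Δ Γ σ Ψ} : Der Sg (.tySub Δ Γ σ Ψ) →
      Der Sg (.eqSub Δ Γ (.sub σ (.shift 0)) σ Ψ)
  | eqSub_assoc {Δ Γ₁ Γ₂ Γ₃ Γ₄ σ₁ σ₂ σ₃} : Der Sg (.tySub Δ Γ₁ σ₁ Γ₂) →
      Der Sg (.tySub Δ Γ₂ σ₂ Γ₃) → Der Sg (.tySub Δ Γ₃ σ₃ Γ₄) →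
      Der Sg (.eqSub Δ Γ₁ (.sub σ₁ (.sub σ₂ σ₃)) (.sub (.sub σ₁ σ₂) σ₃) Γ₄)
  | eqSub_eta {Δ Γ Γ' A n} : Der Sg (.ctx Δ (Γ' ++ A :: Γ)) → Γ'.length = n →
      Der Sg (.eqSub Δ (Γ' ++ A :: Γ) (.shift n) (.cons (.shift (n + 1)) (.var n)) (A :: Γ))
  /- Propagation of meta-substitutions into ordinary substitutions. -/
  | eqSub_msub_shift {Δ Δ' Γ Γ' θ n} : Der Sg (.tyMSub Δ θ Δ') → Der Sg (.ctx Δ' (Γ' ++ Γ)) →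
      Γ'.length = n →
      Der Sg (.eqSub Δ (Ctx.msub θ Γ' ++ Ctx.msub θ Γ) (.msub θ (.shift n)) (.shift n)
        (Ctx.msub θ Γ))
  | eqSub_msub_cons {Δ Δ' Γ Ψ θ σ A M} : Der Sg (.tyMSub Δ θ Δ') → Der Sg (.tySub Δ' Γ σ Ψ) →
      Der Sg (.ty Δ' Ψ A (.sort .type)) → Der Sg (.ty Δ' Γ M (.sub σ A)) →
      Der Sg (.eqSub Δ (Ctx.msub θ Γ) (.msub θ (.cons σ M)) (.cons (.msub θ σ) (.msub θ M))
        (.msub θ A :: Ctx.msub θ Ψ))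
  | eqSub_msub_sub {Δ Δ' Γ Ψ' Ψ θ τ σ} : Der Sg (.tyMSub Δ θ Δ') → Der Sg (.tySub Δ' Γ τ Ψ') →
      Der Sg (.tySub Δ' Ψ' σ Ψ) →
      Der Sg (.eqSub Δ (Ctx.msub θ Γ) (.msub θ (.sub τ σ)) (.sub (.msub θ τ) (.msub θ σ))
        (Ctx.msub θ Ψ))
  | eqSub_msub_msub {Δ Δ' Δ'' Γ Ψ θ θ' σ} : Der Sg (.tyMSub Δ θ Δ') →
      Der Sg (.tyMSub Δ' θ' Δ'') → Der Sg (.tySub Δ'' Γ σ Ψ) →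
      Der Sg (.eqSub Δ (Ctx.msub (.msub θ θ') Γ) (.msub θ (.msub θ' σ)) (.msub (.msub θ θ') σ)
        (Ctx.msub (.msub θ θ') Ψ))
  /- Equality of meta-substitutions: equivalence and congruence. -/
  | eqMSub_refl {Δ θ Δ'} : Der Sg (.tyMSub Δ θ Δ') → Der Sg (.eqMSub Δ θ θ Δ')
  | eqMSub_symm {Δ θ θ' Δ'} : Der Sg (.eqMSub Δ θ θ' Δ') → Der Sg (.eqMSub Δ θ' θ Δ')
  | eqMSub_trans {Δ θ₁ θ₂ θ₃ Δ'} : Der Sg (.eqMSub Δ θ₁ θ₂ Δ') → Der Sg (.eqMSub Δ θ₂ θ₃ Δ') →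
      Der Sg (.eqMSub Δ θ₁ θ₃ Δ')
  | eqMSub_cons {Δ Δ' Γ A θ θ' M M'} : Der Sg (.eqMSub Δ θ θ' Δ') →
      Der Sg (.ty Δ' Γ A (.sort .type)) → Der Sg (.eq Δ (Ctx.msub θ Γ) M M' (.msub θ A)) →
      Der Sg (.eqMSub Δ (.cons θ M) (.cons θ' M') ((Γ, A) :: Δ'))
  | eqMSub_msub {Δ Δ₀ Δ' θ₁ θ₁' θ₂ θ₂'} : Der Sg (.eqMSub Δ θ₁ θ₁' Δ₀) →
      Der Sg (.eqMSub Δ₀ θ₂ θ₂' Δ') → Der Sg (.eqMSub Δ (.msub θ₁ θ₂) (.msub θ₁' θ₂') Δ')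
  /- Reductions of meta-substitutions, category laws, eta. -/
  | eqMSub_cons_shift {Δ Δ₀ Δ₀' Γ A θ M n} :
      Der Sg (.tyMSub Δ (.cons θ M) ((Γ, A) :: (Δ₀' ++ Δ₀))) → Δ₀'.length = n →
      Der Sg (.eqMSub Δ (.msub (.cons θ M) (.shift (n + 1))) (.msub θ (.shift n)) Δ₀)
  | eqMSub_msub_cons {Δ Δ₀' Δ₀ Γ A θ θ' M} : Der Sg (.tyMSub Δ θ Δ₀') →
      Der Sg (.tyMSub Δ₀' (.cons θ' M) ((Γ, A) :: Δ₀)) →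
      Der Sg (.eqMSub Δ (.msub θ (.cons θ' M)) (.cons (.msub θ θ') (.msub θ M)) ((Γ, A) :: Δ₀))
  | eqMSub_shift_shift {Δ Δ₁ Δ₂ m n} : Der Sg (.mctx (Δ₂ ++ (Δ₁ ++ Δ))) → Δ₁.length = m →
      Δ₂.length = n →
      Der Sg (.eqMSub (Δ₂ ++ (Δ₁ ++ Δ)) (.msub (.shift n) (.shift m)) (.shift (n + m)) Δ)
  | eqMSub_id_left {Δ θ Δ₀} : Der Sg (.tyMSub Δ θ Δ₀) →
      Der Sg (.eqMSub Δ (.msub (.shift 0) θ) θ Δ₀)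
  | eqMSub_id_right {Δ θ Δ₀} : Der Sg (.tyMSub Δ θ Δ₀) →
      Der Sg (.eqMSub Δ (.msub θ (.shift 0)) θ Δ₀)
  | eqMSub_assoc {Δ₁ Δ₂ Δ₃ Δ₄ θ₁ θ₂ θ₃} : Der Sg (.tyMSub Δ₁ θ₁ Δ₂) →
      Der Sg (.tyMSub Δ₂ θ₂ Δ₃) → Der Sg (.tyMSub Δ₃ θ₃ Δ₄) →
      Der Sg (.eqMSub Δ₁ (.msub θ₁ (.msub θ₂ θ₃)) (.msub (.msub θ₁ θ₂) θ₃) Δ₄)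
  | eqMSub_eta {Δ Δ' Γ A n} : Der Sg (.mctx (Δ' ++ (Γ, A) :: Δ)) → Δ'.length = n →
      Der Sg (.eqMSub (Δ' ++ (Γ, A) :: Δ) (.shift n) (.cons (.shift (n + 1)) (.mvar n))
        ((Γ, A) :: Δ))

/-- Well-formed signatures: each new constant is fresh, and its classifier is a closed type or kind
over the earlier declarations. -/
inductive Sig.WF : Sig C → Prop
  | nil : Sig.WF []
  | cons {Sg : Sig C} {a : C} {K : Expr C} {s : Srt} : Sig.WF Sg → (∀ K', (a, K') ∉ Sg) →
      Der Sg (.ty [] [] K (.sort s)) → Sig.WF ((a, K) :: Sg)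

/-- `Δ; Γ ⊢ E ≡ E'`, i.e. equality at some sort. -/
def EqAtSort (Sg : Sig C) (Δ : MCtx C) (Γ : Ctx C) (E E' : Expr C) : Prop :=
  ∃ s : Srt, Der Sg (.eq Δ Γ E E' (.sort s))

/-! ### Weak head normal forms, closures and environments -/

/-- Meta-environments `η`. -/
inductive MEnv (C : Type u) : Type u
  | shift (n : ℕ)
  | cons (η : MEnv C) (M : Expr C)

mutual

/-- Closures `L`: a variable, or `[ρ]⟦η⟧E`. -/
inductive Closure (C : Type u) : Type u
  | var (n : ℕ)
  | clo (ρ : Env C) (η : MEnv C) (E : Expr C)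

/-- Environments `ρ`: `↑ⁿ`, `(ρ, L)`, or `[↑ⁿ]ρ`. -/
inductive Env (C : Type u) : Type u
  | shift (n : ℕ)
  | cons (ρ : Env C) (L : Closure C)
  | shifted (n : ℕ) (ρ : Env C)

end

/-- Neutral weak head normal forms `H`: `a`, a variable, `[ρ]X`, or `H L`. -/
inductive Neu (C : Type u) : Type u
  | const (a : C)
  | var (n : ℕ)
  | mvar (ρ : Env C) (n : ℕ)
  | app (H : Neu C) (L : Closure C)

/-- Weak head normal forms `W`: a sort, `[ρ]⟦η⟧(Π A. B)`, `[ρ]⟦η⟧(λ M)`, or a neutral. -/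
inductive Whn (C : Type u) : Type u
  | sort (s : Srt)
  | pi (ρ : Env C) (η : MEnv C) (A B : Expr C)
  | lam (ρ : Env C) (η : MEnv C) (M : Expr C)
  | neu (H : Neu C)

/-- A meta-environment as a meta-substitution. -/
def MEnv.toMSub : MEnv C → MSub C
  | .shift n => .shift n
  | .cons η M => .cons η.toMSub M

mutual

/-- A closure as an expression. -/
def Closure.toExpr : Closure C → Expr C
  | .var n => .var n
  | .clo ρ η E => .sub ρ.toSub (.msub η.toMSub E)

/-- An environment as an ordinary substitution. -/
def Env.toSub : Env C → Sub C
  | .shift n => .shift n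
  | .cons ρ L => .cons ρ.toSub L.toExpr
  | .shifted n ρ => .sub (.shift n) ρ.toSub

end

/-- A neutral weak head normal form as an expression. -/
def Neu.toExpr : Neu C → Expr C
  | .const a => .const a
  | .var n => .var n
  | .mvar ρ n => .sub ρ.toSub (.mvar n)
  | .app H L => .app H.toExpr L.toExpr

/-- A weak head normal form as an expression. -/
def Whn.toExpr : Whn C → Expr C
  | .sort s => .sort s
  | .pi ρ η A B => .sub ρ.toSub (.msub η.toMSub (.pi A B))
  | .lam ρ η M => .sub ρ.toSub (.msub η.toMSub (.lam M))
  | .neu H => H.toExpr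

/-- Shifting a closure by `n`. -/
def Closure.shift (n : ℕ) : Closure C → Closure C
  | .var m => .var (n + m)
  | .clo ρ η E => .clo (.shifted n ρ) η E

/-- Shifting a neutral weak head normal form by `n`. -/
def Neu.shift (n : ℕ) : Neu C → Neu C
  | .const a => .const a
  | .var m => .var (n + m)
  | .mvar ρ m => .mvar (.shifted n ρ) m
  | .app H L => .app (H.shift n) (L.shift n)

/-- Lifting an environment under a binder: `([↑¹]ρ, x₁)`. -/
def Env.lift (ρ : Env C) : Env C := .cons (.shifted 1 ρ) (.var 0)

/-! ### Weak head evaluation -/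

/-- The meta-environment form of `⟦η⟧⇑ⁿ`. -/
def MEnv.drop : MEnv C → ℕ → MEnv C
  | .shift m, n => .shift (m + n)
  | .cons η M, 0 => .cons η M
  | .cons η _, n + 1 => η.drop n

/-- The meta-environment form of `⟦η⟧θ`. -/
def MEnv.eval : MEnv C → MSub C → MEnv C
  | η, .shift n => η.drop n
  | η, .cons θ M => .cons (η.eval θ) (.msub η.toMSub M)
  | η, .msub θ θ' => (η.eval θ).eval θ'

/-- The environment form of `[ρ]⟦η⟧σ`. -/
def Env.eval : Env C → MEnv C → Sub C → Env C
  | .shifted k ρ, η, σ => .shifted k (Env.eval ρ η σ)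
  | ρ, _, .shift 0 => ρ
  | .shift k, _, .shift (n + 1) => .shift (k + (n + 1))
  | .cons ρ _, η, .shift (n + 1) => Env.eval ρ η (.shift n)
  | ρ, η, .cons σ M => .cons (Env.eval ρ η σ) (.clo ρ η M)
  | ρ, η, .sub σ τ => Env.eval (Env.eval ρ η σ) η τ
  | ρ, η, .msub θ σ => Env.eval ρ (η.eval θ) σ
termination_by ρ _ σ => (sizeOf σ, sizeOf ρ)

/-- Lookup of a meta-variable in a meta-environment. -/
def MEnv.lookup : MEnv C → ℕ → Expr C
  | .shift n, m => .mvar (n + m)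
  | .cons _ E, 0 => E
  | .cons η _, m + 1 => η.lookup m

/-- Lookup of a variable in an environment. -/
def Env.lookup : Env C → ℕ → Closure C
  | .shift n, m => .var (n + m)
  | .cons _ L, 0 => L
  | .cons ρ _, m + 1 => ρ.lookup m
  | .shifted n ρ, m => (ρ.lookup m).shift n

mutual

/-- `Whnf L W`: weak head evaluation of the closure `L` is defined and yields `W`. -/
inductive Whnf : Closure C → Whn C → Prop
  | gvar {m} : Whnf (.var m) (.neu (.var m))
  | sort {ρ η s} : Whnf (.clo ρ η (.sort s)) (.sort s)
  | const {ρ η a} : Whnf (.clo ρ η (.const a)) (.neu (.const a))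
  | var {ρ η m W} : Whnf (ρ.lookup m) W → Whnf (.clo ρ η (.var m)) W
  | mvar_id {ρ m} : Whnf (.clo ρ (.shift 0) (.mvar m)) (.neu (.mvar ρ m))
  | mvar {ρ η m W} : η ≠ .shift 0 → Whnf (.clo ρ (.shift 0) (η.lookup m)) W →
      Whnf (.clo ρ η (.mvar m)) W
  | pi {ρ η A E} : Whnf (.clo ρ η (.pi A E)) (.pi ρ η A E)
  | lam {ρ η M} : Whnf (.clo ρ η (.lam M)) (.lam ρ η M)
  | app {ρ η M N W W'} : Whnf (.clo ρ η M) W → WApp W (.clo ρ η N) W' →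
      Whnf (.clo ρ η (.app M N)) W'
  | sub {ρ η σ M W} : Whnf (.clo (ρ.eval η σ) η M) W → Whnf (.clo ρ η (.sub σ M)) W
  | msub {ρ η θ M W} : Whnf (.clo ρ (η.eval θ) M) W → Whnf (.clo ρ η (.msub θ M)) W

/-- `WApp W L W'`: evaluation of the application of `W` to `L` is defined and yields `W'`. -/
inductive WApp : Whn C → Closure C → Whn C → Prop
  | beta {ρ η M L W} : Whnf (.clo (.cons ρ L) η M) W → WApp (.lam ρ η M) L W
  | neu {H L} : WApp (.neu H) L (.neu (.app H L))

end

/-! ### Algorithmic equality -/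

mutual

/-- Algorithmic equality of neutral weak head normal forms. -/
inductive AEqN : Neu C → Neu C → Prop
  | const {a} : AEqN (.const a) (.const a)
  | var {m} : AEqN (.var m) (.var m)
  | mvar {ρ ρ' m} : AEqEnv 0 0 ρ ρ' → AEqN (.mvar ρ m) (.mvar ρ' m)
  | app {H H' L L' W W'} : AEqN H H' → Whnf L W → Whnf L' W' → AEqW W W' →
      AEqN (.app H L) (.app H' L')

/-- Algorithmic equality of weak head normal forms. -/
inductive AEqW : Whn C → Whn C → Prop
  | sort {s} : AEqW (.sort s) (.sort s)
  | pi {ρ η A B ρ' η' A' B' V V' W W'} :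
      Whnf (.clo ρ η A) V → Whnf (.clo ρ' η' A') V' → AEqW V V' →
      Whnf (.clo ρ.lift η B) W → Whnf (.clo ρ'.lift η' B') W' → AEqW W W' →
      AEqW (.pi ρ η A B) (.pi ρ' η' A' B')
  | neu {H H'} : AEqN H H' → AEqW (.neu H) (.neu H')
  | lam {ρ η M ρ' η' M' W W'} :
      Whnf (.clo ρ.lift η M) W → Whnf (.clo ρ'.lift η' M') W' → AEqW W W' →
      AEqW (.lam ρ η M) (.lam ρ' η' M')
  | lam_neu {ρ η M H W} :
      Whnf (.clo ρ.lift η M) W → AEqW W (.neu (.app (H.shift 1) (.var 0))) →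
      AEqW (.lam ρ η M) (.neu H)
  | neu_lam {ρ η M H W} :
      Whnf (.clo ρ.lift η M) W → AEqW (.neu (.app (H.shift 1) (.var 0))) W →
      AEqW (.neu H) (.lam ρ η M)

/-- `AEqEnv k k' ρ ρ'`: algorithmic equality of the environments `ρ`, `ρ'` under shifts by `k` and
`k'` respectively. -/
inductive AEqEnv : ℕ → ℕ → Env C → Env C → Prop
  | shift {k k' n n'} : k + n = k' + n' → AEqEnv k k' (.shift n) (.shift n')
  | shifted_left {k k' n ρ ρ'} : AEqEnv (k + n) k' ρ ρ' → AEqEnv k k' (.shifted n ρ) ρ'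
  | shifted_right {k k' n' ρ ρ'} : AEqEnv k (k' + n') ρ ρ' → AEqEnv k k' ρ (.shifted n' ρ')
  | cons {k k' ρ ρ' L L' W W'} : AEqEnv k k' ρ ρ' →
      Whnf (L.shift k) W → Whnf (L'.shift k') W' → AEqW W W' →
      AEqEnv k k' (.cons ρ L) (.cons ρ' L')
  | cons_shift {k k' n' ρ L W} : AEqEnv k k' ρ (.shift (n' + 1)) →
      Whnf (L.shift k) W → AEqW W (.neu (.var (k' + n'))) →
      AEqEnv k k' (.cons ρ L) (.shift n')
  | shift_cons {k k' n ρ' L' W'} : AEqEnv k k' (.shift (n + 1)) ρ' →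
      Whnf (L'.shift k') W' → AEqW (.neu (.var (k + n))) W' →
      AEqEnv k k' (.shift n) (.cons ρ' L')

end

end CMTT

namespace CMTT

section

variable {C : Type u} {Sg : Sig C}

/-! ### Well-formedness of the contexts of a judgment -/

/-- Every tail of `Δ` is a well-formed meta-context. -/
def MCtx.HWF (Sg : Sig C) (Δ : MCtx C) : Prop := ∀ Δ', Δ' <:+ Δ → Der Sg (.mctx Δ')

/-- Every tail of `Δ` and every tail of `Γ` is well-formed. -/
def Ctx.HWF (Sg : Sig C) (Δ : MCtx C) (Γ : Ctx C) : Prop :=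
  MCtx.HWF Sg Δ ∧ ∀ Γ', Γ' <:+ Γ → Der Sg (.ctx Δ Γ')

theorem MCtx.HWF.suffix {Δ Δ' : MCtx C} (h : MCtx.HWF Sg Δ) (hs : Δ' <:+ Δ) : MCtx.HWF Sg Δ' :=
  fun _ h' => h _ (h'.trans hs)

theorem MCtx.HWF.of_append {Δ Δ' : MCtx C} (h : MCtx.HWF Sg (Δ' ++ Δ)) : MCtx.HWF Sg Δ :=
  h.suffix (List.suffix_append _ _)

theorem MCtx.HWF.cons {Δ : MCtx C} {D} (h : MCtx.HWF Sg Δ) (hD : Der Sg (.mctx (D :: Δ))) :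
    MCtx.HWF Sg (D :: Δ) := by
  intro Δ' hs
  rcases List.suffix_cons_iff.1 hs with rfl | hs
  · exact hD
  · exact h _ hs

theorem Ctx.HWF.of_append {Δ : MCtx C} {Γ Γ' : Ctx C} (h : Ctx.HWF Sg Δ (Γ' ++ Γ)) :
    Ctx.HWF Sg Δ Γ :=
  ⟨h.1, fun _ h' => h.2 _ (h'.trans (List.suffix_append _ _))⟩

theorem Ctx.HWF.cons {Δ : MCtx C} {Γ : Ctx C} {A} (h : Ctx.HWF Sg Δ Γ)
    (hA : Der Sg (.ctx Δ (A :: Γ))) : Ctx.HWF Sg Δ (A :: Γ) := by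
  refine ⟨h.1, fun Γ' hs => ?_⟩
  rcases List.suffix_cons_iff.1 hs with rfl | hs
  · exact hA
  · exact h.2 _ hs

theorem Ctx.HWF.tail {Δ : MCtx C} {Γ : Ctx C} {A} (h : Ctx.HWF Sg Δ (A :: Γ)) :
    Ctx.HWF Sg Δ Γ :=
  Ctx.HWF.of_append (Γ' := [A]) h

theorem Ctx.HWF.nil {Δ : MCtx C} (h : MCtx.HWF Sg Δ) : Ctx.HWF Sg Δ [] := by
  refine ⟨h, fun Γ' hs => ?_⟩
  rw [List.suffix_nil.1 hs]
  exact .ctx_nil (h _ (List.suffix_refl _))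

@[simp] theorem Ctx.msub_nil (θ : MSub C) : Ctx.msub θ [] = [] := rfl

@[simp] theorem Ctx.msub_cons (θ : MSub C) (A : Expr C) (Γ : Ctx C) :
    Ctx.msub θ (A :: Γ) = .msub θ A :: Ctx.msub θ Γ := rfl

@[simp] theorem Ctx.msub_append (θ : MSub C) (Γ Γ' : Ctx C) :
    Ctx.msub θ (Γ ++ Γ') = Ctx.msub θ Γ ++ Ctx.msub θ Γ' := List.map_append

@[simp] theorem Ctx.length_msub (θ : MSub C) (Γ : Ctx C) :
    (Ctx.msub θ Γ).length = Γ.length := List.length_map ..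

theorem Der.ctx_type {Δ : MCtx C} {Γ : Ctx C} {A} (h : Der Sg (.ctx Δ (A :: Γ))) :
    Der Sg (.ty Δ Γ A (.sort .type)) := by
  cases h; assumption

theorem Ctx.HWF.msub {Δ Δ' : MCtx C} {θ} (hΔ : MCtx.HWF Sg Δ) (hθ : Der Sg (.tyMSub Δ θ Δ')) :
    ∀ {Γ : Ctx C}, Ctx.HWF Sg Δ' Γ → Ctx.HWF Sg Δ (Ctx.msub θ Γ)
  | [], _ => .nil hΔ
  | _ :: _, h => .cons (.msub hΔ hθ h.tail) <| .ctx_cons <|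
      .ty_conv (.ty_msub hθ (h.2 _ (List.suffix_refl _)).ctx_type)
        (.eq_msub_type hθ (h.tail.2 _ (List.suffix_refl _)))

/-- The contexts of a formation or typing judgment are hereditarily well-formed. -/
def Judgment.CtxHWF (Sg : Sig C) : Judgment C → Prop
  | .mctx Δ => Δ.HWF Sg
  | .ctx Δ Γ => Γ.HWF Sg Δ
  | .ty Δ Γ _ _ => Γ.HWF Sg Δ
  | .tySub Δ Γ _ Ψ => Γ.HWF Sg Δ ∧ Ψ.HWF Sg Δ
  | .tyMSub Δ _ Δ' => Δ.HWF Sg ∧ Δ'.HWF Sg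
  | .eqCtx Δ Γ Γ' => Γ.HWF Sg Δ ∧ Γ'.HWF Sg Δ
  | _ => True

theorem Der.ctxHWF {J : Judgment C} (h : Der Sg J) : J.CtxHWF Sg := by
  induction h with simp only [Judgment.CtxHWF] at *
  | mctx_nil =>
    intro Δ' hs; rw [List.suffix_nil.1 hs]; exact .mctx_nil
  | mctx_cons h ih => exact ih.1.cons (.mctx_cons h)
  | ctx_nil _ ih => exact .nil ih
  | ctx_cons h ih => exact ih.cons (.ctx_cons h)
  | ty_var_zero h ih => exact ih.cons (.ctx_cons h)
  | ty_var_succ _ h _ ih => exact ih.cons (.ctx_cons h)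
  | ty_mvar_zero h ih =>
    exact .msub (ih.1.cons (.mctx_cons h)) (.tyMSub_shift (Δ' := [_]) (.mctx_cons h) rfl) ih
  | ty_mvar_succ _ h ih ih' =>
    exact .msub (ih'.1.cons (.mctx_cons h)) (.tyMSub_shift (Δ' := [_]) (.mctx_cons h) rfl) ih
  | ty_pi _ ih => exact ih.tail
  | ty_lam _ _ ih => exact ih.tail
  | tySub_cons _ h _ ih _ _ => exact ⟨ih.1, ih.2.cons (.ctx_cons h)⟩
  | tyMSub_cons _ h _ ih _ _ => exact ⟨ih.1, ih.2.cons (.mctx_cons h)⟩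
  | eqCtx_nil _ ih => exact ⟨.nil ih, .nil ih⟩
  | eqCtx_cons _ h h' _ ih _ _ _ => exact ⟨ih.1.cons (.ctx_cons h), ih.2.cons (.ctx_cons h')⟩
  | ty_msub hθ _ ih ih' => exact .msub ih.1 hθ ih'
  | tySub_shift _ _ ih => exact ⟨ih, ih.of_append⟩
  | tyMSub_shift _ _ ih => exact ⟨ih, ih.of_append⟩
  | tySub_msub hθ _ ih ih' => exact ⟨.msub ih.1 hθ ih'.1, .msub ih.1 hθ ih'.2⟩
  | tySub_sub _ _ ih ih' => exact ⟨ih.1, ih'.2⟩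
  | tyMSub_msub _ _ ih ih' => exact ⟨ih.1, ih'.2⟩
  | ty_const _ _ ih | ty_type _ ih => exact ih
  | ty_app _ _ ih | ty_conv _ _ ih => exact ih
  | ty_sub _ _ ih => exact ih.1
  | ty_ctx _ _ _ ih => exact ih.2
  | tySub_ctx _ _ _ _ ih ih' => exact ⟨ih.2, ih'.2⟩

theorem Der.mctx_of_ctx {Δ : MCtx C} {Γ} (h : Der Sg (.ctx Δ Γ)) : Der Sg (.mctx Δ) :=
  h.ctxHWF.1 _ (List.suffix_refl _)

theorem Der.ctx_tail {Δ : MCtx C} {Γ A} (h : Der Sg (.ctx Δ (A :: Γ))) : Der Sg (.ctx Δ Γ) :=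
  h.ctxHWF.2 _ (List.suffix_cons _ _)

theorem Der.ctx_of_append {Δ : MCtx C} {Γ Γ'} (h : Der Sg (.ctx Δ (Γ' ++ Γ))) :
    Der Sg (.ctx Δ Γ) :=
  h.ctxHWF.2 _ (List.suffix_append _ _)

theorem Der.mctx_of_append {Δ Δ' : MCtx C} (h : Der Sg (.mctx (Δ' ++ Δ))) : Der Sg (.mctx Δ) :=
  h.ctxHWF _ (List.suffix_append _ _)

theorem Der.ty_ctxWF {Δ : MCtx C} {Γ E F} (h : Der Sg (.ty Δ Γ E F)) : Der Sg (.ctx Δ Γ) :=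
  h.ctxHWF.2 _ (List.suffix_refl _)

theorem Der.tySub_dom {Δ : MCtx C} {Γ σ Ψ} (h : Der Sg (.tySub Δ Γ σ Ψ)) : Der Sg (.ctx Δ Γ) :=
  h.ctxHWF.1.2 _ (List.suffix_refl _)

theorem Der.tySub_cod {Δ : MCtx C} {Γ σ Ψ} (h : Der Sg (.tySub Δ Γ σ Ψ)) : Der Sg (.ctx Δ Ψ) :=
  h.ctxHWF.2.2 _ (List.suffix_refl _)

theorem Der.tyMSub_dom {Δ Δ' : MCtx C} {θ} (h : Der Sg (.tyMSub Δ θ Δ')) : Der Sg (.mctx Δ) :=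
  h.ctxHWF.1 _ (List.suffix_refl _)

theorem Der.tyMSub_cod {Δ Δ' : MCtx C} {θ} (h : Der Sg (.tyMSub Δ θ Δ')) : Der Sg (.mctx Δ') :=
  h.ctxHWF.2 _ (List.suffix_refl _)

/-- In a judgment, the binder type of the first ordinary context is a type. -/
theorem Der.ty_head {Δ : MCtx C} {Γ A E F} (h : Der Sg (.ty Δ (A :: Γ) E F)) :
    Der Sg (.ty Δ Γ A (.sort .type)) :=
  h.ty_ctxWF.ctx_type

theorem Der.ctx_msub {Δ Δ' : MCtx C} {θ Γ} (hθ : Der Sg (.tyMSub Δ θ Δ'))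
    (h : Der Sg (.ctx Δ' Γ)) : Der Sg (.ctx Δ (Ctx.msub θ Γ)) :=
  (Ctx.HWF.msub hθ.ctxHWF.1 hθ h.ctxHWF).2 _ (List.suffix_refl _)

/-! ### `kind` has no classifier -/

/-- No subject of the judgment is `kind`. -/
def Judgment.NoKind : Judgment C → Prop
  | .ty _ _ E _ => E ≠ .sort .kind
  | .eq _ _ E E' _ => E ≠ .sort .kind ∧ E' ≠ .sort .kind
  | _ => True

theorem Der.noKind {J : Judgment C} (h : Der Sg J) : J.NoKind := by
  induction h with simp only [Judgment.NoKind] at *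
  | _ => simp_all

theorem Der.ty_ne_kind {Δ : MCtx C} {Γ E F} (h : Der Sg (.ty Δ Γ E F)) : E ≠ .sort .kind :=
  h.noKind

theorem Der.eq_ne_kind {Δ : MCtx C} {Γ E E' F} (h : Der Sg (.eq Δ Γ E E' F)) :
    E ≠ .sort .kind ∧ E' ≠ .sort .kind :=
  h.noKind

/-! ### Equality of contexts -/

theorem Der.eqCtx_rfl {Δ : MCtx C} : ∀ {Γ : Ctx C}, Der Sg (.ctx Δ Γ) → Der Sg (.eqCtx Δ Γ Γ)
  | [], h => .eqCtx_nil h.mctx_of_ctx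
  | _ :: _, h => .eqCtx_cons (.eqCtx_rfl h.ctx_tail) h.ctx_type h.ctx_type (.eq_refl h.ctx_type)

theorem Der.eqCtx_inv {Δ : MCtx C} {Γ Γ' : Ctx C} {A} (h : Der Sg (.eqCtx Δ (A :: Γ) Γ')) :
    ∃ A' Γ₀, Γ' = A' :: Γ₀ ∧ Der Sg (.eqCtx Δ Γ Γ₀) ∧ Der Sg (.ty Δ Γ A (.sort .type)) ∧
      Der Sg (.ty Δ Γ₀ A' (.sort .type)) ∧ Der Sg (.eq Δ Γ A A' (.sort .type)) := by
  cases h with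
  | eqCtx_cons h₁ h₂ h₃ h₄ => exact ⟨_, _, rfl, h₁, h₂, h₃, h₄⟩

theorem Der.eqCtx_nil_inv {Δ : MCtx C} {Γ' : Ctx C} (h : Der Sg (.eqCtx Δ [] Γ')) : Γ' = [] := by
  cases h; rfl

theorem Der.eqCtx_symm {Δ : MCtx C} : ∀ {Γ Γ' : Ctx C}, Der Sg (.eqCtx Δ Γ Γ') →
    Der Sg (.eqCtx Δ Γ' Γ)
  | [], _, h => by
    obtain rfl := h.eqCtx_nil_inv
    exact h
  | _ :: _, _, h => by
    obtain ⟨_, _, rfl, h₁, h₂, h₃, h₄⟩ := h.eqCtx_inv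
    exact .eqCtx_cons h₁.eqCtx_symm h₃ h₂ (.eq_symm (.eq_ctx h₄ h₁))

theorem Der.eqCtx_trans {Δ : MCtx C} : ∀ {Γ Γ' Γ'' : Ctx C}, Der Sg (.eqCtx Δ Γ Γ') →
    Der Sg (.eqCtx Δ Γ' Γ'') → Der Sg (.eqCtx Δ Γ Γ'')
  | [], _, _, h, h' => by
    obtain rfl := h.eqCtx_nil_inv
    exact h'
  | _ :: _, _, _, h, h' => by
    obtain ⟨_, _, rfl, h₁, h₂, h₃, h₄⟩ := h.eqCtx_inv
    obtain ⟨_, _, rfl, k₁, k₂, k₃, k₄⟩ := h'.eqCtx_inv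
    exact .eqCtx_cons (h₁.eqCtx_trans k₁) h₂ k₃ (.eq_trans h₄ (.eq_ctx k₄ h₁.eqCtx_symm))

/-- Replacing the last type of a context by an equal one. -/
theorem Der.eqCtx_head {Δ : MCtx C} {Γ A A'} (h : Der Sg (.ty Δ Γ A (.sort .type)))
    (h' : Der Sg (.ty Δ Γ A' (.sort .type))) (e : Der Sg (.eq Δ Γ A A' (.sort .type))) :
    Der Sg (.eqCtx Δ (A :: Γ) (A' :: Γ)) :=
  .eqCtx_cons (.eqCtx_rfl h.ty_ctxWF) h h' e

theorem Der.eqCtx_append {Δ : MCtx C} {Γ Γ' : Ctx C} (e : Der Sg (.eqCtx Δ Γ Γ')) :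
    ∀ {Ψ : Ctx C}, Der Sg (.ctx Δ (Ψ ++ Γ)) → Der Sg (.eqCtx Δ (Ψ ++ Γ) (Ψ ++ Γ'))
  | [], _ => e
  | _ :: _, h =>
    have ih := e.eqCtx_append h.ctx_tail
    .eqCtx_cons ih h.ctx_type (.ty_ctx h.ctx_type ih) (.eq_refl h.ctx_type)

theorem Der.eqCtx_append_inv {Δ : MCtx C} {Γ : Ctx C} : ∀ {Ψ Φ : Ctx C},
    Der Sg (.eqCtx Δ (Ψ ++ Γ) Φ) →
      ∃ Ψ' Γ', Φ = Ψ' ++ Γ' ∧ Ψ'.length = Ψ.length ∧ Der Sg (.eqCtx Δ Γ Γ')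
  | [], Φ, h => ⟨[], Φ, rfl, rfl, h⟩
  | _ :: _, _, h => by
    obtain ⟨B, _, rfl, h₁, -⟩ := h.eqCtx_inv
    obtain ⟨Ψ', Γ', rfl, hl, h₂⟩ := h₁.eqCtx_append_inv
    exact ⟨B :: Ψ', Γ', rfl, by simp [hl], h₂⟩

end

section

variable {C : Type u} {Sg : Sig C}

/-! ### Conversion of classifiers -/

/-- Convertibility of classifiers: a chain of equalities at sorts. -/
def Conv (Sg : Sig C) (Δ : MCtx C) (Γ : Ctx C) : Expr C → Expr C → Prop :=
  Relation.ReflTransGen (EqAtSort Sg Δ Γ)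

namespace Conv

variable {Δ : MCtx C} {Γ Γ' : Ctx C} {E E' F F' F'' : Expr C}

theorem rfl : Conv Sg Δ Γ F F := Relation.ReflTransGen.refl

theorem trans (h : Conv Sg Δ Γ F F') (h' : Conv Sg Δ Γ F' F'') : Conv Sg Δ Γ F F'' :=
  Relation.ReflTransGen.trans h h'

theorem of_eq {s} (h : Der Sg (.eq Δ Γ F F' (.sort s))) : Conv Sg Δ Γ F F' :=
  Relation.ReflTransGen.single ⟨s, h⟩

theorem symm (h : Conv Sg Δ Γ F F') : Conv Sg Δ Γ F' F := by
  induction h with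
  | refl => exact rfl
  | tail _ e ih =>
    obtain ⟨s, e⟩ := e
    exact (of_eq (.eq_symm e)).trans ih

theorem ctx (h : Conv Sg Δ Γ F F') (e : Der Sg (.eqCtx Δ Γ Γ')) : Conv Sg Δ Γ' F F' := by
  induction h with
  | refl => exact rfl
  | tail _ e' ih =>
    obtain ⟨s, e'⟩ := e'
    exact ih.trans (of_eq (.eq_ctx e' e))

theorem ty (h : Conv Sg Δ Γ F F') (hE : Der Sg (.ty Δ Γ E F)) : Der Sg (.ty Δ Γ E F') := by
  induction h with
  | refl => exact hE
  | tail _ e ih =>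
    obtain ⟨s, e⟩ := e
    exact .ty_conv ih e

theorem eq (h : Conv Sg Δ Γ F F') (hE : Der Sg (.eq Δ Γ E E' F)) : Der Sg (.eq Δ Γ E E' F') := by
  induction h with
  | refl => exact hE
  | tail _ e ih =>
    obtain ⟨s, e⟩ := e
    exact .eq_conv ih e

theorem eq_kind_iff (h : Conv Sg Δ Γ F F') : F = .sort .kind ↔ F' = .sort .kind := by
  induction h with
  | refl => exact Iff.rfl
  | tail _ e ih =>
    obtain ⟨s, e⟩ := e
    exact ih.trans ⟨fun h => absurd h e.eq_ne_kind.1, fun h => absurd h e.eq_ne_kind.2⟩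

end Conv

/-- `F` can classify expressions: it is `kind`, a kind, or a type. -/
def IsCls (Sg : Sig C) (Δ : MCtx C) (Γ : Ctx C) (F : Expr C) : Prop :=
  F = .sort .kind ∨ ∃ s, Der Sg (.ty Δ Γ F (.sort s))

theorem Expr.subCls_of_ne {F : Expr C} (h : F ≠ .sort .kind) (σ : Sub C) :
    F.subCls σ = .sub σ F := by
  unfold Expr.subCls; split <;> simp_all

theorem Expr.msubCls_of_ne {F : Expr C} (h : F ≠ .sort .kind) (θ : MSub C) :
    F.msubCls θ = .msub θ F := by
  unfold Expr.msubCls; split <;> simp_all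

@[simp] theorem Expr.subCls_kind (σ : Sub C) :
    Expr.subCls σ (.sort .kind) = .sort .kind := rfl

@[simp] theorem Expr.msubCls_kind (θ : MSub C) :
    Expr.msubCls θ (.sort .kind) = .sort .kind := rfl

theorem Expr.subCls_eq_kind {F : Expr C} {σ : Sub C} :
    F.subCls σ = .sort .kind ↔ F = .sort .kind := by
  by_cases h : F = .sort .kind
  · simp [h]
  · simp [Expr.subCls_of_ne h, h]

theorem Expr.msubCls_eq_kind {F : Expr C} {θ : MSub C} :
    F.msubCls θ = .sort .kind ↔ F = .sort .kind := by
  by_cases h : F = .sort .kind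
  · simp [h]
  · simp [Expr.msubCls_of_ne h, h]

section Substitution

variable {Δ Δ' Δ'' : MCtx C} {Γ Γ' Ψ Φ : Ctx C} {σ σ' τ τ' : Sub C} {θ θ' : MSub C}
  {A A' B B' E E' F F' M N : Expr C} {s : Srt}

theorem Conv.sub_sort (hσ : Der Sg (.tySub Δ Γ σ Ψ)) :
    ∀ {s}, Conv Sg Δ Γ (Expr.subCls σ (.sort s)) (.sort s)
  | .kind => .rfl
  | .type => .of_eq (.eq_sub_type hσ)

theorem Conv.msub_sort (hθ : Der Sg (.tyMSub Δ θ Δ')) (hΓ : Der Sg (.ctx Δ' Γ)) :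
    ∀ {s}, Conv Sg Δ (Ctx.msub θ Γ) (Expr.msubCls θ (.sort s)) (.sort s)
  | .kind => .rfl
  | .type => .of_eq (.eq_msub_type hθ hΓ)

theorem Der.ty_sub_sort (hσ : Der Sg (.tySub Δ Γ σ Ψ)) (h : Der Sg (.ty Δ Ψ A (.sort s))) :
    Der Sg (.ty Δ Γ (.sub σ A) (.sort s)) :=
  (Conv.sub_sort hσ).ty (.ty_sub hσ h)

theorem Der.ty_msub_sort (hθ : Der Sg (.tyMSub Δ θ Δ')) (h : Der Sg (.ty Δ' Γ A (.sort s))) :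
    Der Sg (.ty Δ (Ctx.msub θ Γ) (.msub θ A) (.sort s)) :=
  (Conv.msub_sort hθ h.ty_ctxWF).ty (.ty_msub hθ h)

theorem Der.eq_sub_sort (hσ : Der Sg (.tySub Δ Γ σ Ψ)) (e : Der Sg (.eqSub Δ Γ σ σ' Ψ))
    (h : Der Sg (.eq Δ Ψ A A' (.sort s))) : Der Sg (.eq Δ Γ (.sub σ A) (.sub σ' A') (.sort s)) :=
  (Conv.sub_sort hσ).eq (.eq_sub e h)

theorem Der.eq_msub_sort (hθ : Der Sg (.tyMSub Δ θ Δ')) (hΓ : Der Sg (.ctx Δ' Γ))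
    (e : Der Sg (.eqMSub Δ θ θ' Δ')) (h : Der Sg (.eq Δ' Γ A A' (.sort s))) :
    Der Sg (.eq Δ (Ctx.msub θ Γ) (.msub θ A) (.msub θ' A') (.sort s)) :=
  (Conv.msub_sort hθ hΓ).eq (.eq_msub e h)

theorem Der.eq_sub_left (hσ : Der Sg (.tySub Δ Γ σ Ψ)) (e : Der Sg (.eqSub Δ Γ σ σ' Ψ))
    (h : Der Sg (.ty Δ Ψ A (.sort s))) : Der Sg (.eq Δ Γ (.sub σ A) (.sub σ' A) (.sort s)) :=
  .eq_sub_sort hσ e (.eq_refl h)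

theorem Der.eq_sub_right (hσ : Der Sg (.tySub Δ Γ σ Ψ)) (h : Der Sg (.eq Δ Ψ A A' (.sort s))) :
    Der Sg (.eq Δ Γ (.sub σ A) (.sub σ A') (.sort s)) :=
  .eq_sub_sort hσ (.eqSub_refl hσ) h

theorem Der.eq_msub_right (hθ : Der Sg (.tyMSub Δ θ Δ')) (hΓ : Der Sg (.ctx Δ' Γ))
    (h : Der Sg (.eq Δ' Γ A A' (.sort s))) :
    Der Sg (.eq Δ (Ctx.msub θ Γ) (.msub θ A) (.msub θ A') (.sort s)) :=
  .eq_msub_sort hθ hΓ (.eqMSub_refl hθ) h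

theorem Der.eq_sub_comp_sort (hσ : Der Sg (.tySub Δ Γ σ Ψ)) (hτ : Der Sg (.tySub Δ Ψ τ Φ))
    (h : Der Sg (.ty Δ Φ A (.sort s))) :
    Der Sg (.eq Δ Γ (.sub σ (.sub τ A)) (.sub (.sub σ τ) A) (.sort s)) :=
  (Conv.sub_sort (.tySub_sub hσ hτ)).eq (.eq_sub_comp hσ hτ h)

theorem Der.eq_msub_sub_sort (hθ : Der Sg (.tyMSub Δ θ Δ')) (hσ : Der Sg (.tySub Δ' Γ σ Ψ))
    (h : Der Sg (.ty Δ' Ψ A (.sort s))) :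
    Der Sg (.eq Δ (Ctx.msub θ Γ) (.msub θ (.sub σ A)) (.sub (.msub θ σ) (.msub θ A))
      (.sort s)) := by
  have e := Der.eq_msub_sub hθ hσ h
  cases s with
  | kind => exact e
  | type =>
    have hs := Der.tySub_msub hθ hσ
    exact .eq_conv (.eq_conv e (.eq_sub_right hs (.eq_msub_type hθ hσ.tySub_cod)))
      (.eq_sub_type hs)

/-! #### Equality of contexts under meta-substitutions -/

theorem Der.eqCtx_msub_comp (hθ : Der Sg (.tyMSub Δ θ Δ')) (hθ' : Der Sg (.tyMSub Δ' θ' Δ'')) :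
    ∀ {Γ : Ctx C}, Der Sg (.ctx Δ'' Γ) →
      Der Sg (.eqCtx Δ (Ctx.msub θ (Ctx.msub θ' Γ)) (Ctx.msub (.msub θ θ') Γ))
  | [], _ => .eqCtx_nil hθ.tyMSub_dom
  | A :: Γ, h => by
    have ih := eqCtx_msub_comp hθ hθ' h.ctx_tail
    have hc := Der.tyMSub_msub hθ hθ'
    refine .eqCtx_cons ih (.ty_msub_sort hθ (.ty_msub_sort hθ' h.ctx_type))
      (.ty_msub_sort hc h.ctx_type) ?_
    refine .eq_ctx ?_ ih.eqCtx_symm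
    exact (Conv.msub_sort hc h.ctx_tail).eq (.eq_msub_comp hθ hθ' h.ctx_type)

theorem Der.eqCtx_msub (hθ : Der Sg (.tyMSub Δ θ Δ')) (hθ' : Der Sg (.tyMSub Δ θ' Δ'))
    (e : Der Sg (.eqMSub Δ θ θ' Δ')) : ∀ {Γ : Ctx C}, Der Sg (.ctx Δ' Γ) →
      Der Sg (.eqCtx Δ (Ctx.msub θ Γ) (Ctx.msub θ' Γ))
  | [], _ => .eqCtx_nil hθ.tyMSub_dom
  | _ :: _, h =>
    .eqCtx_cons (eqCtx_msub hθ hθ' e h.ctx_tail) (.ty_msub_sort hθ h.ctx_type)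
      (.ty_msub_sort hθ' h.ctx_type) (.eq_msub_sort hθ h.ctx_tail e (.eq_refl h.ctx_type))

theorem Der.eqCtx_msub_right (hθ : Der Sg (.tyMSub Δ θ Δ')) : ∀ {Γ Γ' : Ctx C},
    Der Sg (.eqCtx Δ' Γ Γ') → Der Sg (.eqCtx Δ (Ctx.msub θ Γ) (Ctx.msub θ Γ'))
  | [], _, h => by
    obtain rfl := h.eqCtx_nil_inv
    exact .eqCtx_nil hθ.tyMSub_dom
  | _ :: _, _, h => by
    obtain ⟨_, _, rfl, h₁, h₂, h₃, h₄⟩ := h.eqCtx_inv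
    exact .eqCtx_cons (eqCtx_msub_right hθ h₁) (.ty_msub_sort hθ h₂) (.ty_msub_sort hθ h₃)
      (.eq_msub_right hθ h₂.ty_ctxWF h₄)

theorem Der.tyMSub_id (h : Der Sg (.mctx Δ)) : Der Sg (.tyMSub Δ (.shift 0) Δ) :=
  .tyMSub_shift (Δ' := []) h rfl

theorem Der.tySub_id (h : Der Sg (.ctx Δ Γ)) : Der Sg (.tySub Δ Γ (.shift 0) Γ) :=
  .tySub_shift (Γ := []) h rfl

theorem Der.eqCtx_msub_id : ∀ {Γ : Ctx C}, Der Sg (.ctx Δ Γ) →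
    Der Sg (.eqCtx Δ (Ctx.msub (.shift 0) Γ) Γ)
  | [], h => .eqCtx_nil h.mctx_of_ctx
  | A :: Γ, h => by
    have ih := eqCtx_msub_id h.ctx_tail
    exact .eqCtx_cons ih (.ty_msub_sort (.tyMSub_id h.mctx_of_ctx) h.ctx_type) h.ctx_type
      (.eq_ctx (.eq_msub_id h.ctx_type) ih.eqCtx_symm)

/-! #### Lifted and extended substitutions -/

theorem Der.tySub_wk (h : Der Sg (.ty Δ Γ A (.sort .type))) :
    Der Sg (.tySub Δ (A :: Γ) (.shift 1) Γ) :=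
  .tySub_shift (Γ := [A]) (.ctx_cons h) rfl

theorem Der.tyMSub_wk (h : Der Sg (.ty Δ Γ A (.sort .type))) :
    Der Sg (.tyMSub ((Γ, A) :: Δ) (.shift 1) Δ) :=
  .tyMSub_shift (Δ' := [_]) (.mctx_cons h) rfl

theorem Der.ty_var_zero_sub (hσ : Der Sg (.tySub Δ Γ σ Ψ)) (hA : Der Sg (.ty Δ Ψ A (.sort .type))) :
    Der Sg (.ty Δ (.sub σ A :: Γ) (.var 0) (.sub (.sub (.shift 1) σ) A)) :=
  have h := Der.ty_sub_sort hσ hA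
  .ty_conv (.ty_var_zero h) (.eq_sub_comp_sort (.tySub_wk h) hσ hA)

theorem Der.tySub_lift (hσ : Der Sg (.tySub Δ Γ σ Ψ)) (hA : Der Sg (.ty Δ Ψ A (.sort .type))) :
    Der Sg (.tySub Δ (.sub σ A :: Γ) σ.lift (A :: Ψ)) :=
  .tySub_cons (.tySub_sub (.tySub_wk (.ty_sub_sort hσ hA)) hσ) hA (.ty_var_zero_sub hσ hA)

theorem Der.eqSub_lift (hσ : Der Sg (.tySub Δ Γ σ Ψ)) (e : Der Sg (.eqSub Δ Γ σ σ' Ψ))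
    (hA : Der Sg (.ty Δ Ψ A (.sort .type))) :
    Der Sg (.eqSub Δ (.sub σ A :: Γ) σ.lift σ'.lift (A :: Ψ)) :=
  .eqSub_cons (.eq_refl (.ty_var_zero_sub hσ hA)) hA
    (.eqSub_sub (.eqSub_refl (.tySub_wk (.ty_sub_sort hσ hA))) e)

theorem Der.ty_sub_id_sort (hN : Der Sg (.ty Δ Γ N A)) (hA : Der Sg (.ty Δ Γ A (.sort s))) :
    Der Sg (.ty Δ Γ N (.sub (.shift 0) A)) :=
  .ty_conv hN (.eq_symm (.eq_sub_id hA))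

theorem Der.tySub_single (hN : Der Sg (.ty Δ Γ N A)) (hA : Der Sg (.ty Δ Γ A (.sort .type))) :
    Der Sg (.tySub Δ Γ (.single N) (A :: Γ)) :=
  .tySub_cons (.tySub_id hN.ty_ctxWF) hA (hN.ty_sub_id_sort hA)

theorem Der.eqSub_single (hN : Der Sg (.eq Δ Γ N N' A)) (hA : Der Sg (.ty Δ Γ A (.sort .type))) :
    Der Sg (.eqSub Δ Γ (.single N) (.single N') (A :: Γ)) :=
  .eqSub_cons (.eq_conv hN (.eq_symm (.eq_sub_id hA))) hA
    (.eqSub_refl (.tySub_id hA.ty_ctxWF))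

theorem Der.eqSub_cons_wk (h : Der Sg (.tySub Δ Γ (.cons σ M) (A :: Ψ)))
    (hσ : Der Sg (.tySub Δ Γ σ Ψ)) :
    Der Sg (.eqSub Δ Γ (.sub (.cons σ M) (.shift 1)) σ Ψ) :=
  .eqSub_trans (.eqSub_cons_shift (Ψ' := []) h rfl) (.eqSub_id_right hσ)

theorem Der.tySub_cons_sub (hτ : Der Sg (.tySub Δ Γ τ Φ)) (hσ : Der Sg (.tySub Δ Φ σ Ψ))
    (hA : Der Sg (.ty Δ Ψ A (.sort .type))) (hN : Der Sg (.ty Δ Γ N (.sub τ (.sub σ A)))) :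
    Der Sg (.tySub Δ Γ (.cons (.sub τ σ) N) (A :: Ψ)) :=
  .tySub_cons (.tySub_sub hτ hσ) hA (.ty_conv hN (.eq_sub_comp_sort hτ hσ hA))

theorem Der.eqSub_cons_lift (hτ : Der Sg (.tySub Δ Γ τ Φ)) (hσ : Der Sg (.tySub Δ Φ σ Ψ))
    (hA : Der Sg (.ty Δ Ψ A (.sort .type))) (hN : Der Sg (.ty Δ Γ N (.sub τ (.sub σ A)))) :
    Der Sg (.eqSub Δ Γ (.sub (.cons τ N) σ.lift) (.cons (.sub τ σ) N) (A :: Ψ)) := by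
  have hσA := Der.ty_sub_sort hσ hA
  have hc := Der.tySub_cons hτ hσA hN
  have hw := Der.tySub_wk hσA
  have e₁ : Der Sg (.eqSub Δ Γ (.sub (.cons τ N) (.sub (.shift 1) σ)) (.sub τ σ) Ψ) :=
    .eqSub_trans (.eqSub_assoc hc hw hσ) (.eqSub_sub (.eqSub_cons_wk hc hτ) (.eqSub_refl hσ))
  have hs := Der.tySub_sub hc (Der.tySub_sub hw hσ)
  refine .eqSub_trans (.eqSub_sub_cons hc (.tySub_lift hσ hA)) (.eqSub_cons ?_ hA e₁)
  exact .eq_conv (.eq_conv (.eq_sub_var_zero hτ hσA hN) (.eq_sub_comp_sort hτ hσ hA))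
    (.eq_symm (.eq_sub_left hs e₁ hA))

theorem Der.eqSub_lift_id (hA : Der Sg (.ty Δ Γ A (.sort .type))) :
    Der Sg (.eqSub Δ (.sub (.shift 0) A :: Γ) (Sub.shift 0).lift (.shift 0) (A :: Γ)) := by
  have hid := Der.tySub_id hA.ty_ctxWF
  have hA' := Der.ty_sub_sort hid hA
  have hw := Der.tySub_wk hA'
  have e := Der.eqCtx_head hA hA' (.eq_symm (.eq_sub_id hA))
  refine .eqSub_trans (.eqSub_cons (.eq_refl (.ty_var_zero_sub hid hA)) hA (.eqSub_id_right hw)) ?_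
  exact .eqSub_symm (.eqSub_ctx (.eqSub_eta (Γ' := []) (.ctx_cons hA) rfl) e
    (.eqCtx_rfl (.ctx_cons hA)))

theorem Der.eqSub_lift_comp (hσ : Der Sg (.tySub Δ Γ σ Ψ)) (hτ : Der Sg (.tySub Δ Ψ τ Φ))
    (hA : Der Sg (.ty Δ Φ A (.sort .type))) :
    Der Sg (.eqSub Δ (.sub σ (.sub τ A) :: Γ) (.sub σ.lift τ.lift) (Sub.lift (.sub σ τ))
      (A :: Φ)) := by
  have hτA := Der.ty_sub_sort hτ hA
  have hσA := Der.ty_sub_sort hσ hτA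
  have hw := Der.tySub_wk hσA
  have hs := Der.tySub_sub hw hσ
  have hv := Der.ty_var_zero_sub hσ hτA
  exact .eqSub_trans (.eqSub_cons_lift hs hτ hA hv)
    (.eqSub_cons (.eq_refl (.ty_conv hv (.eq_sub_comp_sort hs hτ hA))) hA
      (.eqSub_symm (.eqSub_assoc hw hσ hτ)))

theorem Der.eqSub_msub_wk (hθ : Der Sg (.tyMSub Δ θ Δ')) (hA : Der Sg (.ty Δ' Γ A (.sort .type))) :
    Der Sg (.eqSub Δ (.msub θ A :: Ctx.msub θ Γ) (.msub θ (.shift 1)) (.shift 1)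
      (Ctx.msub θ Γ)) :=
  .eqSub_msub_shift (Γ' := [A]) hθ (.ctx_cons hA) rfl

theorem Der.eqSub_msub_id (hθ : Der Sg (.tyMSub Δ θ Δ')) (hΓ : Der Sg (.ctx Δ' Γ)) :
    Der Sg (.eqSub Δ (Ctx.msub θ Γ) (.msub θ (.shift 0)) (.shift 0) (Ctx.msub θ Γ)) :=
  .eqSub_msub_shift (Γ' := []) hθ hΓ rfl

theorem Der.eqSub_msub_lift (hθ : Der Sg (.tyMSub Δ θ Δ')) (hσ : Der Sg (.tySub Δ' Γ σ Ψ))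
    (hA : Der Sg (.ty Δ' Ψ A (.sort .type))) :
    Der Sg (.eqSub Δ (.msub θ (.sub σ A) :: Ctx.msub θ Γ) (.msub θ σ.lift) (Sub.lift (.msub θ σ))
      (.msub θ A :: Ctx.msub θ Ψ)) := by
  have hσA := Der.ty_sub_sort hσ hA
  have hw := Der.tySub_wk hσA
  have hs := Der.tySub_sub hw hσ
  have hv := Der.ty_var_zero_sub hσ hA
  have e₁ : Der Sg (.eqSub Δ (.msub θ (.sub σ A) :: Ctx.msub θ Γ) (.msub θ (.sub (.shift 1) σ))
      (.sub (.shift 1) (.msub θ σ)) (Ctx.msub θ Ψ)) :=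
    .eqSub_trans (.eqSub_msub_sub hθ hw hσ)
      (.eqSub_sub (.eqSub_msub_wk hθ hσA) (.eqSub_refl (.tySub_msub hθ hσ)))
  refine .eqSub_trans (.eqSub_msub_cons hθ hs hA hv) (.eqSub_cons ?_ (.ty_msub_sort hθ hA) e₁)
  exact .eq_conv (.eq_msub_var hθ hv) (.eq_msub_sub_sort hθ hs hA)

/-! #### Single substitutions -/

theorem Der.eqSub_single_lift (hσ : Der Sg (.tySub Δ Γ σ Ψ))
    (hA : Der Sg (.ty Δ Ψ A (.sort .type))) (hN : Der Sg (.ty Δ Γ N (.sub σ A))) :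
    Der Sg (.eqSub Δ Γ (.sub (.single N) σ.lift) (.cons σ N) (A :: Ψ)) := by
  have hid := Der.tySub_id hσ.tySub_dom
  have hN' := hN.ty_sub_id_sort (.ty_sub_sort hσ hA)
  exact .eqSub_trans (.eqSub_cons_lift hid hσ hA hN')
    (.eqSub_cons (.eq_refl (.ty_conv hN' (.eq_sub_comp_sort hid hσ hA))) hA (.eqSub_id_left hσ))

theorem Der.eqSub_sub_single (hσ : Der Sg (.tySub Δ Γ σ Ψ))
    (hA : Der Sg (.ty Δ Ψ A (.sort .type))) (hN : Der Sg (.ty Δ Ψ N A)) :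
    Der Sg (.eqSub Δ Γ (.sub σ (.single N)) (.cons σ (.sub σ N)) (A :: Ψ)) := by
  have hid := Der.tySub_id hA.ty_ctxWF
  have hN' := hN.ty_sub_id_sort hA
  refine .eqSub_trans (.eqSub_sub_cons hσ (.tySub_single hN hA)) ?_
  refine .eqSub_cons (.eq_refl ?_) hA (.eqSub_id_right hσ)
  exact .ty_conv (.ty_sub hσ hN') (.eq_sub_comp_sort hσ hid hA)

theorem Der.eqSub_msub_single (hθ : Der Sg (.tyMSub Δ θ Δ'))
    (hA : Der Sg (.ty Δ' Γ A (.sort .type))) (hN : Der Sg (.ty Δ' Γ N A)) :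
    Der Sg (.eqSub Δ (Ctx.msub θ Γ) (.msub θ (.single N)) (.single (.msub θ N))
      (.msub θ A :: Ctx.msub θ Γ)) := by
  have hid := Der.tySub_id hA.ty_ctxWF
  have hN' := hN.ty_sub_id_sort hA
  refine .eqSub_trans (.eqSub_msub_cons hθ hid hA hN') ?_
  refine .eqSub_cons (.eq_refl ?_) (.ty_msub_sort hθ hA) (.eqSub_msub_id hθ hA.ty_ctxWF)
  exact .ty_conv (.ty_msub hθ hN') (.eq_msub_sub_sort hθ hid hA)

/-- `[↑¹]` followed by instantiation with the last variable is the identity. -/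
theorem Der.eqSub_single_lift_wk (hA : Der Sg (.ty Δ Γ A (.sort .type))) :
    Der Sg (.eqSub Δ (A :: Γ) (.sub (.single (.var 0)) (Sub.shift 1).lift) (.shift 0)
      (A :: Γ)) :=
  .eqSub_trans (.eqSub_single_lift (.tySub_wk hA) hA (.ty_var_zero hA))
    (.eqSub_symm (.eqSub_eta (Γ' := []) (.ctx_cons hA) rfl))

end Substitution

end

section

variable {C : Type u} {Sg : Sig C}

/-! ### Inversion of typing -/

/-- What the typing of an expression says about its components. -/
def Expr.Inv (Sg : Sig C) (Δ : MCtx C) (Γ : Ctx C) : Expr C → Expr C → Prop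
  | .sort s, F => s = .type ∧ F = .sort .kind
  | .const a, F => ∃ K, (a, K) ∈ Sg ∧ Conv Sg Δ Γ K F
  | .pi A B, F => ∃ s, Der Sg (.ty Δ (A :: Γ) B (.sort s)) ∧ Conv Sg Δ Γ (.sort s) F
  | .var 0, F => ∃ A Γ', Γ = A :: Γ' ∧ Der Sg (.ty Δ Γ' A (.sort .type)) ∧
      Conv Sg Δ Γ (.sub (.shift 1) A) F
  | .var (n + 1), F => ∃ A B Γ', Γ = B :: Γ' ∧ Der Sg (.ty Δ Γ' B (.sort .type)) ∧
      Der Sg (.ty Δ Γ' (.var n) A) ∧ Conv Sg Δ Γ (.sub (.shift 1) A) F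
  | .mvar 0, F => ∃ Δ' Ψ A, Δ = (Ψ, A) :: Δ' ∧ Der Sg (.ty Δ' Ψ A (.sort .type)) ∧
      Der Sg (.eqCtx Δ (Ctx.msub (.shift 1) Ψ) Γ) ∧ Conv Sg Δ Γ (.msub (.shift 1) A) F
  | .mvar (n + 1), F => ∃ Δ' Ψ B Γ' A, Δ = (Ψ, B) :: Δ' ∧ Der Sg (.ty Δ' Ψ B (.sort .type)) ∧
      Der Sg (.ty Δ' Γ' (.mvar n) A) ∧
      Der Sg (.eqCtx Δ (Ctx.msub (.shift 1) Γ') Γ) ∧ Conv Sg Δ Γ (.msub (.shift 1) A) F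
  | .lam M, F => ∃ A B, Der Sg (.ty Δ (A :: Γ) M B) ∧ Der Sg (.ty Δ (A :: Γ) B (.sort .type)) ∧
      Conv Sg Δ Γ (.pi A B) F
  | .app E N, F => ∃ A B, Der Sg (.ty Δ Γ E (.pi A B)) ∧ Der Sg (.ty Δ Γ N A) ∧
      Conv Sg Δ Γ (.sub (.single N) B) F
  | .sub σ E, F => ∃ Ψ F', Der Sg (.tySub Δ Γ σ Ψ) ∧ Der Sg (.ty Δ Ψ E F') ∧
      Conv Sg Δ Γ (F'.subCls σ) F
  | .msub θ E, F => ∃ Δ' Γ' F', Der Sg (.tyMSub Δ θ Δ') ∧ Der Sg (.ty Δ' Γ' E F') ∧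
      Der Sg (.eqCtx Δ (Ctx.msub θ Γ') Γ) ∧ Conv Sg Δ Γ (F'.msubCls θ) F

/-- What the typing of a substitution says about its components. -/
def Sub.Inv (Sg : Sig C) (Δ : MCtx C) (Γ Ψ : Ctx C) : Sub C → Prop
  | .shift n => ∃ Γ' Ψ', Γ = Γ' ++ Ψ' ∧ Γ'.length = n ∧ Der Sg (.eqCtx Δ Ψ' Ψ)
  | .cons σ M => ∃ Ψ' A, Der Sg (.tySub Δ Γ σ Ψ') ∧ Der Sg (.ty Δ Ψ' A (.sort .type)) ∧
      Der Sg (.ty Δ Γ M (.sub σ A)) ∧ Der Sg (.eqCtx Δ (A :: Ψ') Ψ)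
  | .sub τ σ => ∃ Ψ', Der Sg (.tySub Δ Γ τ Ψ') ∧ Der Sg (.tySub Δ Ψ' σ Ψ)
  | .msub θ σ => ∃ Δ' Γ' Ψ', Der Sg (.tyMSub Δ θ Δ') ∧ Der Sg (.tySub Δ' Γ' σ Ψ') ∧
      Der Sg (.eqCtx Δ (Ctx.msub θ Γ') Γ) ∧ Der Sg (.eqCtx Δ (Ctx.msub θ Ψ') Ψ)

theorem Expr.Inv.conv {Δ : MCtx C} {Γ : Ctx C} {F F' : Expr C} (c : Conv Sg Δ Γ F F') :
    ∀ {E : Expr C}, E.Inv Sg Δ Γ F → E.Inv Sg Δ Γ F'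
  | .sort _, ⟨h, h'⟩ => ⟨h, c.eq_kind_iff.1 h'⟩
  | .const _, ⟨_, h, h'⟩ => ⟨_, h, h'.trans c⟩
  | .pi _ _, ⟨_, h, h'⟩ => ⟨_, h, h'.trans c⟩
  | .var 0, ⟨_, _, h₁, h₂, h'⟩ => ⟨_, _, h₁, h₂, h'.trans c⟩
  | .var (_ + 1), ⟨_, _, _, h₁, h₂, h₃, h'⟩ => ⟨_, _, _, h₁, h₂, h₃, h'.trans c⟩
  | .mvar 0, ⟨_, _, _, h₁, h₂, h₃, h'⟩ => ⟨_, _, _, h₁, h₂, h₃, h'.trans c⟩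
  | .mvar (_ + 1), ⟨_, _, _, _, _, h₁, h₂, h₃, h₄, h'⟩ =>
    ⟨_, _, _, _, _, h₁, h₂, h₃, h₄, h'.trans c⟩
  | .lam _, ⟨_, _, h₁, h₂, h'⟩ => ⟨_, _, h₁, h₂, h'.trans c⟩
  | .app _ _, ⟨_, _, h₁, h₂, h'⟩ => ⟨_, _, h₁, h₂, h'.trans c⟩
  | .sub _ _, ⟨_, _, h₁, h₂, h'⟩ => ⟨_, _, h₁, h₂, h'.trans c⟩
  | .msub _ _, ⟨_, _, _, h₁, h₂, h₃, h'⟩ => ⟨_, _, _, h₁, h₂, h₃, h'.trans c⟩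

theorem Der.eqCtx_cons_of_head {Δ : MCtx C} {Γ Γ' : Ctx C} {A : Expr C}
    (e : Der Sg (.eqCtx Δ Γ Γ')) (h : Der Sg (.ty Δ Γ A (.sort .type))) :
    Der Sg (.eqCtx Δ (A :: Γ) (A :: Γ')) :=
  .eqCtx_cons e h (.ty_ctx h e) (.eq_refl h)

theorem Expr.Inv.ctx {Δ : MCtx C} {Γ Γ' : Ctx C} {F : Expr C} (e : Der Sg (.eqCtx Δ Γ Γ')) :
    ∀ {E : Expr C}, E.Inv Sg Δ Γ F → E.Inv Sg Δ Γ' F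
  | .sort _, h => h
  | .const _, ⟨_, h, h'⟩ => ⟨_, h, h'.ctx e⟩
  | .pi _ _, ⟨_, h, h'⟩ => ⟨_, .ty_ctx h (.eqCtx_cons_of_head e h.ty_head), h'.ctx e⟩
  | .var 0, ⟨_, _, h₁, h₂, h'⟩ => by
    subst h₁
    obtain ⟨B, Γ', rfl, e₁, e₂, e₃, e₄⟩ := e.eqCtx_inv
    exact ⟨_, _, rfl, e₃, .trans (.of_eq (.eq_sub_right (.tySub_wk e₃)
      (.eq_symm (.eq_ctx e₄ e₁)))) (h'.ctx e)⟩
  | .var (_ + 1), ⟨_, _, _, h₁, h₂, h₃, h'⟩ => by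
    subst h₁
    obtain ⟨B, Γ', rfl, e₁, e₂, e₃, e₄⟩ := e.eqCtx_inv
    exact ⟨_, _, _, rfl, e₃, .ty_ctx h₃ e₁, h'.ctx e⟩
  | .mvar 0, ⟨_, _, _, h₁, h₂, h₃, h'⟩ => ⟨_, _, _, h₁, h₂, h₃.eqCtx_trans e, h'.ctx e⟩
  | .mvar (_ + 1), ⟨_, _, _, _, _, h₁, h₂, h₃, h₄, h'⟩ =>
    ⟨_, _, _, _, _, h₁, h₂, h₃, h₄.eqCtx_trans e, h'.ctx e⟩
  | .lam _, ⟨_, _, h₁, h₂, h'⟩ =>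
    have e' := Der.eqCtx_cons_of_head e h₁.ty_head
    ⟨_, _, .ty_ctx h₁ e', .ty_ctx h₂ e', h'.ctx e⟩
  | .app _ _, ⟨_, _, h₁, h₂, h'⟩ => ⟨_, _, .ty_ctx h₁ e, .ty_ctx h₂ e, h'.ctx e⟩
  | .sub _ _, ⟨_, _, h₁, h₂, h'⟩ =>
    ⟨_, _, .tySub_ctx h₁ e (.eqCtx_rfl h₁.tySub_cod), h₂, h'.ctx e⟩
  | .msub _ _, ⟨_, _, _, h₁, h₂, h₃, h'⟩ => ⟨_, _, _, h₁, h₂, h₃.eqCtx_trans e, h'.ctx e⟩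

theorem Sub.Inv.ctx {Δ : MCtx C} {Γ Γ' Ψ Ψ' : Ctx C} (e : Der Sg (.eqCtx Δ Γ Γ'))
    (e' : Der Sg (.eqCtx Δ Ψ Ψ')) : ∀ {σ : Sub C}, σ.Inv Sg Δ Γ Ψ → σ.Inv Sg Δ Γ' Ψ'
  | .shift _, ⟨_, _, h₁, h₂, h₃⟩ => by
    subst h₁
    obtain ⟨Γ₁, Γ₂, rfl, hl, e₂⟩ := e.eqCtx_append_inv
    exact ⟨_, _, rfl, hl.trans h₂, e₂.eqCtx_symm.eqCtx_trans (h₃.eqCtx_trans e')⟩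
  | .cons _ _, ⟨_, _, h₁, h₂, h₃, h₄⟩ =>
    ⟨_, _, .tySub_ctx h₁ e (.eqCtx_rfl h₁.tySub_cod), h₂, .ty_ctx h₃ e, h₄.eqCtx_trans e'⟩
  | .sub _ _, ⟨_, h₁, h₂⟩ =>
    ⟨_, .tySub_ctx h₁ e (.eqCtx_rfl h₁.tySub_cod), .tySub_ctx h₂ (.eqCtx_rfl h₂.tySub_dom) e'⟩
  | .msub _ _, ⟨_, _, _, h₁, h₂, h₃, h₄⟩ =>
    ⟨_, _, _, h₁, h₂, h₃.eqCtx_trans e, h₄.eqCtx_trans e'⟩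

/-- Inversion of a judgment. -/
def Judgment.Inv (Sg : Sig C) : Judgment C → Prop
  | .ty Δ Γ E F => E.Inv Sg Δ Γ F
  | .tySub Δ Γ σ Ψ => σ.Inv Sg Δ Γ Ψ
  | _ => True

theorem Der.inv {J : Judgment C} (h : Der Sg J) : J.Inv Sg := by
  induction h with
  | ty_type _ _ => exact ⟨rfl, rfl⟩
  | ty_const _ h _ => exact ⟨_, h, .rfl⟩
  | ty_pi h _ => exact ⟨_, h, .rfl⟩
  | ty_var_zero h _ => exact ⟨_, _, rfl, h, .rfl⟩
  | ty_var_succ h h' _ _ => exact ⟨_, _, _, rfl, h', h, .rfl⟩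
  | ty_mvar_zero h _ =>
    exact ⟨_, _, _, rfl, h, .eqCtx_rfl (.ctx_msub (.tyMSub_wk h) h.ty_ctxWF), .rfl⟩
  | ty_mvar_succ h h' _ _ =>
    exact ⟨_, _, _, _, _, rfl, h', h, .eqCtx_rfl (.ctx_msub (.tyMSub_wk h') h.ty_ctxWF), .rfl⟩
  | ty_lam h h' _ _ => exact ⟨_, _, h, h', .rfl⟩
  | ty_app h h' _ _ => exact ⟨_, _, h, h', .rfl⟩
  | ty_sub h h' _ _ => exact ⟨_, _, h, h', .rfl⟩
  | ty_msub h h' _ _ =>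
    exact ⟨_, _, _, h, h', .eqCtx_rfl (.ctx_msub h h'.ty_ctxWF), .rfl⟩
  | ty_conv _ e ih _ => exact Expr.Inv.conv (.of_eq e) ih
  | ty_ctx _ e ih _ => exact Expr.Inv.ctx e ih
  | tySub_shift h hl _ => exact ⟨_, _, rfl, hl, .eqCtx_rfl h.ctx_of_append⟩
  | tySub_cons h h' h'' _ _ _ => exact ⟨_, _, h, h', h'', .eqCtx_rfl (.ctx_cons h')⟩
  | tySub_sub h h' _ _ => exact ⟨_, h, h'⟩
  | tySub_msub h h' _ _ =>
    exact ⟨_, _, _, h, h', .eqCtx_rfl (.ctx_msub h h'.tySub_dom),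
      .eqCtx_rfl (.ctx_msub h h'.tySub_cod)⟩
  | tySub_ctx _ e e' ih _ _ => exact Sub.Inv.ctx e e' ih
  | _ => exact trivial

section

variable {Δ : MCtx C} {Γ Ψ : Ctx C} {A B E F M N : Expr C} {σ τ : Sub C} {θ : MSub C} {n : ℕ}

theorem Der.sort_inv {s} (h : Der Sg (.ty Δ Γ (.sort s) F)) : s = .type ∧ F = .sort .kind :=
  h.inv

theorem Der.const_inv {a} (h : Der Sg (.ty Δ Γ (.const a) F)) :
    ∃ K, (a, K) ∈ Sg ∧ Conv Sg Δ Γ K F :=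
  h.inv

theorem Der.pi_inv (h : Der Sg (.ty Δ Γ (.pi A B) F)) :
    ∃ s, Der Sg (.ty Δ (A :: Γ) B (.sort s)) ∧ Conv Sg Δ Γ (.sort s) F :=
  h.inv

theorem Der.var_zero_inv (h : Der Sg (.ty Δ Γ (.var 0) F)) :
    ∃ A Γ', Γ = A :: Γ' ∧ Der Sg (.ty Δ Γ' A (.sort .type)) ∧
      Conv Sg Δ Γ (.sub (.shift 1) A) F :=
  h.inv

theorem Der.var_succ_inv (h : Der Sg (.ty Δ Γ (.var (n + 1)) F)) :
    ∃ A B Γ', Γ = B :: Γ' ∧ Der Sg (.ty Δ Γ' B (.sort .type)) ∧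
      Der Sg (.ty Δ Γ' (.var n) A) ∧ Conv Sg Δ Γ (.sub (.shift 1) A) F :=
  h.inv

theorem Der.mvar_zero_inv (h : Der Sg (.ty Δ Γ (.mvar 0) F)) :
    ∃ Δ' Ψ A, Δ = (Ψ, A) :: Δ' ∧ Der Sg (.ty Δ' Ψ A (.sort .type)) ∧
      Der Sg (.eqCtx Δ (Ctx.msub (.shift 1) Ψ) Γ) ∧ Conv Sg Δ Γ (.msub (.shift 1) A) F :=
  h.inv

theorem Der.mvar_succ_inv (h : Der Sg (.ty Δ Γ (.mvar (n + 1)) F)) :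
    ∃ Δ' Ψ B Γ' A, Δ = (Ψ, B) :: Δ' ∧ Der Sg (.ty Δ' Ψ B (.sort .type)) ∧
      Der Sg (.ty Δ' Γ' (.mvar n) A) ∧
      Der Sg (.eqCtx Δ (Ctx.msub (.shift 1) Γ') Γ) ∧ Conv Sg Δ Γ (.msub (.shift 1) A) F :=
  h.inv

theorem Der.lam_inv (h : Der Sg (.ty Δ Γ (.lam M) F)) :
    ∃ A B, Der Sg (.ty Δ (A :: Γ) M B) ∧ Der Sg (.ty Δ (A :: Γ) B (.sort .type)) ∧
      Conv Sg Δ Γ (.pi A B) F :=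
  h.inv

theorem Der.app_inv (h : Der Sg (.ty Δ Γ (.app E N) F)) :
    ∃ A B, Der Sg (.ty Δ Γ E (.pi A B)) ∧ Der Sg (.ty Δ Γ N A) ∧
      Conv Sg Δ Γ (.sub (.single N) B) F :=
  h.inv

theorem Der.sub_inv (h : Der Sg (.ty Δ Γ (.sub σ E) F)) :
    ∃ Ψ F', Der Sg (.tySub Δ Γ σ Ψ) ∧ Der Sg (.ty Δ Ψ E F') ∧ Conv Sg Δ Γ (F'.subCls σ) F :=
  h.inv

theorem Der.msub_inv (h : Der Sg (.ty Δ Γ (.msub θ E) F)) :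
    ∃ Δ' Γ' F', Der Sg (.tyMSub Δ θ Δ') ∧ Der Sg (.ty Δ' Γ' E F') ∧
      Der Sg (.eqCtx Δ (Ctx.msub θ Γ') Γ) ∧ Conv Sg Δ Γ (F'.msubCls θ) F :=
  h.inv

theorem Der.shift_inv (h : Der Sg (.tySub Δ Γ (.shift n) Ψ)) :
    ∃ Γ' Ψ', Γ = Γ' ++ Ψ' ∧ Γ'.length = n ∧ Der Sg (.eqCtx Δ Ψ' Ψ) :=
  h.inv

theorem Der.cons_inv (h : Der Sg (.tySub Δ Γ (.cons σ M) Ψ)) :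
    ∃ Ψ' A, Der Sg (.tySub Δ Γ σ Ψ') ∧ Der Sg (.ty Δ Ψ' A (.sort .type)) ∧
      Der Sg (.ty Δ Γ M (.sub σ A)) ∧ Der Sg (.eqCtx Δ (A :: Ψ') Ψ) :=
  h.inv

theorem Der.tySub_sub_inv (h : Der Sg (.tySub Δ Γ (.sub τ σ) Ψ)) :
    ∃ Ψ', Der Sg (.tySub Δ Γ τ Ψ') ∧ Der Sg (.tySub Δ Ψ' σ Ψ) :=
  h.inv

theorem Der.tySub_msub_inv (h : Der Sg (.tySub Δ Γ (.msub θ σ) Ψ)) :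
    ∃ Δ' Γ' Ψ', Der Sg (.tyMSub Δ θ Δ') ∧ Der Sg (.tySub Δ' Γ' σ Ψ') ∧
      Der Sg (.eqCtx Δ (Ctx.msub θ Γ') Γ) ∧ Der Sg (.eqCtx Δ (Ctx.msub θ Ψ') Ψ) :=
  h.inv

end

end

section

variable {C : Type u} {Sg : Sig C}

/-! ### Classifiers of closures -/

section

variable {Δ Δ' Δ'' : MCtx C} {Γ Γ' Ψ Φ : Ctx C} {σ σ' τ τ' : Sub C} {θ θ' : MSub C}
  {A A' B B' E E' F F' M M' N N' : Expr C} {s : Srt} {n : ℕ}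

theorem IsCls.sort (hΓ : Der Sg (.ctx Δ Γ)) : ∀ {s}, IsCls Sg Δ Γ (.sort s)
  | .kind => .inl rfl
  | .type => .inr ⟨.kind, .ty_type hΓ⟩

theorem IsCls.ctx (h : IsCls Sg Δ Γ F) (e : Der Sg (.eqCtx Δ Γ Γ')) : IsCls Sg Δ Γ' F :=
  h.imp_right fun ⟨s, h⟩ => ⟨s, .ty_ctx h e⟩

theorem IsCls.sub (hσ : Der Sg (.tySub Δ Γ σ Ψ)) (h : IsCls Sg Δ Ψ F) :
    IsCls Sg Δ Γ (F.subCls σ) := by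
  rcases h with rfl | ⟨s, h⟩
  · exact .inl rfl
  · rw [Expr.subCls_of_ne h.ty_ne_kind]
    exact .inr ⟨s, .ty_sub_sort hσ h⟩

theorem IsCls.msub (hθ : Der Sg (.tyMSub Δ θ Δ')) (h : IsCls Sg Δ' Γ F) :
    IsCls Sg Δ (Ctx.msub θ Γ) (F.msubCls θ) := by
  rcases h with rfl | ⟨s, h⟩
  · exact .inl rfl
  · rw [Expr.msubCls_of_ne h.ty_ne_kind]
    exact .inr ⟨s, .ty_msub_sort hθ h⟩

theorem IsCls.of_ty (h : Der Sg (.ty Δ Γ F (.sort s))) : IsCls Sg Δ Γ F := .inr ⟨s, h⟩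

theorem Conv.subCls_left (h : IsCls Sg Δ Ψ F) (hσ : Der Sg (.tySub Δ Γ σ Ψ))
    (e : Der Sg (.eqSub Δ Γ σ σ' Ψ)) : Conv Sg Δ Γ (F.subCls σ) (F.subCls σ') := by
  rcases h with rfl | ⟨s, h⟩
  · exact .rfl
  · rw [Expr.subCls_of_ne h.ty_ne_kind, Expr.subCls_of_ne h.ty_ne_kind]
    exact .of_eq (.eq_sub_left hσ e h)

theorem Conv.subCls_right (hσ : Der Sg (.tySub Δ Γ σ Ψ)) (h : Conv Sg Δ Ψ F F') :
    Conv Sg Δ Γ (F.subCls σ) (F'.subCls σ) := by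
  induction h with
  | refl => exact .rfl
  | tail _ e ih =>
    obtain ⟨s, e⟩ := e
    refine ih.trans ?_
    rw [Expr.subCls_of_ne e.eq_ne_kind.1, Expr.subCls_of_ne e.eq_ne_kind.2]
    exact .of_eq (.eq_sub_right hσ e)

theorem Conv.subCls_comp (hσ : Der Sg (.tySub Δ Γ σ Ψ)) (hτ : Der Sg (.tySub Δ Ψ τ Φ))
    (h : IsCls Sg Δ Φ F) : Conv Sg Δ Γ ((F.subCls τ).subCls σ) (F.subCls (.sub σ τ)) := by
  rcases h with rfl | ⟨s, h⟩
  · exact .rfl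
  · rw [Expr.subCls_of_ne h.ty_ne_kind, Expr.subCls_of_ne h.ty_ne_kind,
      Expr.subCls_of_ne (by simp)]
    exact .of_eq (.eq_sub_comp_sort hσ hτ h)

theorem Conv.subCls_id (h : IsCls Sg Δ Γ F) : Conv Sg Δ Γ (F.subCls (.shift 0)) F := by
  rcases h with rfl | ⟨s, h⟩
  · exact .rfl
  · rw [Expr.subCls_of_ne h.ty_ne_kind]
    exact .of_eq (.eq_sub_id h)

theorem Conv.msubCls_left (hΓ : Der Sg (.ctx Δ' Γ)) (h : IsCls Sg Δ' Γ F)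
    (hθ : Der Sg (.tyMSub Δ θ Δ')) (e : Der Sg (.eqMSub Δ θ θ' Δ')) :
    Conv Sg Δ (Ctx.msub θ Γ) (F.msubCls θ) (F.msubCls θ') := by
  rcases h with rfl | ⟨s, h⟩
  · exact .rfl
  · rw [Expr.msubCls_of_ne h.ty_ne_kind, Expr.msubCls_of_ne h.ty_ne_kind]
    exact .of_eq (.eq_msub_sort hθ hΓ e (.eq_refl h))

theorem Conv.msubCls_right (hθ : Der Sg (.tyMSub Δ θ Δ')) (hΓ : Der Sg (.ctx Δ' Γ))
    (h : Conv Sg Δ' Γ F F') : Conv Sg Δ (Ctx.msub θ Γ) (F.msubCls θ) (F'.msubCls θ) := by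
  induction h with
  | refl => exact .rfl
  | tail _ e ih =>
    obtain ⟨s, e⟩ := e
    refine ih.trans ?_
    rw [Expr.msubCls_of_ne e.eq_ne_kind.1, Expr.msubCls_of_ne e.eq_ne_kind.2]
    exact .of_eq (.eq_msub_right hθ hΓ e)

theorem Der.eq_msub_comp_sort (hθ : Der Sg (.tyMSub Δ θ Δ')) (hθ' : Der Sg (.tyMSub Δ' θ' Δ''))
    (h : Der Sg (.ty Δ'' Γ A (.sort s))) :
    Der Sg (.eq Δ (Ctx.msub (.msub θ θ') Γ) (.msub θ (.msub θ' A)) (.msub (.msub θ θ') A)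
      (.sort s)) :=
  (Conv.msub_sort (.tyMSub_msub hθ hθ') h.ty_ctxWF).eq (.eq_msub_comp hθ hθ' h)

theorem Conv.msubCls_comp (hθ : Der Sg (.tyMSub Δ θ Δ')) (hθ' : Der Sg (.tyMSub Δ' θ' Δ''))
    (h : IsCls Sg Δ'' Γ F) :
    Conv Sg Δ (Ctx.msub (.msub θ θ') Γ) ((F.msubCls θ').msubCls θ) (F.msubCls (.msub θ θ')) := by
  rcases h with rfl | ⟨s, h⟩
  · exact .rfl
  · rw [Expr.msubCls_of_ne h.ty_ne_kind, Expr.msubCls_of_ne h.ty_ne_kind,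
      Expr.msubCls_of_ne (by simp)]
    exact .of_eq (.eq_msub_comp_sort hθ hθ' h)

theorem Conv.msubCls_id (h : IsCls Sg Δ Γ F) : Conv Sg Δ Γ (F.msubCls (.shift 0)) F := by
  rcases h with rfl | ⟨s, h⟩
  · exact .rfl
  · rw [Expr.msubCls_of_ne h.ty_ne_kind]
    exact .of_eq (.eq_msub_id h)

theorem Conv.msubCls_subCls (hθ : Der Sg (.tyMSub Δ θ Δ')) (hσ : Der Sg (.tySub Δ' Γ σ Ψ))
    (h : IsCls Sg Δ' Ψ F) :
    Conv Sg Δ (Ctx.msub θ Γ) ((F.subCls σ).msubCls θ) ((F.msubCls θ).subCls (.msub θ σ)) := by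
  rcases h with rfl | ⟨s, h⟩
  · exact .rfl
  · rw [Expr.subCls_of_ne h.ty_ne_kind, Expr.msubCls_of_ne h.ty_ne_kind,
      Expr.subCls_of_ne (by simp), Expr.msubCls_of_ne (by simp)]
    exact .of_eq (.eq_msub_sub_sort hθ hσ h)

/-! #### Classifiers of variables, constants and functions -/

theorem Der.var_cls_ne_kind (h : Der Sg (.ty Δ Γ (.var n) F)) : F ≠ .sort .kind := by
  intro hF
  cases n with
  | zero =>
    obtain ⟨A, Γ', -, -, c⟩ := h.var_zero_inv
    exact absurd (c.eq_kind_iff.2 hF) (by simp)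
  | succ n =>
    obtain ⟨A, B, Γ', -, -, -, c⟩ := h.var_succ_inv
    exact absurd (c.eq_kind_iff.2 hF) (by simp)

theorem Der.mvar_cls_ne_kind (h : Der Sg (.ty Δ Γ (.mvar n) F)) : F ≠ .sort .kind := by
  intro hF
  cases n with
  | zero =>
    obtain ⟨_, _, _, -, -, -, c⟩ := h.mvar_zero_inv
    exact absurd (c.eq_kind_iff.2 hF) (by simp)
  | succ n =>
    obtain ⟨_, _, _, _, _, -, -, -, -, c⟩ := h.mvar_succ_inv
    exact absurd (c.eq_kind_iff.2 hF) (by simp)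

theorem IsCls.pi_inv (h : IsCls Sg Δ Γ (.pi A B)) :
    ∃ s, Der Sg (.ty Δ (A :: Γ) B (.sort s)) := by
  rcases h with h | ⟨s, h⟩
  · cases h
  · obtain ⟨s', h, -⟩ := h.pi_inv
    exact ⟨s', h⟩

theorem IsCls.pi (h : Der Sg (.ty Δ (A :: Γ) B (.sort s))) : IsCls Sg Δ Γ (.pi A B) :=
  .of_ty (.ty_pi h)

theorem Der.tySub_cons_inv (h : Der Sg (.tySub Δ Γ (.cons σ M) (A :: Ψ))) :
    Der Sg (.tySub Δ Γ σ Ψ) ∧ Der Sg (.ty Δ Ψ A (.sort .type)) ∧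
      Der Sg (.ty Δ Γ M (.sub σ A)) := by
  obtain ⟨Ψ', A', h₁, h₂, h₃, e⟩ := h.cons_inv
  obtain ⟨_, _, h, e₁, e₂, e₃, e₄⟩ := e.eqCtx_inv
  cases h
  have hσ : Der Sg (.tySub Δ Γ σ Ψ) := .tySub_ctx h₁ (.eqCtx_rfl h₁.tySub_dom) e₁
  exact ⟨hσ, e₃, .ty_conv h₃ (.eq_sub_right hσ (.eq_ctx e₄ e₁))⟩

theorem Der.tyMSub_cons_inv (h : Der Sg (.tyMSub Δ (.cons θ M) ((Γ, A) :: Δ'))) :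
    Der Sg (.tyMSub Δ θ Δ') ∧ Der Sg (.ty Δ' Γ A (.sort .type)) ∧
      Der Sg (.ty Δ (Ctx.msub θ Γ) M (.msub θ A)) := by
  cases h with
  | tyMSub_cons h₁ h₂ h₃ => exact ⟨h₁, h₂, h₃⟩

theorem Der.tySub_shift_cons (h : Der Sg (.ctx Δ (Γ' ++ A :: Γ))) :
    Der Sg (.tySub Δ (Γ' ++ A :: Γ) (.shift (Γ'.length + 1)) Γ) := by
  have := Der.tySub_shift (Γ := Γ' ++ [A]) (Ψ := Γ) (Sg := Sg) (Δ := Δ) (n := Γ'.length + 1)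
    (by simpa using h) (by simp)
  simpa using this

theorem Der.eqSub_wk_shift (h : Der Sg (.ctx Δ (B :: (Γ' ++ A :: Γ)))) :
    Der Sg (.eqSub Δ (B :: (Γ' ++ A :: Γ)) (.sub (.shift 1) (.shift (Γ'.length + 1)))
      (.shift (Γ'.length + 1 + 1)) Γ) := by
  have := Der.eqSub_shift_shift (Γ₂ := [B]) (Γ₁ := Γ' ++ [A]) (Γ := Γ) (Sg := Sg) (Δ := Δ)
    (n := 1) (m := Γ'.length + 1) (by simpa using h) (by simp) rfl
  simpa [Nat.add_comm 1] using this

theorem Der.eq_wk_shift (h : Der Sg (.ctx Δ (B :: (Γ' ++ A :: Γ)))) :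
    Der Sg (.eq Δ (B :: (Γ' ++ A :: Γ)) (.sub (.shift 1) (.sub (.shift (Γ'.length + 1)) A))
      (.sub (.shift (Γ'.length + 1 + 1)) A) (.sort .type)) := by
  have hA := (h.ctx_of_append (Γ' := B :: Γ')).ctx_type
  have hs := Der.tySub_shift_cons h.ctx_tail
  have hw := Der.tySub_wk h.ctx_type
  exact .eq_trans (.eq_sub_comp_sort hw hs hA)
    (.eq_sub_left (.tySub_sub hw hs) (.eqSub_wk_shift h) hA)

theorem Der.ty_var_length : ∀ {Γ' : Ctx C}, Der Sg (.ctx Δ (Γ' ++ A :: Γ)) →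
    Der Sg (.ty Δ (Γ' ++ A :: Γ) (.var Γ'.length) (.sub (.shift (Γ'.length + 1)) A))
  | [], h => .ty_var_zero h.ctx_type
  | _ :: _, h =>
    .ty_conv (.ty_var_succ (ty_var_length h.ctx_tail) h.ctx_type) (.eq_wk_shift h)

/-- The type of a variable is the corresponding entry of the context, shifted. -/
theorem Der.var_inv : ∀ {n : ℕ} {Γ : Ctx C} {F}, Der Sg (.ty Δ Γ (.var n) F) →
    ∃ Γ₂ A Γ₁, Γ = Γ₂ ++ A :: Γ₁ ∧ Γ₂.length = n ∧ Conv Sg Δ Γ (.sub (.shift (n + 1)) A) F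
  | 0, _, _, h => by
    obtain ⟨A, Γ', rfl, hA, c⟩ := h.var_zero_inv
    exact ⟨[], A, Γ', rfl, rfl, c⟩
  | n + 1, _, _, h => by
    have hΓ := h.ty_ctxWF
    obtain ⟨A', B, Γ', rfl, hB, hA, c⟩ := h.var_succ_inv
    have hne := hA.var_cls_ne_kind
    obtain ⟨Γ₂, A, Γ₁, rfl, rfl, c'⟩ := hA.var_inv
    refine ⟨B :: Γ₂, A, Γ₁, rfl, rfl, .trans (.symm ?_) c⟩
    have c'' := c'.symm.subCls_right (.tySub_wk hB)
    rw [Expr.subCls_of_ne hne, Expr.subCls_of_ne (by simp)] at c''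
    exact c''.trans (.of_eq (.eq_wk_shift hΓ))

theorem Der.tyMSub_shift_cons (h : Der Sg (.mctx (Δ' ++ (Γ, A) :: Δ))) :
    Der Sg (.tyMSub (Δ' ++ (Γ, A) :: Δ) (.shift (Δ'.length + 1)) Δ) := by
  have := Der.tyMSub_shift (Δ' := Δ' ++ [(Γ, A)]) (Δ := Δ) (Sg := Sg) (n := Δ'.length + 1)
    (by simpa using h) (by simp)
  simpa using this

theorem Der.mctx_type (h : Der Sg (.mctx ((Γ, A) :: Δ))) : Der Sg (.ty Δ Γ A (.sort .type)) := by
  cases h; assumption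

theorem Der.eqMSub_wk_shift {D} (h : Der Sg (.mctx (D :: (Δ' ++ (Γ, A) :: Δ)))) :
    Der Sg (.eqMSub (D :: (Δ' ++ (Γ, A) :: Δ)) (.msub (.shift 1) (.shift (Δ'.length + 1)))
      (.shift (Δ'.length + 1 + 1)) Δ) := by
  have := Der.eqMSub_shift_shift (Δ₂ := [D]) (Δ₁ := Δ' ++ [(Γ, A)]) (Δ := Δ) (Sg := Sg)
    (n := 1) (m := Δ'.length + 1) (by simpa using h) (by simp) rfl
  simpa [Nat.add_comm 1] using this

theorem Der.eqCtx_mwk_shift {D} (h : Der Sg (.mctx (D :: (Δ' ++ (Γ, A) :: Δ)))) :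
    Der Sg (.eqCtx (D :: (Δ' ++ (Γ, A) :: Δ))
      (Ctx.msub (.shift 1) (Ctx.msub (.shift (Δ'.length + 1)) Γ))
      (Ctx.msub (.shift (Δ'.length + 1 + 1)) Γ)) := by
  obtain ⟨Ψ, B⟩ := D
  have hB := h.mctx_type
  have hm := hB.ty_ctxWF.mctx_of_ctx
  have hΓ := hm.mctx_of_append.mctx_type.ty_ctxWF
  have hs := Der.tyMSub_shift_cons hm
  have hw := Der.tyMSub_wk hB
  have hr := Der.tyMSub_shift_cons (Δ' := (Ψ, B) :: Δ') h
  exact (Der.eqCtx_msub_comp hw hs hΓ).eqCtx_trans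
    (.eqCtx_msub (.tyMSub_msub hw hs) hr (.eqMSub_wk_shift h) hΓ)

theorem Der.eq_mwk_shift {D} (h : Der Sg (.mctx (D :: (Δ' ++ (Γ, A) :: Δ)))) :
    Der Sg (.eq (D :: (Δ' ++ (Γ, A) :: Δ)) (Ctx.msub (.shift (Δ'.length + 1 + 1)) Γ)
      (.msub (.shift 1) (.msub (.shift (Δ'.length + 1)) A))
      (.msub (.shift (Δ'.length + 1 + 1)) A) (.sort .type)) := by
  obtain ⟨Ψ, B⟩ := D
  have hB := h.mctx_type
  have hm := hB.ty_ctxWF.mctx_of_ctx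
  have hA := hm.mctx_of_append.mctx_type
  have hs := Der.tyMSub_shift_cons hm
  have hw := Der.tyMSub_wk hB
  have hc := Der.tyMSub_msub hw hs
  have hr := Der.tyMSub_shift_cons (Δ' := (Ψ, B) :: Δ') h
  refine .eq_ctx ?_ (Der.eqCtx_msub hc hr (.eqMSub_wk_shift h) hA.ty_ctxWF)
  exact .eq_trans (.eq_msub_comp_sort hw hs hA)
    (.eq_msub_sort hc hA.ty_ctxWF (.eqMSub_wk_shift h) (.eq_refl hA))

theorem Der.ty_mvar_length : ∀ {Δ' : MCtx C}, Der Sg (.mctx (Δ' ++ (Γ, A) :: Δ)) →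
    Der Sg (.ty (Δ' ++ (Γ, A) :: Δ) (Ctx.msub (.shift (Δ'.length + 1)) Γ) (.mvar Δ'.length)
      (.msub (.shift (Δ'.length + 1)) A))
  | [], h => .ty_mvar_zero h.mctx_type
  | (_, _) :: _, h =>
    .ty_conv (.ty_ctx (.ty_mvar_succ (ty_mvar_length h.mctx_type.ty_ctxWF.mctx_of_ctx) h.mctx_type)
      (.eqCtx_mwk_shift h)) (.eq_mwk_shift h)

/-- The context and the type of a meta-variable are those of its declaration, shifted. -/
theorem Der.mvar_inv : ∀ {n : ℕ} {Δ : MCtx C} {Γ : Ctx C} {F}, Der Sg (.ty Δ Γ (.mvar n) F) →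
    ∃ Δ₂ Ψ A Δ₁, Δ = Δ₂ ++ (Ψ, A) :: Δ₁ ∧ Δ₂.length = n ∧
      Der Sg (.eqCtx Δ (Ctx.msub (.shift (n + 1)) Ψ) Γ) ∧
      Conv Sg Δ Γ (.msub (.shift (n + 1)) A) F
  | 0, _, _, _, h => by
    obtain ⟨Δ', Ψ, A, rfl, hA, e, c⟩ := h.mvar_zero_inv
    exact ⟨[], Ψ, A, Δ', rfl, rfl, e, c⟩
  | n + 1, _, _, _, h => by
    have hΔ := h.ty_ctxWF.mctx_of_ctx
    obtain ⟨Δ', Ψ, B, Γ', A', rfl, hB, hA, e, c⟩ := h.mvar_succ_inv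
    have hne := hA.mvar_cls_ne_kind
    obtain ⟨Δ₂, Φ, A, Δ₁, rfl, rfl, e', c'⟩ := hA.mvar_inv
    have hw := Der.tyMSub_wk hB
    have e₁ := (Der.eqCtx_msub_right hw e').eqCtx_trans e
    refine ⟨(Ψ, B) :: Δ₂, Φ, A, Δ₁, rfl, rfl, (Der.eqCtx_mwk_shift hΔ).eqCtx_symm.eqCtx_trans e₁,
      .trans (.symm ?_) c⟩
    have c'' := c'.symm.msubCls_right hw hA.ty_ctxWF
    rw [Expr.msubCls_of_ne hne, Expr.msubCls_of_ne (by simp)] at c''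
    refine (c''.ctx e).trans ?_
    exact (Conv.of_eq (Der.eq_mwk_shift hΔ)).ctx ((Der.eqCtx_mwk_shift hΔ).eqCtx_symm.eqCtx_trans e₁)

theorem Der.ty_var_msub (hθ : Der Sg (.tyMSub Δ θ Δ')) (h : Der Sg (.ty Δ' Γ (.var n) F)) :
    Der Sg (.ty Δ (Ctx.msub θ Γ) (.var n) (.msub θ F)) := by
  have hΓ := h.ty_ctxWF
  have hne := h.var_cls_ne_kind
  obtain ⟨Γ₂, A, Γ₁, rfl, rfl, c⟩ := h.var_inv
  have hA := hΓ.ctx_of_append.ctx_type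
  have hs := Der.tySub_shift_cons hΓ
  have c' := c.msubCls_right hθ hΓ
  rw [Expr.msubCls_of_ne hne, Expr.msubCls_of_ne (by simp)] at c'
  have hΓ' := Der.ctx_msub hθ hΓ
  have e : Der Sg (.eqSub Δ (Ctx.msub θ (Γ₂ ++ A :: Γ₁)) (.msub θ (.shift (Γ₂.length + 1)))
      (.shift (Γ₂.length + 1)) (Ctx.msub θ Γ₁)) := by
    have := Der.eqSub_msub_shift (Γ' := Γ₂ ++ [A]) (Γ := Γ₁) hθ (by simpa using hΓ)
      (n := Γ₂.length + 1) (by simp)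
    simpa using this
  refine c'.ty ?_
  have hv := Der.ty_var_length (Γ' := Ctx.msub θ Γ₂) (A := .msub θ A) (Γ := Ctx.msub θ Γ₁)
    (by simpa using hΓ')
  rw [Ctx.length_msub] at hv
  rw [Ctx.msub_append, Ctx.msub_cons] at e ⊢
  refine .ty_conv hv (s := .type) (.eq_symm ?_)
  have h₁ := Der.eq_msub_sub_sort hθ hs hA
  have h₂ := Der.tySub_msub hθ hs
  rw [Ctx.msub_append, Ctx.msub_cons] at h₁ h₂
  exact .eq_trans h₁ (.eq_sub_left h₂ e (.ty_msub_sort hθ hA))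

end

/-! ### Validity of the rules -/

/-- `E : F`, where `F` is a classifier. -/
def VTy (Sg : Sig C) (Δ : MCtx C) (Γ : Ctx C) (E F : Expr C) : Prop :=
  Der Sg (.ty Δ Γ E F) ∧ IsCls Sg Δ Γ F

/-- `E ≡ E' : F`, where `F` is a classifier, and both sides have it. -/
def VEq (Sg : Sig C) (Δ : MCtx C) (Γ : Ctx C) (E E' F : Expr C) : Prop :=
  Der Sg (.eq Δ Γ E E' F) ∧ Der Sg (.ty Δ Γ E F) ∧ Der Sg (.ty Δ Γ E' F) ∧ IsCls Sg Δ Γ F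

/-- `σ ≡ σ' : Ψ`, where both sides are well-typed. -/
def VEqSub (Sg : Sig C) (Δ : MCtx C) (Γ : Ctx C) (σ σ' : Sub C) (Ψ : Ctx C) : Prop :=
  Der Sg (.eqSub Δ Γ σ σ' Ψ) ∧ Der Sg (.tySub Δ Γ σ Ψ) ∧ Der Sg (.tySub Δ Γ σ' Ψ)

/-- `θ ≡ θ' : Δ'`, where both sides are well-typed. -/
def VEqMSub (Sg : Sig C) (Δ : MCtx C) (θ θ' : MSub C) (Δ' : MCtx C) : Prop :=
  Der Sg (.eqMSub Δ θ θ' Δ') ∧ Der Sg (.tyMSub Δ θ Δ') ∧ Der Sg (.tyMSub Δ θ' Δ')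

section

variable {Δ Δ' Δ'' : MCtx C} {Γ Γ' Ψ Ψ' Φ : Ctx C} {σ σ' τ τ' : Sub C} {θ θ' θ₁ θ₂ : MSub C}
  {A A' B B' E E' F F' M M' N N' : Expr C} {s : Srt} {n m : ℕ}

theorem VTy.ctx (h : VTy Sg Δ Γ E F) (e : Der Sg (.eqCtx Δ Γ Γ')) : VTy Sg Δ Γ' E F :=
  ⟨.ty_ctx h.1 e, h.2.ctx e⟩

theorem VEq.ctx (h : VEq Sg Δ Γ E E' F) (e : Der Sg (.eqCtx Δ Γ Γ')) : VEq Sg Δ Γ' E E' F :=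
  ⟨.eq_ctx h.1 e, .ty_ctx h.2.1 e, .ty_ctx h.2.2.1 e, h.2.2.2.ctx e⟩

theorem VEqSub.ctx (h : VEqSub Sg Δ Γ σ σ' Ψ) (e : Der Sg (.eqCtx Δ Γ Γ'))
    (e' : Der Sg (.eqCtx Δ Ψ Ψ')) : VEqSub Sg Δ Γ' σ σ' Ψ' :=
  ⟨.eqSub_ctx h.1 e e', .tySub_ctx h.2.1 e e', .tySub_ctx h.2.2 e e'⟩

theorem VTy.wk (h : Der Sg (.ty Δ Γ B (.sort .type))) (hA : VTy Sg Δ Γ (.var n) A) :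
    VTy Sg Δ (B :: Γ) (.var (n + 1)) (.sub (.shift 1) A) := by
  refine ⟨.ty_var_succ hA.1 h, ?_⟩
  have := IsCls.sub (.tySub_wk h) hA.2
  rwa [Expr.subCls_of_ne hA.1.var_cls_ne_kind] at this

theorem VTy.mwk (h : Der Sg (.ty Δ Ψ B (.sort .type))) (hA : VTy Sg Δ Γ (.mvar n) A) :
    VTy Sg ((Ψ, B) :: Δ) (Ctx.msub (.shift 1) Γ) (.mvar (n + 1)) (.msub (.shift 1) A) := by
  refine ⟨.ty_mvar_succ hA.1 h, ?_⟩
  have := IsCls.msub (.tyMSub_wk h) hA.2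
  rwa [Expr.msubCls_of_ne hA.1.mvar_cls_ne_kind] at this

theorem VTy.app (h : VTy Sg Δ Γ E (.pi A F)) (hN : Der Sg (.ty Δ Γ N A)) :
    VTy Sg Δ Γ (.app E N) (.sub (.single N) F) := by
  obtain ⟨s, hF⟩ := h.2.pi_inv
  exact ⟨.ty_app h.1 hN, .of_ty (.ty_sub_sort (.tySub_single hN hF.ty_head) hF)⟩

theorem VTy.sub (hσ : Der Sg (.tySub Δ Γ σ Ψ)) (h : VTy Sg Δ Ψ E F) :
    VTy Sg Δ Γ (.sub σ E) (F.subCls σ) :=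
  ⟨.ty_sub hσ h.1, h.2.sub hσ⟩

theorem VTy.msub (hθ : Der Sg (.tyMSub Δ θ Δ')) (h : VTy Sg Δ' Γ E F) :
    VTy Sg Δ (Ctx.msub θ Γ) (.msub θ E) (F.msubCls θ) :=
  ⟨.ty_msub hθ h.1, h.2.msub hθ⟩

theorem VTy.conv (h : Der Sg (.ty Δ Γ E F)) (e : VEq Sg Δ Γ F F' (.sort s)) :
    VTy Sg Δ Γ E F' :=
  ⟨.ty_conv h e.1, .of_ty e.2.2.1⟩

namespace VEq

theorem refl (h : VTy Sg Δ Γ E F) : VEq Sg Δ Γ E E F := ⟨.eq_refl h.1, h.1, h.1, h.2⟩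

theorem symm (h : VEq Sg Δ Γ E E' F) : VEq Sg Δ Γ E' E F :=
  ⟨.eq_symm h.1, h.2.2.1, h.2.1, h.2.2.2⟩

theorem trans (h : VEq Sg Δ Γ E E' F) (h' : VEq Sg Δ Γ E' M F) : VEq Sg Δ Γ E M F :=
  ⟨.eq_trans h.1 h'.1, h.2.1, h'.2.2.1, h.2.2.2⟩

theorem conv (h : VEq Sg Δ Γ E E' F) (e : VEq Sg Δ Γ F F' (.sort s)) : VEq Sg Δ Γ E E' F' :=
  ⟨.eq_conv h.1 e.1, .ty_conv h.2.1 e.1, .ty_conv h.2.2.1 e.1, .of_ty e.2.2.1⟩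

theorem pi (hA : VEq Sg Δ Γ A A' (.sort .type)) (hE : VEq Sg Δ (A :: Γ) E E' (.sort s)) :
    VEq Sg Δ Γ (.pi A E) (.pi A' E') (.sort s) :=
  ⟨.eq_pi hA.1 hA.2.1 hE.1, .ty_pi hE.2.1,
    .ty_pi (.ty_ctx hE.2.2.1 (.eqCtx_head hA.2.1 hA.2.2.1 hA.1)), .sort hA.2.1.ty_ctxWF⟩

theorem lam (hM : VEq Sg Δ (A :: Γ) M M' B) (hB : Der Sg (.ty Δ (A :: Γ) B (.sort .type))) :
    VEq Sg Δ Γ (.lam M) (.lam M') (.pi A B) :=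
  ⟨.eq_lam hM.1 hB, .ty_lam hM.2.1 hB, .ty_lam hM.2.2.1 hB, .pi hB⟩

theorem app (hE : VEq Sg Δ Γ E E' (.pi A F)) (hN : VEq Sg Δ Γ N N' A) :
    VEq Sg Δ Γ (.app E N) (.app E' N') (.sub (.single N) F) := by
  obtain ⟨s, hF⟩ := hE.2.2.2.pi_inv
  have h := VTy.app ⟨hE.2.1, hE.2.2.2⟩ hN.2.1
  refine ⟨.eq_app hE.1 hN.1, h.1, .ty_conv (.ty_app hE.2.2.1 hN.2.2.1) (s := s)
    (.eq_symm ?_), h.2⟩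
  exact .eq_sub_left (.tySub_single hN.2.1 hF.ty_head) (.eqSub_single hN.1 hF.ty_head) hF

theorem sub (hσ : VEqSub Sg Δ Γ σ σ' Ψ) (hE : VEq Sg Δ Ψ E E' F) :
    VEq Sg Δ Γ (.sub σ E) (.sub σ' E') (F.subCls σ) :=
  ⟨.eq_sub hσ.1 hE.1, .ty_sub hσ.2.1 hE.2.1,
    (Conv.subCls_left hE.2.2.2 hσ.2.1 hσ.1).symm.ty (.ty_sub hσ.2.2 hE.2.2.1), hE.2.2.2.sub hσ.2.1⟩

theorem msub (hθ : VEqMSub Sg Δ θ θ' Δ') (hE : VEq Sg Δ' Γ E E' F) :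
    VEq Sg Δ (Ctx.msub θ Γ) (.msub θ E) (.msub θ' E') (F.msubCls θ) := by
  have hΓ := hE.2.1.ty_ctxWF
  refine ⟨.eq_msub hθ.1 hE.1, .ty_msub hθ.2.1 hE.2.1, ?_, hE.2.2.2.msub hθ.2.1⟩
  refine (Conv.msubCls_left hΓ hE.2.2.2 hθ.2.1 hθ.1).symm.ty ?_
  exact .ty_ctx (.ty_msub hθ.2.2 hE.2.2.1) (Der.eqCtx_msub hθ.2.1 hθ.2.2 hθ.1 hΓ).eqCtx_symm

theorem beta (hM : Der Sg (.ty Δ (A :: Γ) M B)) (hB : Der Sg (.ty Δ (A :: Γ) B (.sort .type)))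
    (hN : Der Sg (.ty Δ Γ N A)) :
    VEq Sg Δ Γ (.app (.lam M) N) (.sub (.single N) M) (.sub (.single N) B) := by
  have h := VTy.app ⟨.ty_lam hM hB, .pi hB⟩ hN
  refine ⟨.eq_beta hM hB hN, h.1, ?_, h.2⟩
  have := Der.ty_sub (.tySub_single hN hM.ty_head) hM
  rwa [Expr.subCls_of_ne hB.ty_ne_kind] at this

theorem _root_.CMTT.Der.ty_sub_wk_pi (hM : Der Sg (.ty Δ Γ M (.pi A B)))
    (hB : Der Sg (.ty Δ (A :: Γ) B (.sort s))) (h : Der Sg (.ty Δ Γ A' (.sort .type))) :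
    Der Sg (.ty Δ (A' :: Γ) (.sub (.shift 1) M)
      (.pi (.sub (.shift 1) A) (.sub (Sub.shift 1).lift B))) :=
  .ty_conv (.ty_sub (.tySub_wk h) hM) (.eq_sub_pi (.tySub_wk h) hB)

/-- The body of an `η`-expansion. -/
theorem _root_.CMTT.Der.ty_eta_body (hM : Der Sg (.ty Δ Γ M (.pi A B)))
    (hB : Der Sg (.ty Δ (A :: Γ) B (.sort s))) :
    Der Sg (.ty Δ (A :: Γ) (.app (.sub (.shift 1) M) (.var 0)) B) := by
  have hA := hB.ty_head
  have hw := Der.tySub_wk hA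
  have hv := Der.ty_var_zero hA
  have hs := Der.tySub_single hv (.ty_sub_sort hw hA)
  have hl := Der.tySub_lift hw hA
  refine .ty_conv (.ty_app (hM.ty_sub_wk_pi hB hA) hv) (s := s) ?_
  exact .eq_trans (.eq_trans (.eq_sub_comp_sort hs hl hB)
    (.eq_sub_left (.tySub_sub hs hl) (.eqSub_single_lift_wk hA) hB)) (.eq_sub_id hB)

theorem eta (hM : Der Sg (.ty Δ Γ M (.pi A B))) (hB : Der Sg (.ty Δ (A :: Γ) B (.sort .type))) :
    VEq Sg Δ Γ M (.lam (.app (.sub (.shift 1) M) (.var 0))) (.pi A B) :=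
  ⟨.eq_eta hM hB, hM, .ty_lam (hM.ty_eta_body hB) hB, .pi hB⟩

theorem sub_id (h : VTy Sg Δ Γ E F) : VEq Sg Δ Γ (.sub (.shift 0) E) E F :=
  ⟨.eq_sub_id h.1, (Conv.subCls_id h.2).ty (.ty_sub (.tySub_id h.1.ty_ctxWF) h.1), h.1, h.2⟩

theorem sub_comp (hσ : Der Sg (.tySub Δ Γ σ Ψ)) (hτ : Der Sg (.tySub Δ Ψ τ Φ))
    (h : VTy Sg Δ Φ E F) :
    VEq Sg Δ Γ (.sub σ (.sub τ E)) (.sub (.sub σ τ) E) (F.subCls (.sub σ τ)) :=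
  ⟨.eq_sub_comp hσ hτ h.1, (Conv.subCls_comp hσ hτ h.2).ty (.ty_sub hσ (.ty_sub hτ h.1)),
    .ty_sub (.tySub_sub hσ hτ) h.1, h.2.sub (.tySub_sub hσ hτ)⟩

theorem sub_type (hσ : Der Sg (.tySub Δ Γ σ Ψ)) :
    VEq Sg Δ Γ (.sub σ (.sort .type)) (.sort .type) (.sort .kind) :=
  ⟨.eq_sub_type hσ, .ty_sub hσ (.ty_type hσ.tySub_cod), .ty_type hσ.tySub_dom, .inl rfl⟩

theorem sub_var_zero (hσ : Der Sg (.tySub Δ Γ σ Ψ)) (hA : Der Sg (.ty Δ Ψ A (.sort .type)))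
    (hM : Der Sg (.ty Δ Γ M (.sub σ A))) :
    VEq Sg Δ Γ (.sub (.cons σ M) (.var 0)) M (.sub σ A) := by
  have hc := Der.tySub_cons hσ hA hM
  have hw := Der.tySub_wk hA
  refine ⟨.eq_sub_var_zero hσ hA hM, ?_, hM, .of_ty (.ty_sub_sort hσ hA)⟩
  exact .ty_conv (.ty_sub hc (.ty_var_zero hA)) (s := .type) (.eq_trans (.eq_sub_comp_sort hc hw hA)
    (.eq_sub_left (.tySub_sub hc hw) (.eqSub_cons_wk hc hσ) hA))

theorem var_succ (h : VTy Sg Δ Γ (.var (n + 1)) F) :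
    VEq Sg Δ Γ (.var (n + 1)) (.sub (.shift 1) (.var n)) F := by
  obtain ⟨A, B, Γ', rfl, hB, hA, c⟩ := h.1.var_succ_inv
  refine ⟨.eq_var_succ h.1, h.1, c.ty ?_, h.2⟩
  have := Der.ty_sub (.tySub_wk hB) hA
  rwa [Expr.subCls_of_ne hA.var_cls_ne_kind] at this

theorem sub_pi (hσ : Der Sg (.tySub Δ Γ σ Ψ)) (hF : Der Sg (.ty Δ (A :: Ψ) F (.sort s))) :
    VEq Sg Δ Γ (.sub σ (.pi A F)) (.pi (.sub σ A) (.sub σ.lift F)) (.sort s) :=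
  ⟨.eq_sub_pi hσ hF, .ty_sub_sort hσ (.ty_pi hF),
    .ty_pi (.ty_sub_sort (.tySub_lift hσ hF.ty_head) hF), .sort hσ.tySub_dom⟩

theorem sub_lam (hσ : Der Sg (.tySub Δ Γ σ Ψ)) (hM : Der Sg (.ty Δ (A :: Ψ) M B))
    (hB : Der Sg (.ty Δ (A :: Ψ) B (.sort .type))) :
    VEq Sg Δ Γ (.sub σ (.lam M)) (.lam (.sub σ.lift M)) (.pi (.sub σ A) (.sub σ.lift B)) := by
  have hl := Der.tySub_lift hσ hB.ty_head
  have hB' := Der.ty_sub_sort hl hB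
  have hM' := Der.ty_sub hl hM
  rw [Expr.subCls_of_ne hB.ty_ne_kind] at hM'
  exact ⟨.eq_sub_lam hσ hM hB, .ty_conv (.ty_sub hσ (.ty_lam hM hB)) (.eq_sub_pi hσ hB),
    .ty_lam hM' hB', .pi hB'⟩

theorem sub_app (hσ : Der Sg (.tySub Δ Γ σ Ψ)) (hE : VTy Sg Δ Ψ E (.pi A F))
    (hN : Der Sg (.ty Δ Ψ N A)) :
    VEq Sg Δ Γ (.sub σ (.app E N)) (.app (.sub σ E) (.sub σ N))
      (.sub (.cons σ (.sub σ N)) F) := by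
  obtain ⟨s, hF⟩ := hE.2.pi_inv
  have hA := hF.ty_head
  have hN' : Der Sg (.ty Δ Γ (.sub σ N) (.sub σ A)) := by
    have := Der.ty_sub hσ hN
    rwa [Expr.subCls_of_ne hA.ty_ne_kind] at this
  have hs := Der.tySub_single hN hA
  have hs' := Der.tySub_single hN' (.ty_sub_sort hσ hA)
  have hl := Der.tySub_lift hσ hA
  refine ⟨.eq_sub_app hσ hE.1 hN, ?_, ?_, .of_ty (.ty_sub_sort (.tySub_cons hσ hA hN') hF)⟩
  · refine .ty_conv (.ty_sub hσ (.ty_app hE.1 hN)) (s := s) ?_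
    exact .eq_trans (.eq_sub_comp_sort hσ hs hF)
      (.eq_sub_left (.tySub_sub hσ hs) (.eqSub_sub_single hσ hA hN) hF)
  · refine .ty_conv (.ty_app (.ty_conv (.ty_sub hσ hE.1) (.eq_sub_pi hσ hF)) hN') (s := s) ?_
    exact .eq_trans (.eq_sub_comp_sort hs' hl hF)
      (.eq_sub_left (.tySub_sub hs' hl) (.eqSub_single_lift hσ hA hN') hF)

theorem msub_id (h : VTy Sg Δ Γ E F) : VEq Sg Δ Γ (.msub (.shift 0) E) E F := by
  have hΓ := h.1.ty_ctxWF
  exact ⟨.eq_msub_id h.1, (Conv.msubCls_id h.2).ty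
    (.ty_ctx (.ty_msub (.tyMSub_id hΓ.mctx_of_ctx) h.1) (.eqCtx_msub_id hΓ)), h.1, h.2⟩

theorem msub_comp (hθ : Der Sg (.tyMSub Δ θ Δ')) (hθ' : Der Sg (.tyMSub Δ' θ' Δ''))
    (h : VTy Sg Δ'' Γ E F) :
    VEq Sg Δ (Ctx.msub (.msub θ θ') Γ) (.msub θ (.msub θ' E)) (.msub (.msub θ θ') E)
      (F.msubCls (.msub θ θ')) := by
  have hc := Der.tyMSub_msub hθ hθ'
  refine ⟨.eq_msub_comp hθ hθ' h.1, (Conv.msubCls_comp hθ hθ' h.2).ty ?_, .ty_msub hc h.1,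
    h.2.msub hc⟩
  exact .ty_ctx (.ty_msub hθ (.ty_msub hθ' h.1)) (.eqCtx_msub_comp hθ hθ' h.1.ty_ctxWF)

theorem msub_type (hθ : Der Sg (.tyMSub Δ θ Δ')) (hΓ : Der Sg (.ctx Δ' Γ)) :
    VEq Sg Δ (Ctx.msub θ Γ) (.msub θ (.sort .type)) (.sort .type) (.sort .kind) :=
  ⟨.eq_msub_type hθ hΓ, .ty_msub hθ (.ty_type hΓ), .ty_type (.ctx_msub hθ hΓ), .inl rfl⟩

theorem msub_var (hθ : Der Sg (.tyMSub Δ θ Δ')) (h : VTy Sg Δ' Γ (.var n) F) :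
    VEq Sg Δ (Ctx.msub θ Γ) (.msub θ (.var n)) (.var n) (.msub θ F) := by
  have h' := VTy.msub hθ h
  rw [Expr.msubCls_of_ne h.1.var_cls_ne_kind] at h'
  exact ⟨.eq_msub_var hθ h.1, h'.1, .ty_var_msub hθ h.1, h'.2⟩

theorem msub_mvar_zero (hθ : Der Sg (.tyMSub Δ θ Δ')) (hA : Der Sg (.ty Δ' Γ A (.sort .type)))
    (hM : Der Sg (.ty Δ (Ctx.msub θ Γ) M (.msub θ A))) :
    VEq Sg Δ (Ctx.msub θ Γ) (.msub (.cons θ M) (.mvar 0)) M (.msub θ A) := by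
  have hc := Der.tyMSub_cons hθ hA hM
  have hw := Der.tyMSub_wk hA
  have e : Der Sg (.eqMSub Δ (.msub (.cons θ M) (.shift 1)) θ Δ') :=
    .eqMSub_trans (.eqMSub_cons_shift (Δ₀' := []) hc rfl) (.eqMSub_id_right hθ)
  have hcw := Der.tyMSub_msub hc hw
  have e₁ := Der.eqCtx_msub_comp hc hw hA.ty_ctxWF
  have e₂ := Der.eqCtx_msub hcw hθ e hA.ty_ctxWF
  refine ⟨.eq_msub_mvar_zero hθ hA hM, ?_, hM, .of_ty (.ty_msub_sort hθ hA)⟩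
  refine .ty_conv (.ty_ctx (.ty_msub hc (.ty_mvar_zero hA)) (e₁.eqCtx_trans e₂)) (s := .type)
    (.eq_ctx ?_ e₂)
  exact .eq_trans (.eq_msub_comp_sort hc hw hA) (.eq_msub_sort hcw hA.ty_ctxWF e (.eq_refl hA))

theorem mvar_succ (h : VTy Sg Δ Γ (.mvar (n + 1)) F) :
    VEq Sg Δ Γ (.mvar (n + 1)) (.msub (.shift 1) (.mvar n)) F := by
  obtain ⟨Δ', Ψ, B, Γ', A, rfl, hB, hA, e, c⟩ := h.1.mvar_succ_inv
  refine ⟨.eq_mvar_succ h.1, h.1, c.ty ?_, h.2⟩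
  have := Der.ty_msub (.tyMSub_wk hB) hA
  rw [Expr.msubCls_of_ne hA.mvar_cls_ne_kind] at this
  exact .ty_ctx this e

theorem msub_pi (hθ : Der Sg (.tyMSub Δ θ Δ')) (hF : Der Sg (.ty Δ' (A :: Γ) F (.sort s))) :
    VEq Sg Δ (Ctx.msub θ Γ) (.msub θ (.pi A F)) (.pi (.msub θ A) (.msub θ F)) (.sort s) :=
  have h := Der.ty_msub_sort hθ hF
  ⟨.eq_msub_pi hθ hF, .ty_msub_sort hθ (.ty_pi hF), .ty_pi h,
    .sort h.ty_ctxWF.ctx_tail⟩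

theorem msub_lam (hθ : Der Sg (.tyMSub Δ θ Δ')) (hM : Der Sg (.ty Δ' (A :: Γ) M B))
    (hB : Der Sg (.ty Δ' (A :: Γ) B (.sort .type))) :
    VEq Sg Δ (Ctx.msub θ Γ) (.msub θ (.lam M)) (.lam (.msub θ M))
      (.pi (.msub θ A) (.msub θ B)) := by
  have hB' := Der.ty_msub_sort hθ hB
  have hM' := Der.ty_msub hθ hM
  rw [Expr.msubCls_of_ne hB.ty_ne_kind] at hM'
  exact ⟨.eq_msub_lam hθ hM hB, .ty_conv (.ty_msub hθ (.ty_lam hM hB)) (.eq_msub_pi hθ hB),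
    .ty_lam hM' hB', .pi hB'⟩

theorem msub_app (hθ : Der Sg (.tyMSub Δ θ Δ')) (hE : VTy Sg Δ' Γ E (.pi A F))
    (hN : Der Sg (.ty Δ' Γ N A)) :
    VEq Sg Δ (Ctx.msub θ Γ) (.msub θ (.app E N)) (.app (.msub θ E) (.msub θ N))
      (.sub (.single (.msub θ N)) (.msub θ F)) := by
  obtain ⟨s, hF⟩ := hE.2.pi_inv
  have hA := hF.ty_head
  have hN' : Der Sg (.ty Δ (Ctx.msub θ Γ) (.msub θ N) (.msub θ A)) := by
    have := Der.ty_msub hθ hN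
    rwa [Expr.msubCls_of_ne hA.ty_ne_kind] at this
  have hs := Der.tySub_single hN hA
  have hF' := Der.ty_msub_sort hθ hF
  have h := VTy.app (F := .msub θ F)
    ⟨.ty_conv (.ty_msub hθ hE.1) (.eq_msub_pi hθ hF), .pi hF'⟩ hN'
  refine ⟨.eq_msub_app hθ hE.1 hN, ?_, h.1, h.2⟩
  refine .ty_conv (.ty_msub hθ (.ty_app hE.1 hN)) (s := s) ?_
  exact .eq_trans (.eq_msub_sub_sort hθ hs hF)
    (.eq_sub_left (.tySub_msub hθ hs) (.eqSub_msub_single hθ hA hN) hF')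

theorem msub_sub (hθ : Der Sg (.tyMSub Δ θ Δ')) (hσ : Der Sg (.tySub Δ' Γ σ Ψ))
    (hE : VTy Sg Δ' Ψ E F) :
    VEq Sg Δ (Ctx.msub θ Γ) (.msub θ (.sub σ E)) (.sub (.msub θ σ) (.msub θ E))
      ((F.msubCls θ).subCls (.msub θ σ)) := by
  have h := VTy.sub (.tySub_msub hθ hσ) (VTy.msub hθ hE)
  exact ⟨.eq_msub_sub hθ hσ hE.1,
    (Conv.msubCls_subCls hθ hσ hE.2).ty (.ty_msub hθ (.ty_sub hσ hE.1)), h.1, h.2⟩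

end VEq

namespace VEqSub

theorem refl (h : Der Sg (.tySub Δ Γ σ Ψ)) : VEqSub Sg Δ Γ σ σ Ψ := ⟨.eqSub_refl h, h, h⟩

theorem symm (h : VEqSub Sg Δ Γ σ σ' Ψ) : VEqSub Sg Δ Γ σ' σ Ψ := ⟨.eqSub_symm h.1, h.2.2, h.2.1⟩

theorem trans (h : VEqSub Sg Δ Γ σ σ' Ψ) (h' : VEqSub Sg Δ Γ σ' τ Ψ) : VEqSub Sg Δ Γ σ τ Ψ :=
  ⟨.eqSub_trans h.1 h'.1, h.2.1, h'.2.2⟩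

theorem cons (hM : VEq Sg Δ Γ M M' (.sub σ A)) (hA : Der Sg (.ty Δ Ψ A (.sort .type)))
    (hσ : VEqSub Sg Δ Γ σ σ' Ψ) : VEqSub Sg Δ Γ (.cons σ M) (.cons σ' M') (A :: Ψ) :=
  ⟨.eqSub_cons hM.1 hA hσ.1, .tySub_cons hσ.2.1 hA hM.2.1,
    .tySub_cons hσ.2.2 hA (.ty_conv hM.2.2.1 (.eq_sub_left hσ.2.1 hσ.1 hA))⟩

theorem sub (hτ : VEqSub Sg Δ Γ τ τ' Φ) (hσ : VEqSub Sg Δ Φ σ σ' Ψ) :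
    VEqSub Sg Δ Γ (.sub τ σ) (.sub τ' σ') Ψ :=
  ⟨.eqSub_sub hτ.1 hσ.1, .tySub_sub hτ.2.1 hσ.2.1, .tySub_sub hτ.2.2 hσ.2.2⟩

theorem msub (hθ : VEqMSub Sg Δ θ θ' Δ') (hσ : VEqSub Sg Δ' Γ σ σ' Ψ) :
    VEqSub Sg Δ (Ctx.msub θ Γ) (.msub θ σ) (.msub θ' σ') (Ctx.msub θ Ψ) :=
  ⟨.eqSub_msub hθ.1 hσ.1, .tySub_msub hθ.2.1 hσ.2.1, .tySub_ctx (.tySub_msub hθ.2.2 hσ.2.2)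
    (Der.eqCtx_msub hθ.2.1 hθ.2.2 hθ.1 hσ.2.1.tySub_dom).eqCtx_symm
    (Der.eqCtx_msub hθ.2.1 hθ.2.2 hθ.1 hσ.2.1.tySub_cod).eqCtx_symm⟩

theorem cons_shift (h : Der Sg (.tySub Δ Γ (.cons σ M) (A :: (Ψ' ++ Ψ)))) (hn : Ψ'.length = n) :
    VEqSub Sg Δ Γ (.sub (.cons σ M) (.shift (n + 1))) (.sub σ (.shift n)) Ψ :=
  ⟨.eqSub_cons_shift h hn, .tySub_sub h (.tySub_shift (Γ := A :: Ψ') h.tySub_cod (by simp [hn])),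
    .tySub_sub h.tySub_cons_inv.1 (.tySub_shift h.tySub_cod.ctx_tail hn)⟩

theorem sub_cons (hσ : Der Sg (.tySub Δ Γ σ Φ)) (h : Der Sg (.tySub Δ Φ (.cons τ M) (A :: Ψ))) :
    VEqSub Sg Δ Γ (.sub σ (.cons τ M)) (.cons (.sub σ τ) (.sub σ M)) (A :: Ψ) := by
  obtain ⟨h₁, h₂, h₃⟩ := h.tySub_cons_inv
  refine ⟨.eqSub_sub_cons hσ h, .tySub_sub hσ h, .tySub_cons (.tySub_sub hσ h₁) h₂ ?_⟩
  exact .ty_conv (.ty_sub hσ h₃) (.eq_sub_comp_sort hσ h₁ h₂)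

theorem shift_shift {Γ₁ Γ₂ : Ctx C} (h : Der Sg (.ctx Δ (Γ₂ ++ (Γ₁ ++ Γ)))) (hm : Γ₁.length = m)
    (hn : Γ₂.length = n) :
    VEqSub Sg Δ (Γ₂ ++ (Γ₁ ++ Γ)) (.sub (.shift n) (.shift m)) (.shift (n + m)) Γ := by
  refine ⟨.eqSub_shift_shift h hm hn, .tySub_sub (.tySub_shift h hn)
    (.tySub_shift h.ctx_of_append hm), ?_⟩
  have := Der.tySub_shift (Γ := Γ₂ ++ Γ₁) (Ψ := Γ) (Sg := Sg) (Δ := Δ) (n := n + m)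
    (by simpa using h) (by simp [hm, hn])
  simpa using this

theorem id_left (h : Der Sg (.tySub Δ Γ σ Ψ)) : VEqSub Sg Δ Γ (.sub (.shift 0) σ) σ Ψ :=
  ⟨.eqSub_id_left h, .tySub_sub (.tySub_id h.tySub_dom) h, h⟩

theorem id_right (h : Der Sg (.tySub Δ Γ σ Ψ)) : VEqSub Sg Δ Γ (.sub σ (.shift 0)) σ Ψ :=
  ⟨.eqSub_id_right h, .tySub_sub h (.tySub_id h.tySub_cod), h⟩

theorem assoc {Γ₁ Γ₂ Γ₃ Γ₄ : Ctx C} {σ₁ σ₂ σ₃ : Sub C} (h₁ : Der Sg (.tySub Δ Γ₁ σ₁ Γ₂))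
    (h₂ : Der Sg (.tySub Δ Γ₂ σ₂ Γ₃)) (h₃ : Der Sg (.tySub Δ Γ₃ σ₃ Γ₄)) :
    VEqSub Sg Δ Γ₁ (.sub σ₁ (.sub σ₂ σ₃)) (.sub (.sub σ₁ σ₂) σ₃) Γ₄ :=
  ⟨.eqSub_assoc h₁ h₂ h₃, .tySub_sub h₁ (.tySub_sub h₂ h₃), .tySub_sub (.tySub_sub h₁ h₂) h₃⟩

theorem eta (h : Der Sg (.ctx Δ (Γ' ++ A :: Γ))) (hn : Γ'.length = n) :
    VEqSub Sg Δ (Γ' ++ A :: Γ) (.shift n) (.cons (.shift (n + 1)) (.var n)) (A :: Γ) := by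
  subst hn
  exact ⟨.eqSub_eta h rfl, .tySub_shift h rfl,
    .tySub_cons (.tySub_shift_cons h) h.ctx_of_append.ctx_type (.ty_var_length h)⟩

theorem msub_shift (hθ : Der Sg (.tyMSub Δ θ Δ')) (h : Der Sg (.ctx Δ' (Γ' ++ Γ)))
    (hn : Γ'.length = n) :
    VEqSub Sg Δ (Ctx.msub θ (Γ' ++ Γ)) (.msub θ (.shift n)) (.shift n) (Ctx.msub θ Γ) := by
  have h₁ := Der.tySub_msub hθ (.tySub_shift h hn)
  have h₂ := Der.ctx_msub hθ h
  rw [Ctx.msub_append] at *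
  exact ⟨.eqSub_msub_shift hθ h hn, h₁, .tySub_shift h₂ (by simp [hn])⟩

theorem msub_cons (hθ : Der Sg (.tyMSub Δ θ Δ')) (hσ : Der Sg (.tySub Δ' Γ σ Ψ))
    (hA : Der Sg (.ty Δ' Ψ A (.sort .type))) (hM : Der Sg (.ty Δ' Γ M (.sub σ A))) :
    VEqSub Sg Δ (Ctx.msub θ Γ) (.msub θ (.cons σ M)) (.cons (.msub θ σ) (.msub θ M))
      (Ctx.msub θ (A :: Ψ)) :=
  ⟨.eqSub_msub_cons hθ hσ hA hM, .tySub_msub hθ (.tySub_cons hσ hA hM),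
    .tySub_cons (.tySub_msub hθ hσ) (.ty_msub_sort hθ hA)
      (.ty_conv (.ty_msub hθ hM) (.eq_msub_sub_sort hθ hσ hA))⟩

theorem msub_sub (hθ : Der Sg (.tyMSub Δ θ Δ')) (hτ : Der Sg (.tySub Δ' Γ τ Φ))
    (hσ : Der Sg (.tySub Δ' Φ σ Ψ)) :
    VEqSub Sg Δ (Ctx.msub θ Γ) (.msub θ (.sub τ σ)) (.sub (.msub θ τ) (.msub θ σ))
      (Ctx.msub θ Ψ) :=
  ⟨.eqSub_msub_sub hθ hτ hσ, .tySub_msub hθ (.tySub_sub hτ hσ),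
    .tySub_sub (.tySub_msub hθ hτ) (.tySub_msub hθ hσ)⟩

theorem msub_msub (hθ : Der Sg (.tyMSub Δ θ Δ')) (hθ' : Der Sg (.tyMSub Δ' θ' Δ''))
    (hσ : Der Sg (.tySub Δ'' Γ σ Ψ)) :
    VEqSub Sg Δ (Ctx.msub (.msub θ θ') Γ) (.msub θ (.msub θ' σ)) (.msub (.msub θ θ') σ)
      (Ctx.msub (.msub θ θ') Ψ) :=
  ⟨.eqSub_msub_msub hθ hθ' hσ, .tySub_ctx (.tySub_msub hθ (.tySub_msub hθ' hσ))
    (.eqCtx_msub_comp hθ hθ' hσ.tySub_dom) (.eqCtx_msub_comp hθ hθ' hσ.tySub_cod),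
    .tySub_msub (.tyMSub_msub hθ hθ') hσ⟩

end VEqSub

namespace VEqMSub

theorem refl (h : Der Sg (.tyMSub Δ θ Δ')) : VEqMSub Sg Δ θ θ Δ' := ⟨.eqMSub_refl h, h, h⟩

theorem symm (h : VEqMSub Sg Δ θ θ' Δ') : VEqMSub Sg Δ θ' θ Δ' := ⟨.eqMSub_symm h.1, h.2.2, h.2.1⟩

theorem trans (h : VEqMSub Sg Δ θ θ₁ Δ') (h' : VEqMSub Sg Δ θ₁ θ₂ Δ') : VEqMSub Sg Δ θ θ₂ Δ' :=
  ⟨.eqMSub_trans h.1 h'.1, h.2.1, h'.2.2⟩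

theorem cons (hθ : VEqMSub Sg Δ θ θ' Δ') (hA : Der Sg (.ty Δ' Γ A (.sort .type)))
    (hM : VEq Sg Δ (Ctx.msub θ Γ) M M' (.msub θ A)) :
    VEqMSub Sg Δ (.cons θ M) (.cons θ' M') ((Γ, A) :: Δ') :=
  ⟨.eqMSub_cons hθ.1 hA hM.1, .tyMSub_cons hθ.2.1 hA hM.2.1, .tyMSub_cons hθ.2.2 hA <|
    .ty_ctx (.ty_conv hM.2.2.1 (.eq_msub_sort hθ.2.1 hA.ty_ctxWF hθ.1 (.eq_refl hA)))
      (.eqCtx_msub hθ.2.1 hθ.2.2 hθ.1 hA.ty_ctxWF)⟩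

theorem msub (h : VEqMSub Sg Δ θ θ' Δ') (h' : VEqMSub Sg Δ' θ₁ θ₂ Δ'') :
    VEqMSub Sg Δ (.msub θ θ₁) (.msub θ' θ₂) Δ'' :=
  ⟨.eqMSub_msub h.1 h'.1, .tyMSub_msub h.2.1 h'.2.1, .tyMSub_msub h.2.2 h'.2.2⟩

theorem cons_shift {Δ₀ Δ₀' : MCtx C} (h : Der Sg (.tyMSub Δ (.cons θ M) ((Γ, A) :: (Δ₀' ++ Δ₀))))
    (hn : Δ₀'.length = n) :
    VEqMSub Sg Δ (.msub (.cons θ M) (.shift (n + 1))) (.msub θ (.shift n)) Δ₀ :=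
  ⟨.eqMSub_cons_shift h hn,
    .tyMSub_msub h (.tyMSub_shift (Δ' := (Γ, A) :: Δ₀') h.tyMSub_cod (by simp [hn])),
    .tyMSub_msub h.tyMSub_cons_inv.1
      (.tyMSub_shift (Der.mctx_of_append (Δ' := [(Γ, A)]) h.tyMSub_cod) hn)⟩

theorem msub_cons (hθ : Der Sg (.tyMSub Δ θ Δ')) (h : Der Sg (.tyMSub Δ' (.cons θ' M) ((Γ, A) :: Δ''))) :
    VEqMSub Sg Δ (.msub θ (.cons θ' M)) (.cons (.msub θ θ') (.msub θ M)) ((Γ, A) :: Δ'') := by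
  obtain ⟨h₁, h₂, h₃⟩ := h.tyMSub_cons_inv
  refine ⟨.eqMSub_msub_cons hθ h, .tyMSub_msub hθ h, .tyMSub_cons (.tyMSub_msub hθ h₁) h₂ ?_⟩
  exact .ty_conv (.ty_ctx (.ty_msub hθ h₃) (.eqCtx_msub_comp hθ h₁ h₂.ty_ctxWF))
    (.eq_msub_comp_sort hθ h₁ h₂)

theorem shift_shift {Δ₁ Δ₂ : MCtx C} (h : Der Sg (.mctx (Δ₂ ++ (Δ₁ ++ Δ)))) (hm : Δ₁.length = m)
    (hn : Δ₂.length = n) :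
    VEqMSub Sg (Δ₂ ++ (Δ₁ ++ Δ)) (.msub (.shift n) (.shift m)) (.shift (n + m)) Δ := by
  refine ⟨.eqMSub_shift_shift h hm hn, .tyMSub_msub (.tyMSub_shift h hn)
    (.tyMSub_shift h.mctx_of_append hm), ?_⟩
  have := Der.tyMSub_shift (Δ' := Δ₂ ++ Δ₁) (Δ := Δ) (Sg := Sg) (n := n + m)
    (by simpa using h) (by simp [hm, hn])
  simpa using this

theorem id_left (h : Der Sg (.tyMSub Δ θ Δ')) : VEqMSub Sg Δ (.msub (.shift 0) θ) θ Δ' :=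
  ⟨.eqMSub_id_left h, .tyMSub_msub (.tyMSub_id h.tyMSub_dom) h, h⟩

theorem id_right (h : Der Sg (.tyMSub Δ θ Δ')) : VEqMSub Sg Δ (.msub θ (.shift 0)) θ Δ' :=
  ⟨.eqMSub_id_right h, .tyMSub_msub h (.tyMSub_id h.tyMSub_cod), h⟩

theorem assoc {Δ₁ Δ₂ Δ₃ Δ₄ : MCtx C} {θ₁ θ₂ θ₃ : MSub C} (h₁ : Der Sg (.tyMSub Δ₁ θ₁ Δ₂))
    (h₂ : Der Sg (.tyMSub Δ₂ θ₂ Δ₃)) (h₃ : Der Sg (.tyMSub Δ₃ θ₃ Δ₄)) :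
    VEqMSub Sg Δ₁ (.msub θ₁ (.msub θ₂ θ₃)) (.msub (.msub θ₁ θ₂) θ₃) Δ₄ :=
  ⟨.eqMSub_assoc h₁ h₂ h₃, .tyMSub_msub h₁ (.tyMSub_msub h₂ h₃),
    .tyMSub_msub (.tyMSub_msub h₁ h₂) h₃⟩

theorem eta (h : Der Sg (.mctx (Δ' ++ (Γ, A) :: Δ))) (hn : Δ'.length = n) :
    VEqMSub Sg (Δ' ++ (Γ, A) :: Δ) (.shift n) (.cons (.shift (n + 1)) (.mvar n))
      ((Γ, A) :: Δ) := by
  subst hn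
  exact ⟨.eqMSub_eta h rfl, .tyMSub_shift h rfl,
    .tyMSub_cons (.tyMSub_shift_cons h) h.mctx_of_append.mctx_type (.ty_mvar_length h)⟩

end VEqMSub

end

end

section

variable {C : Type u} {Sg : Sig C}

/-! ### Weakening at the outer end of the contexts, and validity -/

/-- A classifier that is well-formed in all contexts and is fixed by all substitutions. -/
def Closed (Sg : Sig C) (K : Expr C) : Prop :=
  ∃ s, (∀ Δ Γ, Der Sg (.ctx Δ Γ) → Der Sg (.ty Δ Γ K (.sort s))) ∧
    (∀ Δ Γ σ Ψ, Der Sg (.tySub Δ Γ σ Ψ) → Der Sg (.eq Δ Γ (.sub σ K) K (.sort s))) ∧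
    (∀ Δ θ Δ' Γ, Der Sg (.tyMSub Δ θ Δ') → Der Sg (.ctx Δ' Γ) →
      Der Sg (.eq Δ (Ctx.msub θ Γ) (.msub θ K) K (.sort s)))

/-- `Γ, Γ'` where the outer part `Γ'` is a base context lifted over `n` meta-variables. -/
def Ctx.graft (Γ Γ₁ : Ctx C) (n : ℕ) : Ctx C := Γ ++ Ctx.msub (.shift n) Γ₁

/-- The base context `Γ₁` is grafted to each context of the declarations. -/
def MCtx.extend (Γ₁ : Ctx C) (n : ℕ) : MCtx C → MCtx C
  | [] => []
  | (Ψ, A) :: Δ => (Ctx.graft Ψ Γ₁ (Δ.length + n), A) :: MCtx.extend Γ₁ n Δ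

/-- The meta-context `Δ` over the base `Δ₁; Γ₁`. -/
def MCtx.graft (Δ Δ₁ : MCtx C) (Γ₁ : Ctx C) : MCtx C := MCtx.extend Γ₁ 0 Δ ++ Δ₁

section

variable (Δ₁ : MCtx C) (Γ₁ : Ctx C)

@[simp] theorem MCtx.length_extend (n : ℕ) : ∀ Δ : MCtx C, (Δ.extend Γ₁ n).length = Δ.length
  | [] => rfl
  | _ :: Δ => congrArg (· + 1) (MCtx.length_extend n Δ)

theorem MCtx.extend_append (n : ℕ) (Δ : MCtx C) : ∀ Δ' : MCtx C,
    (Δ' ++ Δ).extend Γ₁ n = Δ'.extend Γ₁ (Δ.length + n) ++ Δ.extend Γ₁ n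
  | [] => rfl
  | (Ψ, A) :: Δ' => by
    rw [List.cons_append, MCtx.extend, MCtx.extend_append n Δ Δ', MCtx.extend, List.length_append,
      Nat.add_assoc]
    rfl

theorem MCtx.graft_append (Δ' Δ : MCtx C) :
    (Δ' ++ Δ).graft Δ₁ Γ₁ = Δ'.extend Γ₁ Δ.length ++ Δ.graft Δ₁ Γ₁ := by
  simp [MCtx.graft, MCtx.extend_append]

theorem Ctx.graft_append (n : ℕ) (Γ' Γ : Ctx C) :
    (Γ' ++ Γ).graft Γ₁ n = Γ' ++ Γ.graft Γ₁ n :=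
  List.append_assoc ..

/-- `θ` does not act on the base. -/
def FixesBase (Sg : Sig C) (Δ : MCtx C) (θ : MSub C) (Δ' : MCtx C) : Prop :=
  Der Sg (.eqMSub (Δ.graft Δ₁ Γ₁) (.msub θ (.shift Δ'.length)) (.shift Δ.length) Δ₁)

/-- The judgment holds, and is valid, over the base `Δ₁; Γ₁`. -/
def Judgment.Grafts (Sg : Sig C) : Judgment C → Prop
  | .mctx Δ => Der Sg (.mctx (Δ.graft Δ₁ Γ₁))
  | .ctx Δ Γ => Der Sg (.ctx (Δ.graft Δ₁ Γ₁) (Γ.graft Γ₁ Δ.length))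
  | .ty Δ Γ E F => VTy Sg (Δ.graft Δ₁ Γ₁) (Γ.graft Γ₁ Δ.length) E F
  | .tySub Δ Γ σ Ψ =>
    Der Sg (.tySub (Δ.graft Δ₁ Γ₁) (Γ.graft Γ₁ Δ.length) σ (Ψ.graft Γ₁ Δ.length))
  | .tyMSub Δ θ Δ' => Der Sg (.tyMSub (Δ.graft Δ₁ Γ₁) θ (Δ'.graft Δ₁ Γ₁)) ∧
      FixesBase Δ₁ Γ₁ Sg Δ θ Δ'
  | .eqCtx Δ Γ Γ' =>
    Der Sg (.eqCtx (Δ.graft Δ₁ Γ₁) (Γ.graft Γ₁ Δ.length) (Γ'.graft Γ₁ Δ.length))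
  | .eq Δ Γ E E' F => VEq Sg (Δ.graft Δ₁ Γ₁) (Γ.graft Γ₁ Δ.length) E E' F
  | .eqSub Δ Γ σ σ' Ψ =>
    VEqSub Sg (Δ.graft Δ₁ Γ₁) (Γ.graft Γ₁ Δ.length) σ σ' (Ψ.graft Γ₁ Δ.length)
  | .eqMSub Δ θ θ' Δ' => VEqMSub Sg (Δ.graft Δ₁ Γ₁) θ θ' (Δ'.graft Δ₁ Γ₁) ∧
      FixesBase Δ₁ Γ₁ Sg Δ θ Δ'

variable {Δ₁ Γ₁} {Δ Δ' Δ'' : MCtx C} {Γ Ψ : Ctx C} {θ θ' : MSub C} {M A B E F : Expr C}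

theorem Der.tyMSub_graft (h : Der Sg (.mctx (Δ.graft Δ₁ Γ₁))) :
    Der Sg (.tyMSub (Δ.graft Δ₁ Γ₁) (.shift Δ.length) Δ₁) :=
  .tyMSub_shift h (by simp)

theorem FixesBase.shift (h : Der Sg (.mctx ((Δ' ++ Δ).graft Δ₁ Γ₁))) :
    FixesBase Δ₁ Γ₁ Sg (Δ' ++ Δ) (.shift Δ'.length) Δ := by
  rw [MCtx.graft_append] at h
  unfold FixesBase
  rw [MCtx.graft_append, List.length_append]
  exact .eqMSub_shift_shift (Δ₁ := Δ.extend Γ₁ 0) h (by simp) (by simp)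

theorem FixesBase.id (h : Der Sg (.mctx (Δ.graft Δ₁ Γ₁))) :
    FixesBase Δ₁ Γ₁ Sg Δ (.shift 0) Δ :=
  .shift (Δ' := []) h

theorem FixesBase.cons
    (h : Der Sg (.tyMSub (Δ.graft Δ₁ Γ₁) (.cons θ M) (MCtx.graft ((Γ, A) :: Δ') Δ₁ Γ₁)))
    (hθ : FixesBase Δ₁ Γ₁ Sg Δ θ Δ') : FixesBase Δ₁ Γ₁ Sg Δ (.cons θ M) ((Γ, A) :: Δ') :=
  .eqMSub_trans (.eqMSub_cons_shift (Δ₀' := Δ'.extend Γ₁ 0) h (by simp)) hθ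

theorem FixesBase.msub (hθ : Der Sg (.tyMSub (Δ.graft Δ₁ Γ₁) θ (Δ'.graft Δ₁ Γ₁)))
    (hθ' : Der Sg (.tyMSub (Δ'.graft Δ₁ Γ₁) θ' (Δ''.graft Δ₁ Γ₁)))
    (h : FixesBase Δ₁ Γ₁ Sg Δ θ Δ') (h' : FixesBase Δ₁ Γ₁ Sg Δ' θ' Δ'') :
    FixesBase Δ₁ Γ₁ Sg Δ (.msub θ θ') Δ'' :=
  .eqMSub_trans (.eqMSub_symm (.eqMSub_assoc hθ hθ' (.tyMSub_graft hθ'.tyMSub_cod)))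
    (.eqMSub_trans (.eqMSub_msub (.eqMSub_refl hθ) h') h)

theorem FixesBase.congr (e : VEqMSub Sg (Δ.graft Δ₁ Γ₁) θ θ' (Δ'.graft Δ₁ Γ₁))
    (h : FixesBase Δ₁ Γ₁ Sg Δ θ Δ') : FixesBase Δ₁ Γ₁ Sg Δ θ' Δ' :=
  .eqMSub_trans (.eqMSub_msub (.eqMSub_symm e.1)
    (.eqMSub_refl (.tyMSub_graft e.2.1.tyMSub_cod))) h

theorem Der.eqCtx_graft (hΓ₁ : Der Sg (.ctx Δ₁ Γ₁))
    (hθ : Der Sg (.tyMSub (Δ.graft Δ₁ Γ₁) θ (Δ'.graft Δ₁ Γ₁))) (h : FixesBase Δ₁ Γ₁ Sg Δ θ Δ')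
    (hΓ : Der Sg (.ctx (Δ'.graft Δ₁ Γ₁) (Γ.graft Γ₁ Δ'.length))) :
    Der Sg (.eqCtx (Δ.graft Δ₁ Γ₁) (Ctx.msub θ (Γ.graft Γ₁ Δ'.length))
      ((Ctx.msub θ Γ).graft Γ₁ Δ.length)) := by
  have hΓ' := Der.ctx_msub hθ hΓ
  have hs := Der.tyMSub_graft hθ.tyMSub_cod
  unfold Ctx.graft at *
  rw [Ctx.msub_append] at *
  refine .eqCtx_append ?_ hΓ'
  exact (Der.eqCtx_msub_comp hθ hs hΓ₁).eqCtx_trans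
    (.eqCtx_msub (.tyMSub_msub hθ hs) (.tyMSub_graft hθ.tyMSub_dom) h hΓ₁)

theorem VEq.sub_const {σ : Sub C} {a} (hcl : ∀ K, (a, K) ∈ Sg → Closed Sg K)
    (hσ : Der Sg (.tySub Δ Γ σ Ψ)) (h : VTy Sg Δ Ψ (.const a) F) :
    VEq Sg Δ Γ (.sub σ (.const a)) (.const a) (.sub σ F) := by
  obtain ⟨K, haK, c⟩ := h.1.const_inv
  obtain ⟨s, h₁, h₂, -⟩ := hcl K haK
  have hK := (h₁ Δ Ψ hσ.tySub_cod).ty_ne_kind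
  have hF := c.eq_kind_iff.not.1 hK
  have h' := VTy.sub hσ h
  have c' := c.subCls_right hσ
  rw [Expr.subCls_of_ne hF] at h' c'
  rw [Expr.subCls_of_ne hK] at c'
  exact ⟨.eq_sub_const hσ h.1, h'.1, c'.ty
    (.ty_conv (.ty_const hσ.tySub_dom haK) (.eq_symm (h₂ _ _ _ _ hσ))), h'.2⟩

theorem VEq.msub_const {a} (hcl : ∀ K, (a, K) ∈ Sg → Closed Sg K)
    (hθ : Der Sg (.tyMSub Δ θ Δ')) (h : VTy Sg Δ' Γ (.const a) F) :
    VEq Sg Δ (Ctx.msub θ Γ) (.msub θ (.const a)) (.const a) (.msub θ F) := by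
  obtain ⟨K, haK, c⟩ := h.1.const_inv
  obtain ⟨s, h₁, -, h₂⟩ := hcl K haK
  have hΓ := h.1.ty_ctxWF
  have hK := (h₁ Δ' Γ hΓ).ty_ne_kind
  have hF := c.eq_kind_iff.not.1 hK
  have h' := VTy.msub hθ h
  have c' := c.msubCls_right hθ hΓ
  rw [Expr.msubCls_of_ne hF] at h' c'
  rw [Expr.msubCls_of_ne hK] at c'
  exact ⟨.eq_msub_const hθ h.1, h'.1, c'.ty
    (.ty_conv (.ty_const h'.1.ty_ctxWF haK) (.eq_symm (h₂ _ _ _ _ hθ hΓ))), h'.2⟩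

/-- If the constants of `Sg'` are closed in the larger signature `Sg`, then the judgments over
`Sg'` hold, and are valid, in `Sg` over any base. -/
theorem Der.grafts {Sg' : Sig C} (hsub : ∀ a K, (a, K) ∈ Sg' → (a, K) ∈ Sg)
    (hcl : ∀ a K K', (a, K) ∈ Sg' → (a, K') ∈ Sg → Closed Sg K') (hΓ₁ : Der Sg (.ctx Δ₁ Γ₁))
    {J : Judgment C} (h : Der Sg' J) : J.Grafts Δ₁ Γ₁ Sg := by
  induction h with dsimp only [Judgment.Grafts] at *
  | mctx_nil => exact hΓ₁.mctx_of_ctx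
  | mctx_cons _ ih => exact .mctx_cons ih.1
  | ctx_nil _ ih => exact .ctx_msub (.tyMSub_graft ih) hΓ₁
  | ctx_cons _ ih => exact .ctx_cons ih.1
  | ty_type _ ih => exact ⟨.ty_type ih, .inl rfl⟩
  | ty_const _ ha ih =>
    obtain ⟨s, h₁, -⟩ := hcl _ _ _ ha (hsub _ _ ha)
    exact ⟨.ty_const ih (hsub _ _ ha), .of_ty (h₁ _ _ ih)⟩
  | ty_pi _ ih => exact ⟨.ty_pi ih.1, .sort ih.1.ty_ctxWF.ctx_tail⟩
  | ty_var_zero _ ih => exact ⟨.ty_var_zero ih.1, .of_ty (.ty_sub_sort (.tySub_wk ih.1) ih.1)⟩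
  | ty_var_succ _ _ ih ih' => exact .wk ih'.1 ih
  | ty_mvar_zero _ ih =>
    refine VTy.ctx ⟨.ty_mvar_zero ih.1, .of_ty (.ty_msub_sort (.tyMSub_wk ih.1) ih.1)⟩ ?_
    exact .eqCtx_graft hΓ₁ (.tyMSub_wk ih.1) (.shift (Δ' := [_]) (.mctx_cons ih.1)) ih.1.ty_ctxWF
  | @ty_mvar_succ Δ _ _ Γ' A' _ _ _ ih ih' =>
    exact (VTy.mwk ih'.1 ih).ctx (.eqCtx_graft (Δ := (Γ', A') :: Δ) hΓ₁ (.tyMSub_wk ih'.1)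
      (.shift (Δ' := [(Γ', A')]) (.mctx_cons ih'.1)) ih.1.ty_ctxWF)
  | ty_lam _ _ ih ih' => exact ⟨.ty_lam ih.1 ih'.1, .pi ih'.1⟩
  | ty_app _ _ ih ih' => exact .app ih ih'.1
  | ty_sub _ _ ih ih' => exact .sub ih ih'
  | ty_msub _ _ ih ih' =>
    exact (VTy.msub ih.1 ih').ctx (.eqCtx_graft hΓ₁ ih.1 ih.2 ih'.1.ty_ctxWF)
  | ty_conv _ _ ih ih' => exact .conv ih.1 ih'
  | tySub_shift _ hn ih =>
    rw [Ctx.graft_append] at *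
    exact .tySub_shift ih hn
  | tySub_cons _ _ _ ih ih' ih'' => exact .tySub_cons ih ih'.1 ih''.1
  | tySub_sub _ _ ih ih' => exact .tySub_sub ih ih'
  | tySub_msub _ _ ih ih' =>
    exact .tySub_ctx (.tySub_msub ih.1 ih') (.eqCtx_graft hΓ₁ ih.1 ih.2 ih'.tySub_dom)
      (.eqCtx_graft hΓ₁ ih.1 ih.2 ih'.tySub_cod)
  | tyMSub_shift _ hn ih =>
    subst hn
    refine ⟨?_, .shift ih⟩
    rw [MCtx.graft_append] at *
    exact .tyMSub_shift ih (by simp)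
  | tyMSub_cons _ _ _ ih ih' ih'' =>
    have h := Der.tyMSub_cons ih.1 ih'.1
      (.ty_ctx ih''.1 (Der.eqCtx_graft hΓ₁ ih.1 ih.2 ih'.1.ty_ctxWF).eqCtx_symm)
    exact ⟨h, .cons h ih.2⟩
  | tyMSub_msub _ _ ih ih' => exact ⟨.tyMSub_msub ih.1 ih'.1, .msub ih.1 ih'.1 ih.2 ih'.2⟩
  | eqCtx_nil _ ih => exact .eqCtx_rfl (.ctx_msub (.tyMSub_graft ih) hΓ₁)
  | eqCtx_cons _ _ _ _ ih ih₁ ih₂ ih₃ => exact .eqCtx_cons ih ih₁.1 ih₂.1 ih₃.1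
  | ty_ctx _ _ ih ih' => exact ih.ctx ih'
  | tySub_ctx _ _ _ ih ih' ih'' => exact .tySub_ctx ih ih' ih''
  | eq_ctx _ _ ih ih' => exact ih.ctx ih'
  | eqSub_ctx _ _ _ ih ih' ih'' => exact ih.ctx ih' ih''
  | eq_refl _ ih => exact .refl ih
  | eq_symm _ ih => exact ih.symm
  | eq_trans _ _ ih ih' => exact ih.trans ih'
  | eq_conv _ _ ih ih' => exact ih.conv ih'
  | eq_pi _ _ _ ih _ ih' => exact .pi ih ih'
  | eq_lam _ _ ih ih' => exact .lam ih ih'.1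
  | eq_app _ _ ih ih' => exact .app ih ih'
  | eq_sub _ _ ih ih' => exact .sub ih ih'
  | eq_msub _ _ ih ih' =>
    exact (VEq.msub ih.1 ih').ctx (.eqCtx_graft hΓ₁ ih.1.2.1 ih.2 ih'.2.1.ty_ctxWF)
  | eq_beta _ _ _ ih ih' ih'' => exact .beta ih.1 ih'.1 ih''.1
  | eq_eta _ _ ih ih' => exact .eta ih.1 ih'.1
  | eq_sub_id _ ih => exact .sub_id ih
  | eq_sub_comp _ _ _ ih ih' ih'' => exact .sub_comp ih ih' ih''
  | eq_sub_type _ ih => exact .sub_type ih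
  | eq_sub_const _ h ih ih' =>
    obtain ⟨K, hK, -⟩ := h.const_inv
    exact .sub_const (fun K' => hcl _ _ K' hK) ih ih'
  | eq_sub_var_zero _ _ _ ih ih' ih'' => exact .sub_var_zero ih ih'.1 ih''.1
  | eq_var_succ _ ih => exact .var_succ ih
  | eq_sub_pi _ _ ih ih' => exact .sub_pi ih ih'.1
  | eq_sub_lam _ _ _ ih ih' ih'' => exact .sub_lam ih ih'.1 ih''.1
  | eq_sub_app _ _ _ ih ih' ih'' => exact .sub_app ih ih' ih''.1
  | eq_msub_id _ ih => exact .msub_id ih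
  | eq_msub_comp _ _ _ ih ih' ih'' =>
    exact (VEq.msub_comp ih.1 ih'.1 ih'').ctx (.eqCtx_graft hΓ₁ (.tyMSub_msub ih.1 ih'.1)
      (.msub ih.1 ih'.1 ih.2 ih'.2) ih''.1.ty_ctxWF)
  | eq_msub_type _ _ ih ih' => exact (VEq.msub_type ih.1 ih').ctx (.eqCtx_graft hΓ₁ ih.1 ih.2 ih')
  | eq_msub_const _ h ih ih' =>
    obtain ⟨K, hK, -⟩ := h.const_inv
    exact (VEq.msub_const (fun K' => hcl _ _ K' hK) ih.1 ih').ctx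
      (.eqCtx_graft hΓ₁ ih.1 ih.2 ih'.1.ty_ctxWF)
  | eq_msub_var _ _ ih ih' =>
    exact (VEq.msub_var ih.1 ih').ctx (.eqCtx_graft hΓ₁ ih.1 ih.2 ih'.1.ty_ctxWF)
  | eq_msub_mvar_zero _ _ _ ih ih' ih'' =>
    have e := Der.eqCtx_graft hΓ₁ ih.1 ih.2 ih'.1.ty_ctxWF
    exact (VEq.msub_mvar_zero ih.1 ih'.1 (.ty_ctx ih''.1 e.eqCtx_symm)).ctx e
  | eq_mvar_succ _ ih => exact .mvar_succ ih
  | eq_msub_pi _ _ ih ih' =>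
    exact (VEq.msub_pi ih.1 ih'.1).ctx (.eqCtx_graft hΓ₁ ih.1 ih.2 ih'.1.ty_ctxWF.ctx_tail)
  | eq_msub_lam _ _ _ ih ih' ih'' =>
    exact (VEq.msub_lam ih.1 ih'.1 ih''.1).ctx
      (.eqCtx_graft hΓ₁ ih.1 ih.2 ih'.1.ty_ctxWF.ctx_tail)
  | eq_msub_app _ _ _ ih ih' ih'' =>
    exact (VEq.msub_app ih.1 ih' ih''.1).ctx (.eqCtx_graft hΓ₁ ih.1 ih.2 ih'.1.ty_ctxWF)
  | eq_msub_sub _ _ _ ih ih' ih'' =>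
    exact (VEq.msub_sub ih.1 ih' ih'').ctx (.eqCtx_graft hΓ₁ ih.1 ih.2 ih'.tySub_dom)
  | eqSub_refl _ ih => exact .refl ih
  | eqSub_symm _ ih => exact ih.symm
  | eqSub_trans _ _ ih ih' => exact ih.trans ih'
  | eqSub_cons _ _ _ ih ih' ih'' => exact .cons ih ih'.1 ih''
  | eqSub_sub _ _ ih ih' => exact .sub ih ih'
  | eqSub_msub _ _ ih ih' =>
    exact (VEqSub.msub ih.1 ih').ctx (.eqCtx_graft hΓ₁ ih.1.2.1 ih.2 ih'.2.1.tySub_dom)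
      (.eqCtx_graft hΓ₁ ih.1.2.1 ih.2 ih'.2.1.tySub_cod)
  | eqSub_cons_shift _ hn ih =>
    rw [← List.cons_append, Ctx.graft_append] at ih
    exact .cons_shift ih hn
  | eqSub_sub_cons _ _ ih ih' => exact .sub_cons ih ih'
  | eqSub_shift_shift _ hm hn ih =>
    rw [Ctx.graft_append, Ctx.graft_append] at *
    exact .shift_shift ih hm hn
  | eqSub_id_left _ ih => exact .id_left ih
  | eqSub_id_right _ ih => exact .id_right ih
  | eqSub_assoc _ _ _ ih ih' ih'' => exact .assoc ih ih' ih''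
  | eqSub_eta _ hn ih =>
    rw [Ctx.graft_append] at *
    exact .eta ih hn
  | eqSub_msub_shift _ _ hn ih ih' =>
    have e := Der.eqCtx_graft hΓ₁ ih.1 ih.2 ih'
    have e' := Der.eqCtx_graft hΓ₁ ih.1 ih.2
      (Der.ctx_of_append (by rw [← Ctx.graft_append]; exact ih'))
    rw [← Ctx.msub_append]
    rw [Ctx.graft_append] at ih' e
    exact (VEqSub.msub_shift ih.1 ih' hn).ctx e e'
  | eqSub_msub_cons _ _ _ _ ih ih₁ ih₂ ih₃ =>
    exact (VEqSub.msub_cons ih.1 ih₁ ih₂.1 ih₃.1).ctx (.eqCtx_graft hΓ₁ ih.1 ih.2 ih₁.tySub_dom)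
      (.eqCtx_graft (Γ := _ :: _) hΓ₁ ih.1 ih.2 (.ctx_cons ih₂.1))
  | eqSub_msub_sub _ _ _ ih ih' ih'' =>
    exact (VEqSub.msub_sub ih.1 ih' ih'').ctx (.eqCtx_graft hΓ₁ ih.1 ih.2 ih'.tySub_dom)
      (.eqCtx_graft hΓ₁ ih.1 ih.2 ih''.tySub_cod)
  | eqSub_msub_msub _ _ _ ih ih' ih'' =>
    have h := FixesBase.msub ih.1 ih'.1 ih.2 ih'.2
    have hc := Der.tyMSub_msub ih.1 ih'.1
    exact (VEqSub.msub_msub ih.1 ih'.1 ih'').ctx (.eqCtx_graft hΓ₁ hc h ih''.tySub_dom)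
      (.eqCtx_graft hΓ₁ hc h ih''.tySub_cod)
  | eqMSub_refl _ ih => exact ⟨.refl ih.1, ih.2⟩
  | eqMSub_symm _ ih => exact ⟨ih.1.symm, ih.2.congr ih.1⟩
  | eqMSub_trans _ _ ih ih' => exact ⟨ih.1.trans ih'.1, ih.2⟩
  | eqMSub_cons _ _ _ ih ih' ih'' =>
    have h := VEqMSub.cons ih.1 ih'.1
      (ih''.ctx (Der.eqCtx_graft hΓ₁ ih.1.2.1 ih.2 ih'.1.ty_ctxWF).eqCtx_symm)
    exact ⟨h, .cons h.2.1 ih.2⟩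
  | eqMSub_msub _ _ ih ih' =>
    exact ⟨.msub ih.1 ih'.1, .msub ih.1.2.1 ih'.1.2.1 ih.2 ih'.2⟩
  | @eqMSub_cons_shift _ Δ₀ Δ₀' Γ A _ _ _ _ hn ih =>
    subst hn
    have ih' := ih.1
    rw [← List.cons_append, MCtx.graft_append] at ih'
    refine ⟨.cons_shift ih' (by simp), .msub ih.1 ?_ ih.2
      (.shift (Δ' := (Γ, A) :: Δ₀') ih.1.tyMSub_cod)⟩
    rw [← List.cons_append, MCtx.graft_append]
    exact .tyMSub_shift ih'.tyMSub_cod (by simp)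
  | eqMSub_msub_cons _ _ ih ih' => exact ⟨.msub_cons ih.1 ih'.1, .msub ih.1 ih'.1 ih.2 ih'.2⟩
  | eqMSub_shift_shift _ hm hn ih =>
    subst hm hn
    have hm := ih
    rw [MCtx.graft_append] at hm
    have h₁ := FixesBase.shift ih
    have h₂ := FixesBase.shift hm.mctx_of_append
    have hm' := hm
    rw [MCtx.graft_append] at hm'
    refine ⟨?_, .msub ?_ ?_ h₁ h₂⟩
    · rw [MCtx.graft_append, MCtx.graft_append]
      exact .shift_shift hm' (by simp) (by simp)
    · rw [MCtx.graft_append]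
      exact .tyMSub_shift hm (by simp)
    · rw [MCtx.graft_append]
      exact .tyMSub_shift hm'.mctx_of_append (by simp)
  | eqMSub_id_left _ ih =>
    exact ⟨.id_left ih.1, .msub (.tyMSub_id ih.1.tyMSub_dom) ih.1 (.id ih.1.tyMSub_dom) ih.2⟩
  | eqMSub_id_right _ ih =>
    exact ⟨.id_right ih.1, .msub ih.1 (.tyMSub_id ih.1.tyMSub_cod) ih.2 (.id ih.1.tyMSub_cod)⟩
  | eqMSub_assoc _ _ _ ih ih' ih'' =>
    exact ⟨.assoc ih.1 ih'.1 ih''.1, .msub ih.1 (.tyMSub_msub ih'.1 ih''.1) ih.2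
      (.msub ih'.1 ih''.1 ih'.2 ih''.2)⟩
  | eqMSub_eta _ hn ih =>
    subst hn
    refine ⟨?_, .shift ih⟩
    rw [MCtx.graft_append] at *
    exact .eta ih (by simp)

end

end

section

variable {C : Type u} {Sg Sg' : Sig C}

/-- Validity of a judgment: classifiers are well-formed, and both sides of an equation are
well-typed. -/
def Judgment.Valid (Sg : Sig C) : Judgment C → Prop
  | .ty Δ Γ _ F => IsCls Sg Δ Γ F
  | .eq Δ Γ E E' F => VEq Sg Δ Γ E E' F
  | .eqSub Δ Γ σ σ' Ψ => VEqSub Sg Δ Γ σ σ' Ψ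
  | .eqMSub Δ θ θ' Δ' => VEqMSub Sg Δ θ θ' Δ'
  | _ => True

@[simp] theorem Ctx.graft_nil (Γ : Ctx C) (n : ℕ) : Γ.graft [] n = Γ := List.append_nil Γ

@[simp] theorem MCtx.extend_nil (n : ℕ) : ∀ Δ : MCtx C, Δ.extend [] n = Δ
  | [] => rfl
  | (Ψ, A) :: Δ => by rw [MCtx.extend, MCtx.extend_nil n Δ, Ctx.graft_nil]

@[simp] theorem MCtx.graft_nil (Δ : MCtx C) : Δ.graft [] [] = Δ := by simp [MCtx.graft]

/-- `Sg'` is a part of `Sg`, and its constants are closed in `Sg`. -/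
structure Sig.ClosedIn (Sg' Sg : Sig C) : Prop where
  subset : ∀ a K, (a, K) ∈ Sg' → (a, K) ∈ Sg
  closed : ∀ a K K', (a, K) ∈ Sg' → (a, K') ∈ Sg → Closed Sg K'

theorem Der.mono_valid (hS : Sig.ClosedIn Sg' Sg) {J : Judgment C} (h : Der Sg' J) :
    Der Sg J ∧ J.Valid Sg := by
  have := Der.grafts hS.subset hS.closed (.ctx_nil .mctx_nil) h
  cases J <;> simp_all [Judgment.Grafts, Judgment.Valid, VTy, VEq, VEqSub, VEqMSub]

theorem Der.valid (hS : Sig.ClosedIn Sg Sg) {J : Judgment C} (h : Der Sg J) : J.Valid Sg :=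
  (h.mono_valid hS).2

section

variable {Δ Δ' Δ'' : MCtx C} {Γ Γ' Ψ Φ : Ctx C} {σ σ' τ : Sub C} {θ θ' : MSub C}
  {A B E E' F K M N : Expr C} {s : Srt} {n : ℕ}

theorem Der.vty (hS : Sig.ClosedIn Sg Sg) (h : Der Sg (.ty Δ Γ E F)) : VTy Sg Δ Γ E F :=
  ⟨h, h.valid hS⟩

theorem Der.veq (hS : Sig.ClosedIn Sg Sg) (h : Der Sg (.eq Δ Γ E E' F)) : VEq Sg Δ Γ E E' F :=
  h.valid hS

theorem Der.veqSub (hS : Sig.ClosedIn Sg Sg) (h : Der Sg (.eqSub Δ Γ σ σ' Ψ)) :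
    VEqSub Sg Δ Γ σ σ' Ψ :=
  h.valid hS

theorem Der.veqMSub (hS : Sig.ClosedIn Sg Sg) (h : Der Sg (.eqMSub Δ θ θ' Δ')) :
    VEqMSub Sg Δ θ θ' Δ' :=
  h.valid hS

theorem Der.pi_cod (hS : Sig.ClosedIn Sg Sg) (h : Der Sg (.ty Δ Γ E (.pi A B))) :
    ∃ s, Der Sg (.ty Δ (A :: Γ) B (.sort s)) :=
  IsCls.pi_inv (h.valid hS)

theorem VEq.convs {F'} (h : VEq Sg Δ Γ E E' F) (c : Conv Sg Δ Γ F F') (hF' : IsCls Sg Δ Γ F') :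
    VEq Sg Δ Γ E E' F' :=
  ⟨c.eq h.1, c.ty h.2.1, c.ty h.2.2.1, hF'⟩

/-! ### Elimination of meta-substitutions from closed expressions -/

mutual

/-- No meta-variable and no meta-substitution occurs in the expression. -/
def Expr.MetaFree : Expr C → Prop
  | .sort _ => True
  | .const _ => True
  | .pi A B => A.MetaFree ∧ B.MetaFree
  | .var _ => True
  | .mvar _ => False
  | .lam M => M.MetaFree
  | .app E N => E.MetaFree ∧ N.MetaFree
  | .sub σ E => σ.MetaFree ∧ E.MetaFree
  | .msub _ _ => False

/-- No meta-variable and no meta-substitution occurs in the substitution. -/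
def Sub.MetaFree : Sub C → Prop
  | .shift _ => True
  | .cons σ M => σ.MetaFree ∧ M.MetaFree
  | .sub σ τ => σ.MetaFree ∧ τ.MetaFree
  | .msub _ _ => False

end

/-- A list of meta-free expressions. -/
def MSub.MetaFree : MSub C → Prop
  | .shift n => n = 0
  | .cons θ M => θ.MetaFree ∧ M.MetaFree
  | .msub _ _ => False

theorem Der.tyMSub_shift_inv (h : Der Sg (.tyMSub Δ (.shift n) Δ')) :
    ∃ Δ₂, Δ = Δ₂ ++ Δ' ∧ Δ₂.length = n := by
  cases h; exact ⟨_, rfl, by assumption⟩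

theorem Der.tyMSub_msub_inv (h : Der Sg (.tyMSub Δ (.msub θ θ') Δ')) :
    ∃ Δ₀, Der Sg (.tyMSub Δ θ Δ₀) ∧ Der Sg (.tyMSub Δ₀ θ' Δ') := by
  cases h; exact ⟨_, by assumption, by assumption⟩

theorem Der.eqMSub_cons_wk (h : Der Sg (.tyMSub Δ (.cons θ M) ((Ψ, A) :: Δ'))) :
    Der Sg (.eqMSub Δ (.msub (.cons θ M) (.shift 1)) θ Δ') :=
  .eqMSub_trans (.eqMSub_cons_shift (Δ₀' := []) h rfl) (.eqMSub_id_right h.tyMSub_cons_inv.1)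

theorem Der.eqCtx_msub_cons_wk (h : Der Sg (.tyMSub Δ (.cons θ M) ((Ψ, A) :: Δ')))
    (hΓ : Der Sg (.ctx Δ' Γ)) :
    Der Sg (.eqCtx Δ (Ctx.msub (.cons θ M) (Ctx.msub (.shift 1) Γ)) (Ctx.msub θ Γ)) := by
  obtain ⟨h₁, h₂, -⟩ := h.tyMSub_cons_inv
  have hw := Der.tyMSub_wk h₂
  exact (Der.eqCtx_msub_comp h hw hΓ).eqCtx_trans
    (.eqCtx_msub (.tyMSub_msub h hw) h₁ h.eqMSub_cons_wk hΓ)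

/-- `⟦θ, M⟧⟦⇑¹⟧E ≡ ⟦θ⟧E` -/
theorem VEq.msub_cons_wk (h : Der Sg (.tyMSub Δ (.cons θ M) ((Ψ, A) :: Δ')))
    (hE : VTy Sg Δ' Γ E F) :
    VEq Sg Δ (Ctx.msub θ Γ) (.msub (.cons θ M) (.msub (.shift 1) E)) (.msub θ E)
      (F.msubCls θ) := by
  obtain ⟨h₁, h₂, -⟩ := h.tyMSub_cons_inv
  have hw := Der.tyMSub_wk h₂
  have hc := Der.tyMSub_msub h hw
  have hΓ := hE.1.ty_ctxWF
  have e := h.eqMSub_cons_wk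
  have e' := VEq.trans (VEq.msub_comp h hw hE) (.msub ⟨e, hc, h₁⟩ (.refl hE))
  exact (e'.convs (Conv.msubCls_left hΓ hE.2 hc e)
    ((hE.2.msub h₁).ctx (Der.eqCtx_msub hc h₁ e hΓ).eqCtx_symm)).ctx (.eqCtx_msub hc h₁ e hΓ)

theorem Conv.msubCls_cons_wk (h : Der Sg (.tyMSub Δ (.cons θ M) ((Ψ, A) :: Δ')))
    (hΓ : Der Sg (.ctx Δ' Γ)) (hF : IsCls Sg Δ' Γ F) :
    Conv Sg Δ (Ctx.msub θ Γ) ((F.msubCls (.shift 1)).msubCls (.cons θ M)) (F.msubCls θ) := by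
  obtain ⟨h₁, h₂, -⟩ := h.tyMSub_cons_inv
  have hw := Der.tyMSub_wk h₂
  have hc := Der.tyMSub_msub h hw
  have e := h.eqMSub_cons_wk
  exact ((Conv.msubCls_comp h hw hF).trans (.msubCls_left hΓ hF hc e)).ctx
    (.eqCtx_msub hc h₁ e hΓ)

theorem Der.eq_msub_single (hθ : Der Sg (.tyMSub Δ θ Δ')) (hN : Der Sg (.ty Δ' Γ N A))
    (hB : Der Sg (.ty Δ' (A :: Γ) B (.sort s))) :
    Der Sg (.eq Δ (Ctx.msub θ Γ) (.msub θ (.sub (.single N) B))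
      (.sub (.single (.msub θ N)) (.msub θ B)) (.sort s)) :=
  have hs := Der.tySub_single hN hB.ty_head
  .eq_trans (.eq_msub_sub_sort hθ hs hB) (.eq_sub_left (.tySub_msub hθ hs)
    (.eqSub_msub_single hθ hB.ty_head hN) (.ty_msub_sort hθ hB))

theorem Expr.exists_metaFree_mvar (hS : Sig.ClosedIn Sg Sg) : ∀ (n : ℕ) {Δ : MCtx C} {Γ : Ctx C}
    {F : Expr C} {θ : MSub C}, Der Sg (.ty Δ Γ (.mvar n) F) → θ.MetaFree →
    Der Sg (.tyMSub [] θ Δ) → ∃ E' : Expr C, E'.MetaFree ∧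
      Der Sg (.eq [] (Ctx.msub θ Γ) (.msub θ (.mvar n)) E' (F.msubCls θ))
  | n, _, _, _, .shift k, h, hk, hθ => by
    obtain ⟨Δ₂, e, -⟩ := hθ.tyMSub_shift_inv
    obtain ⟨rfl, rfl⟩ := List.nil_eq_append_iff.1 e
    obtain ⟨Δ₂, _, _, _, e, -⟩ := h.mvar_inv
    simp at e
  | 0, _, _, _, .cons θ M, h, hM, hθ => by
    obtain ⟨Δ', Ψ, A, rfl, hA, e, c⟩ := h.mvar_zero_inv
    obtain ⟨h₁, h₂, h₃⟩ := hθ.tyMSub_cons_inv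
    have e₁ := (Der.eqCtx_msub_cons_wk hθ hA.ty_ctxWF).eqCtx_symm.eqCtx_trans
      (.eqCtx_msub_right hθ e)
    refine ⟨M, hM.2, (c.msubCls_right hθ h.ty_ctxWF).eq ?_⟩
    have c' := (Conv.msubCls_cons_wk hθ hA.ty_ctxWF (.of_ty hA)).symm.ctx e₁
    rw [Expr.msubCls_of_ne hA.ty_ne_kind, Expr.msubCls_of_ne hA.ty_ne_kind] at c'
    exact c'.eq (.eq_ctx (.eq_msub_mvar_zero h₁ hA h₃) e₁)
  | n + 1, _, _, _, .cons θ M, h, hM, hθ => by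
    have hv := h.valid hS
    obtain ⟨Δ', Ψ, B, Γ', A, rfl, hB, hA, e, c⟩ := h.mvar_succ_inv
    obtain ⟨h₁, h₂, h₃⟩ := hθ.tyMSub_cons_inv
    obtain ⟨E', hE', e'⟩ := Expr.exists_metaFree_mvar hS n hA hM.1 h₁
    have hcls := hA.valid hS
    have e₁ := (Der.eqCtx_msub_cons_wk hθ hA.ty_ctxWF).eqCtx_symm.eqCtx_trans
      (.eqCtx_msub_right hθ e)
    have e₂ := VEq.trans (VEq.msub_cons_wk hθ (hA.vty hS)) (e'.veq hS)
    have c' := (Conv.msubCls_cons_wk hθ hA.ty_ctxWF hcls).symm.ctx e₁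
    rw [Expr.msubCls_of_ne hA.mvar_cls_ne_kind (.shift 1)] at c'
    refine ⟨E', hE', .eq_trans (.eq_msub (.eqMSub_refl hθ) (.eq_mvar_succ h)) ?_⟩
    exact (c'.trans (c.msubCls_right hθ h.ty_ctxWF)).eq (.eq_ctx e₂.1 e₁)

theorem MSub.exists_metaFree_shift : ∀ (Δ₂ : MCtx C) {Δ : MCtx C} {θ : MSub C},
    Der Sg (.tyMSub [] θ (Δ₂ ++ Δ)) → θ.MetaFree → ∃ θ' : MSub C, θ'.MetaFree ∧
      VEqMSub Sg [] (.msub θ (.shift Δ₂.length)) θ' Δ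
  | [], _, θ, h, hθ => ⟨θ, hθ, .id_right h⟩
  | _ :: _, _, .shift k, h, hθ => by
    obtain ⟨_, e, -⟩ := h.tyMSub_shift_inv
    simp at e
  | (Ψ, A) :: Δ₂, _, .cons θ M, h, hθ => by
    obtain ⟨h₁, h₂, h₃⟩ := h.tyMSub_cons_inv
    obtain ⟨θ', hθ', e⟩ := MSub.exists_metaFree_shift Δ₂ h₁ hθ.1
    exact ⟨θ', hθ', .trans (.cons_shift h rfl) e⟩

mutual

theorem Expr.exists_metaFree (hS : Sig.ClosedIn Sg Sg) : ∀ (E : Expr C) {Δ : MCtx C} {Γ : Ctx C}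
    {F : Expr C} {θ : MSub C}, Der Sg (.ty Δ Γ E F) → θ.MetaFree → Der Sg (.tyMSub [] θ Δ) →
      ∃ E' : Expr C, E'.MetaFree ∧ Der Sg (.eq [] (Ctx.msub θ Γ) (.msub θ E) E' (F.msubCls θ))
  | .sort _, _, _, _, _, h, _, hθ => by
    obtain ⟨rfl, rfl⟩ := h.sort_inv
    exact ⟨.sort .type, trivial, .eq_msub_type hθ h.ty_ctxWF⟩
  | .const a, _, _, _, _, h, _, hθ => by
    obtain ⟨K, hK, c⟩ := h.const_inv
    obtain ⟨s, h₁, -⟩ := hS.closed a K K hK hK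
    refine ⟨.const a, trivial, ?_⟩
    rw [Expr.msubCls_of_ne (c.eq_kind_iff.not.1 (h₁ _ _ h.ty_ctxWF).ty_ne_kind)]
    exact .eq_msub_const hθ h
  | .pi A B, _, _, _, _, h, hm, hθ => by
    obtain ⟨s, hB, c⟩ := h.pi_inv
    obtain ⟨A', hA', e⟩ := Expr.exists_metaFree hS A hB.ty_head hm hθ
    obtain ⟨B', hB', e'⟩ := Expr.exists_metaFree hS B hB hm hθ
    refine ⟨.pi A' B', ⟨hA', hB'⟩, (c.msubCls_right hθ h.ty_ctxWF).eq ?_⟩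
    refine (Conv.msub_sort hθ h.ty_ctxWF).symm.eq (.eq_trans (.eq_msub_pi hθ hB) ?_)
    exact .eq_pi ((Conv.msub_sort hθ h.ty_ctxWF).eq e) (.ty_msub_sort hθ hB.ty_head)
      ((Conv.msub_sort hθ hB.ty_ctxWF).eq e')
  | .var n, _, _, _, _, h, _, hθ => by
    refine ⟨.var n, trivial, ?_⟩
    rw [Expr.msubCls_of_ne h.var_cls_ne_kind]
    exact .eq_msub_var hθ h
  | .mvar n, _, _, _, _, h, hm, hθ => Expr.exists_metaFree_mvar hS n h hm hθ
  | .lam M, _, _, _, _, h, hm, hθ => by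
    obtain ⟨A, B, hM, hB, c⟩ := h.lam_inv
    obtain ⟨M', hM', e⟩ := Expr.exists_metaFree hS M hM hm hθ
    rw [Expr.msubCls_of_ne hB.ty_ne_kind] at e
    refine ⟨.lam M', hM', (c.msubCls_right hθ h.ty_ctxWF).eq ?_⟩
    exact .eq_conv (.eq_trans (.eq_msub_lam hθ hM hB) (.eq_lam e (.ty_msub_sort hθ hB)))
      (.eq_symm (.eq_msub_pi hθ hB))
  | .app E N, _, _, _, _, h, hm, hθ => by
    obtain ⟨A, B, hE, hN, c⟩ := h.app_inv
    obtain ⟨s, hB⟩ := hE.pi_cod hS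
    obtain ⟨E', hE', e⟩ := Expr.exists_metaFree hS E hE hm hθ
    obtain ⟨N', hN', e'⟩ := Expr.exists_metaFree hS N hN hm hθ
    rw [Expr.msubCls_of_ne hB.ty_head.ty_ne_kind] at e'
    refine ⟨.app E' N', ⟨hE', hN'⟩, (c.msubCls_right hθ h.ty_ctxWF).eq ?_⟩
    exact .eq_conv (.eq_trans (.eq_msub_app hθ hE hN)
      (.eq_app (.eq_conv e (.eq_msub_pi hθ hB)) e')) (.eq_symm (.eq_msub_single hθ hN hB))
  | .sub σ E, _, _, _, _, h, hm, hθ => by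
    obtain ⟨Ψ, F', hσ, hE, c⟩ := h.sub_inv
    obtain ⟨σ', hσ', e⟩ := Sub.exists_metaFree hS σ hσ hm hθ
    obtain ⟨E', hE', e'⟩ := Expr.exists_metaFree hS E hE hm hθ
    refine ⟨.sub σ' E', ⟨hσ', hE'⟩, (c.msubCls_right hθ h.ty_ctxWF).eq ?_⟩
    exact (Conv.msubCls_subCls hθ hσ (hE.valid hS)).symm.eq
      (.eq_trans (.eq_msub_sub hθ hσ hE) (.eq_sub e e'))
  | .msub θ' E, _, _, _, _, h, hm, hθ => by
    obtain ⟨Δ', Γ', F', hθ', hE, e, c⟩ := h.msub_inv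
    obtain ⟨θ'', hm', e₁⟩ := MSub.exists_metaFree hS θ' hθ' hm hθ
    obtain ⟨E', hE', e'⟩ := Expr.exists_metaFree hS E hE hm' e₁.2.2
    have hΓ := hE.ty_ctxWF
    have hF := hE.valid hS
    have e₂ := (Der.eqCtx_msub_comp hθ hθ' hΓ).eqCtx_symm.eqCtx_trans (.eqCtx_msub_right hθ e)
    have e₃ := (Der.eqCtx_msub e₁.2.1 e₁.2.2 e₁.1 hΓ).eqCtx_symm
    refine ⟨E', hE', (c.msubCls_right hθ h.ty_ctxWF).eq ?_⟩
    refine ((Conv.msubCls_comp hθ hθ' hF).symm.ctx e₂).eq (.eq_ctx ?_ e₂)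
    refine .eq_trans (.eq_msub_comp hθ hθ' hE) (.eq_trans (.eq_msub e₁.1 (.eq_refl hE)) ?_)
    exact (Conv.msubCls_left hΓ hF e₁.2.1 e₁.1).symm.eq (.eq_ctx e' e₃)

theorem Sub.exists_metaFree (hS : Sig.ClosedIn Sg Sg) : ∀ (σ : Sub C) {Δ : MCtx C} {Γ Ψ : Ctx C}
    {θ : MSub C}, Der Sg (.tySub Δ Γ σ Ψ) → θ.MetaFree → Der Sg (.tyMSub [] θ Δ) →
      ∃ σ' : Sub C, σ'.MetaFree ∧
        Der Sg (.eqSub [] (Ctx.msub θ Γ) (.msub θ σ) σ' (Ctx.msub θ Ψ))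
  | .shift n, _, _, _, _, h, _, hθ => by
    obtain ⟨Γ', Ψ', rfl, rfl, e⟩ := h.shift_inv
    exact ⟨.shift Γ'.length, trivial, .eqSub_ctx (VEqSub.msub_shift hθ h.tySub_dom rfl).1
      (.eqCtx_rfl (.ctx_msub hθ h.tySub_dom)) (.eqCtx_msub_right hθ e)⟩
  | .cons σ M, _, _, _, _, h, hm, hθ => by
    obtain ⟨Ψ', A, hσ, hA, hM, e⟩ := h.cons_inv
    obtain ⟨σ', hσ', e₁⟩ := Sub.exists_metaFree hS σ hσ hm hθ
    obtain ⟨M', hM', e₂⟩ := Expr.exists_metaFree hS M hM hm hθ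
    refine ⟨.cons σ' M', ⟨hσ', hM'⟩, .eqSub_ctx (.eqSub_trans (.eqSub_msub_cons hθ hσ hA hM) ?_)
      (.eqCtx_rfl (.ctx_msub hθ h.tySub_dom)) (.eqCtx_msub_right hθ e)⟩
    exact .eqSub_cons (.eq_conv e₂ (.eq_msub_sub_sort hθ hσ hA)) (.ty_msub_sort hθ hA) e₁
  | .sub σ τ, _, _, _, _, h, hm, hθ => by
    obtain ⟨Ψ', hσ, hτ⟩ := h.tySub_sub_inv
    obtain ⟨σ', hσ', e₁⟩ := Sub.exists_metaFree hS σ hσ hm hθ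
    obtain ⟨τ', hτ', e₂⟩ := Sub.exists_metaFree hS τ hτ hm hθ
    exact ⟨.sub σ' τ', ⟨hσ', hτ'⟩, .eqSub_trans (.eqSub_msub_sub hθ hσ hτ) (.eqSub_sub e₁ e₂)⟩
  | .msub θ' σ, _, _, _, _, h, hm, hθ => by
    obtain ⟨Δ', Γ', Ψ', hθ', hσ, e, e'⟩ := h.tySub_msub_inv
    obtain ⟨θ'', hm', e₁⟩ := MSub.exists_metaFree hS θ' hθ' hm hθ
    obtain ⟨σ', hσ', e₂⟩ := Sub.exists_metaFree hS σ hσ hm' e₁.2.2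
    have e₃ : ∀ {Φ}, Der Sg (.ctx Δ' Φ) → _ := fun hΦ =>
      (Der.eqCtx_msub e₁.2.1 e₁.2.2 e₁.1 hΦ).eqCtx_symm
    have e₄ : ∀ {Φ}, Der Sg (.ctx Δ' Φ) → _ := fun hΦ => (Der.eqCtx_msub_comp hθ hθ' hΦ).eqCtx_symm
    refine ⟨σ', hσ', .eqSub_ctx ?_ ((e₄ hσ.tySub_dom).eqCtx_trans (.eqCtx_msub_right hθ e))
      ((e₄ hσ.tySub_cod).eqCtx_trans (.eqCtx_msub_right hθ e'))⟩
    exact .eqSub_trans (.eqSub_msub_msub hθ hθ' hσ) (.eqSub_trans (.eqSub_msub e₁.1 (.eqSub_refl hσ))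
      (.eqSub_ctx e₂ (e₃ hσ.tySub_dom) (e₃ hσ.tySub_cod)))

theorem MSub.exists_metaFree (hS : Sig.ClosedIn Sg Sg) : ∀ (θ' : MSub C) {Δ Δ' : MCtx C}
    {θ : MSub C}, Der Sg (.tyMSub Δ θ' Δ') → θ.MetaFree → Der Sg (.tyMSub [] θ Δ) →
      ∃ θ'' : MSub C, θ''.MetaFree ∧ VEqMSub Sg [] (.msub θ θ') θ'' Δ'
  | .shift _, _, _, _, h, hm, hθ => by
    obtain ⟨Δ₂, rfl, rfl⟩ := h.tyMSub_shift_inv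
    exact MSub.exists_metaFree_shift Δ₂ hθ hm
  | .cons θ' M, _, _, _, h, hm, hθ => by
    cases h with
    | tyMSub_cons h₁ h₂ h₃ =>
    obtain ⟨θ'', hm', e⟩ := MSub.exists_metaFree hS θ' h₁ hm hθ
    obtain ⟨M', hM', e'⟩ := Expr.exists_metaFree hS M h₃ hm hθ
    have e₁ := Der.eqCtx_msub_comp hθ h₁ h₂.ty_ctxWF
    refine ⟨.cons θ'' M', ⟨hm', hM'⟩, (VEqMSub.msub_cons hθ (.tyMSub_cons h₁ h₂ h₃)).trans ?_⟩
    exact .cons e h₂ (Der.veq hS (.eq_conv (.eq_ctx e' e₁) (.eq_msub_comp_sort hθ h₁ h₂)))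
  | .msub θ₁ θ₂, _, _, _, h, hm, hθ => by
    obtain ⟨Δ₀, h₁, h₂⟩ := h.tyMSub_msub_inv
    obtain ⟨θ₁', hm₁, e₁⟩ := MSub.exists_metaFree hS θ₁ h₁ hm hθ
    obtain ⟨θ₂', hm₂, e₂⟩ := MSub.exists_metaFree hS θ₂ h₂ hm₁ e₁.2.2
    exact ⟨θ₂', hm₂, .trans (.assoc hθ h₁ h₂) (.trans (.msub e₁ (.refl h₂)) e₂)⟩

end

/-- A closed expression is equal to a meta-free one. -/
theorem Der.exists_metaFree (hS : Sig.ClosedIn Sg Sg) (h : Der Sg (.ty [] [] K (.sort s))) :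
    ∃ K' : Expr C, K'.MetaFree ∧ Der Sg (.eq [] [] K K' (.sort s)) := by
  have hid := Der.tyMSub_id (Sg := Sg) (C := C) .mctx_nil
  obtain ⟨K', hK', e⟩ := Expr.exists_metaFree hS K h (θ := .shift 0) rfl hid
  exact ⟨K', hK', .eq_trans (.eq_symm (.eq_msub_id h))
    ((Conv.msub_sort hid (.ctx_nil .mctx_nil)).eq e)⟩

end

end

section

variable {C : Type u} {Sg Sg' : Sig C}

/-! ### Closed classifiers are fixed by all substitutions -/

section

variable {Δ Δ' : MCtx C} {Γ Γ' Γ₁ Ψ Ψ' Φ : Ctx C} {σ σ' τ τ' : Sub C} {θ : MSub C}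
  {A B E E' F K M N : Expr C} {s : Srt} {n : ℕ}

theorem Der.vty_mwk (h : Der Sg' (.ty [] Γ E F)) (hS : Sig.ClosedIn Sg' Sg)
    (hΔ : Der Sg (.mctx Δ)) : VTy Sg Δ Γ E F := by
  simpa [Judgment.Grafts, MCtx.graft, MCtx.extend] using
    Der.grafts hS.subset hS.closed (.ctx_nil hΔ) h

theorem Der.tySub_mwk (h : Der Sg' (.tySub [] Γ σ Ψ)) (hS : Sig.ClosedIn Sg' Sg)
    (hΔ : Der Sg (.mctx Δ)) : Der Sg (.tySub Δ Γ σ Ψ) := by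
  simpa [Judgment.Grafts, MCtx.graft, MCtx.extend] using
    Der.grafts hS.subset hS.closed (.ctx_nil hΔ) h

theorem Der.eqCtx_mwk (h : Der Sg' (.eqCtx [] Γ Γ')) (hS : Sig.ClosedIn Sg' Sg)
    (hΔ : Der Sg (.mctx Δ)) : Der Sg (.eqCtx Δ Γ Γ') := by
  simpa [Judgment.Grafts, MCtx.graft, MCtx.extend] using
    Der.grafts hS.subset hS.closed (.ctx_nil hΔ) h

theorem Conv.mwk (hS : Sig.ClosedIn Sg' Sg) (hΔ : Der Sg (.mctx Δ)) (h : Conv Sg' [] Γ F E') :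
    Conv Sg Δ Γ F E' := by
  induction h with
  | refl => exact .rfl
  | @tail E F _ e ih =>
    obtain ⟨s, e⟩ := e
    have : VEq Sg Δ Γ E F (.sort s) := by
      simpa [Judgment.Grafts, MCtx.graft, MCtx.extend] using
        Der.grafts hS.subset hS.closed (.ctx_nil hΔ) e
    exact ih.trans (.of_eq this.1)

theorem Der.veq_wk (h : Der Sg' (.eq [] [] E E' F)) (hS : Sig.ClosedIn Sg' Sg)
    (hΓ : Der Sg (.ctx Δ Γ)) : VEq Sg Δ Γ E E' F := by
  have : VEq Sg Δ (Ctx.msub (.shift 0) Γ) E E' F := by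
    simpa [Judgment.Grafts, MCtx.graft, MCtx.extend, Ctx.graft] using
      Der.grafts hS.subset hS.closed hΓ h
  exact this.ctx (.eqCtx_msub_id hΓ)

theorem Der.ty_wk (h : Der Sg' (.ty [] [] E F)) (hS : Sig.ClosedIn Sg' Sg)
    (hΓ : Der Sg (.ctx Δ Γ)) : Der Sg (.ty Δ Γ E F) :=
  ((Der.eq_refl h).veq_wk hS hΓ).2.1

theorem VTy.pi_cod (h : VTy Sg Δ Γ E (.pi A B)) : ∃ s, Der Sg (.ty Δ (A :: Γ) B (.sort s)) :=
  h.2.pi_inv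

/-! #### Meta-substitutions with empty codomain -/

mutual

theorem Expr.msub_fixed (hS : Sig.ClosedIn Sg' Sg) (hθ : Der Sg (.tyMSub Δ θ [])) :
    ∀ (E : Expr C) {Γ F}, E.MetaFree → Der Sg' (.ty [] Γ E F) →
      VEq Sg Δ (Ctx.msub θ Γ) (.msub θ E) E (F.msubCls θ)
  | .sort _, Γ, _, _, h => by
    have hΓ := (h.vty_mwk hS .mctx_nil).1.ty_ctxWF
    obtain ⟨rfl, rfl⟩ := h.sort_inv
    exact .msub_type hθ hΓ
  | .const a, Γ, F, _, h => by
    have hv := h.vty_mwk hS .mctx_nil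
    have hΓ := hv.1.ty_ctxWF
    have hΓ' := Der.ctx_msub hθ hΓ
    obtain ⟨K, hK, c⟩ := h.const_inv
    have hK' := hS.subset _ _ hK
    obtain ⟨s, h₁, -, h₃⟩ := hS.closed a K K hK hK'
    have ha := Der.ty_const (Sg := Sg) hΓ hK'
    have c' := (c.mwk hS .mctx_nil).msubCls_right hθ hΓ
    have hk := (h₁ _ _ hΓ).ty_ne_kind
    rw [Expr.msubCls_of_ne hk] at c'
    have t₁ := Der.ty_msub hθ ha
    rw [Expr.msubCls_of_ne hk] at t₁
    exact VEq.convs ⟨.eq_msub_const hθ ha, t₁, .ty_conv (.ty_const hΓ' hK')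
      (.eq_symm (h₃ _ _ _ _ hθ hΓ)), .of_ty (.ty_msub_sort hθ (h₁ _ _ hΓ))⟩ c' (hv.2.msub hθ)
  | .pi A B, Γ, F, hm, h => by
    have hv := h.vty_mwk hS .mctx_nil
    have hΓ := hv.1.ty_ctxWF
    obtain ⟨s, hB, c⟩ := h.pi_inv
    have hB' := (hB.vty_mwk hS .mctx_nil).1
    have iA := (Expr.msub_fixed hS hθ A hm.1 hB.ty_head).convs (.msub_sort hθ hΓ)
      (.sort (.ctx_msub hθ hΓ))
    have iB := (Expr.msub_fixed hS hθ B hm.2 hB).convs (.msub_sort hθ hB'.ty_ctxWF)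
      (.sort (.ctx_msub hθ hB'.ty_ctxWF))
    refine ((VEq.msub_pi hθ hB').trans (.pi iA iB)).convs
      ((Conv.msub_sort hθ hΓ).symm.trans ((c.mwk hS .mctx_nil).msubCls_right hθ hΓ)) (hv.2.msub hθ)
  | .var n, Γ, F, _, h => by
    have hv := h.vty_mwk hS .mctx_nil
    rw [Expr.msubCls_of_ne h.var_cls_ne_kind]
    exact .msub_var hθ hv
  | .lam M, Γ, F, hm, h => by
    have hv := h.vty_mwk hS .mctx_nil
    have hΓ := hv.1.ty_ctxWF
    obtain ⟨A, B, hM, hB, c⟩ := h.lam_inv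
    have hB' := (hB.vty_mwk hS .mctx_nil).1
    have hM' := (hM.vty_mwk hS .mctx_nil).1
    have iM := Expr.msub_fixed hS hθ M hm hM
    rw [Expr.msubCls_of_ne hB.ty_ne_kind] at iM
    have c' := (c.mwk hS .mctx_nil).msubCls_right hθ hΓ
    exact ((VEq.msub_lam hθ hM' hB').trans (.lam iM (.ty_msub_sort hθ hB'))).convs
      ((Conv.of_eq (.eq_symm (.eq_msub_pi hθ hB'))).trans c') (hv.2.msub hθ)
  | .app E N, Γ, F, hm, h => by
    have hv := h.vty_mwk hS .mctx_nil
    have hΓ := hv.1.ty_ctxWF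
    obtain ⟨A, B, hE, hN, c⟩ := h.app_inv
    have hE' := hE.vty_mwk hS .mctx_nil
    have hN' := (hN.vty_mwk hS .mctx_nil).1
    obtain ⟨s, hB⟩ := hE'.pi_cod
    have iE := (Expr.msub_fixed hS hθ E hm.1 hE).convs (.of_eq (.eq_msub_pi hθ hB))
      (.pi (.ty_msub_sort hθ hB))
    have iN := Expr.msub_fixed hS hθ N hm.2 hN
    rw [Expr.msubCls_of_ne hB.ty_head.ty_ne_kind] at iN
    have c' := (c.mwk hS .mctx_nil).msubCls_right hθ hΓ
    exact ((VEq.msub_app hθ hE' hN').trans (.app iE iN)).convs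
      ((Conv.of_eq (.eq_symm (.eq_msub_single hθ hN' hB))).trans c') (hv.2.msub hθ)
  | .sub σ E, Γ, F, hm, h => by
    have hv := h.vty_mwk hS .mctx_nil
    have hΓ := hv.1.ty_ctxWF
    obtain ⟨Ψ, F', hσ, hE, c⟩ := h.sub_inv
    have hσ' := hσ.tySub_mwk hS .mctx_nil
    have hE' := hE.vty_mwk hS .mctx_nil
    have iσ := Sub.msub_fixed hS hθ σ hm.1 hσ
    have iE := Expr.msub_fixed hS hθ E hm.2 hE
    exact ((VEq.msub_sub hθ hσ' hE').trans (.sub iσ iE)).convs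
      ((Conv.msubCls_subCls hθ hσ' hE'.2).symm.trans ((c.mwk hS .mctx_nil).msubCls_right hθ hΓ))
      (hv.2.msub hθ)

theorem Sub.msub_fixed (hS : Sig.ClosedIn Sg' Sg) (hθ : Der Sg (.tyMSub Δ θ [])) :
    ∀ (σ : Sub C) {Γ Ψ}, σ.MetaFree → Der Sg' (.tySub [] Γ σ Ψ) →
      VEqSub Sg Δ (Ctx.msub θ Γ) (.msub θ σ) σ (Ctx.msub θ Ψ)
  | .shift _, Γ, Ψ, _, h => by
    have hΓ := (h.tySub_mwk hS .mctx_nil).tySub_dom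
    obtain ⟨Γ', Ψ', rfl, rfl, e⟩ := h.shift_inv
    exact (VEqSub.msub_shift hθ hΓ rfl).ctx (.eqCtx_rfl (.ctx_msub hθ hΓ))
      (.eqCtx_msub_right hθ (e.eqCtx_mwk hS .mctx_nil))
  | .cons σ M, Γ, Ψ, hm, h => by
    have hΓ := (h.tySub_mwk hS .mctx_nil).tySub_dom
    obtain ⟨Ψ', A, hσ, hA, hM, e⟩ := h.cons_inv
    have hσ' := hσ.tySub_mwk hS .mctx_nil
    have hA' := (hA.vty_mwk hS .mctx_nil).1
    have hM' := (hM.vty_mwk hS .mctx_nil).1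
    have iσ := Sub.msub_fixed hS hθ σ hm.1 hσ
    have iM := (Expr.msub_fixed hS hθ M hm.2 hM).convs (.of_eq (.eq_msub_sub_sort hθ hσ' hA'))
      (.of_ty (.ty_sub_sort iσ.2.1 (.ty_msub_sort hθ hA')))
    exact ((VEqSub.msub_cons hθ hσ' hA' hM').trans (.cons iM (.ty_msub_sort hθ hA') iσ)).ctx
      (.eqCtx_rfl (.ctx_msub hθ hΓ)) (.eqCtx_msub_right hθ (e.eqCtx_mwk hS .mctx_nil))
  | .sub σ τ, Γ, Ψ, hm, h => by
    obtain ⟨Φ, hσ, hτ⟩ := h.tySub_sub_inv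
    exact (VEqSub.msub_sub hθ (hσ.tySub_mwk hS .mctx_nil) (hτ.tySub_mwk hS .mctx_nil)).trans
      (.sub (Sub.msub_fixed hS hθ σ hm.1 hσ) (Sub.msub_fixed hS hθ τ hm.2 hτ))

end

/-! #### Ordinary substitutions with empty codomain -/

/-- `σ` lifted under `n` binders. -/
def Sub.lifts (σ : Sub C) : ℕ → Sub C
  | 0 => σ
  | n + 1 => (σ.lifts n).lift

/-- The domain of a lifted substitution. -/
def Ctx.lifts (Γ₁ : Ctx C) (σ : Sub C) : Ctx C → Ctx C
  | [] => Γ₁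
  | A :: Γ => .sub (σ.lifts Γ.length) A :: Ctx.lifts Γ₁ σ Γ

theorem Der.tySub_lifts (hσ : Der Sg (.tySub Δ Γ₁ σ [])) : ∀ {Γ : Ctx C}, Der Sg (.ctx Δ Γ) →
    Der Sg (.tySub Δ (Γ₁.lifts σ Γ) (σ.lifts Γ.length) Γ)
  | [], _ => hσ
  | _ :: _, h => .tySub_lift (Der.tySub_lifts hσ h.ctx_tail) h.ctx_type

theorem Der.length_eqCtx : ∀ {Γ Γ' : Ctx C}, Der Sg (.eqCtx Δ Γ Γ') → Γ.length = Γ'.length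
  | [], _, h => by rw [h.eqCtx_nil_inv]
  | _ :: _, _, h => by
    obtain ⟨_, _, rfl, e, -⟩ := h.eqCtx_inv
    simp [Der.length_eqCtx e]

theorem Der.eqCtx_lifts (hσ : Der Sg (.tySub Δ Γ₁ σ [])) : ∀ {Γ Γ' : Ctx C},
    Der Sg (.eqCtx Δ Γ Γ') → Der Sg (.eqCtx Δ (Γ₁.lifts σ Γ) (Γ₁.lifts σ Γ'))
  | [], _, h => by
    rw [h.eqCtx_nil_inv]
    exact .eqCtx_rfl hσ.tySub_dom
  | _ :: Γ, _, h => by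
    obtain ⟨A', Γ', rfl, e, h₁, h₂, h₃⟩ := h.eqCtx_inv
    have hw := Der.tySub_lifts hσ h₁.ty_ctxWF
    have hw' := Der.tySub_lifts hσ h₂.ty_ctxWF
    rw [Ctx.lifts, Ctx.lifts]
    rw [← e.length_eqCtx] at hw' ⊢
    exact .eqCtx_cons (Der.eqCtx_lifts hσ e) (.ty_sub_sort hw h₁) (.ty_sub_sort hw' h₂)
      (.eq_sub_right hw h₃)

theorem Conv.sub_square (hσ : Der Sg (.tySub Δ Γ σ Ψ)) (hτ : Der Sg (.tySub Δ Ψ τ Φ))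
    (hσ' : Der Sg (.tySub Δ Γ σ' Ψ')) (hτ' : Der Sg (.tySub Δ Ψ' τ' Φ))
    (e : Der Sg (.eqSub Δ Γ (.sub σ τ) (.sub σ' τ') Φ)) (h : IsCls Sg Δ Φ F) :
    Conv Sg Δ Γ ((F.subCls τ).subCls σ) ((F.subCls τ').subCls σ') :=
  (Conv.subCls_comp hσ hτ h).trans <|
    (Conv.subCls_left h (.tySub_sub hσ hτ) e).trans (Conv.subCls_comp hσ' hτ' h).symm

theorem VEq.sub_square (hσ : Der Sg (.tySub Δ Γ σ Ψ)) (hτ : Der Sg (.tySub Δ Ψ τ Φ))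
    (hσ' : Der Sg (.tySub Δ Γ σ' Ψ')) (hτ' : Der Sg (.tySub Δ Ψ' τ' Φ))
    (e : Der Sg (.eqSub Δ Γ (.sub σ τ) (.sub σ' τ') Φ)) (h : VTy Sg Δ Φ E F) :
    VEq Sg Δ Γ (.sub σ (.sub τ E)) (.sub σ' (.sub τ' E)) ((F.subCls τ).subCls σ) := by
  have h₁ := Der.tySub_sub hσ hτ
  have h₂ := Der.tySub_sub hσ' hτ'
  exact ((VEq.sub_comp hσ hτ h).trans ((VEq.sub ⟨e, h₁, h₂⟩ (.refl h)).trans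
    ((VEq.sub_comp hσ' hτ' h).symm.convs (Conv.subCls_left h.2 h₁ e).symm (h.2.sub h₁)))).convs
    (Conv.subCls_comp hσ hτ h.2).symm ((h.2.sub hτ).sub hσ)

theorem VEqSub.lifts_shift (hσ : Der Sg (.tySub Δ Γ₁ σ [])) : ∀ (Γ' : Ctx C) {Γ : Ctx C},
    Der Sg (.ctx Δ (Γ' ++ Γ)) →
      Der Sg (.tySub Δ (Γ₁.lifts σ (Γ' ++ Γ)) (.shift Γ'.length) (Γ₁.lifts σ Γ)) ∧
      VEqSub Sg Δ (Γ₁.lifts σ (Γ' ++ Γ)) (.sub (σ.lifts (Γ' ++ Γ).length) (.shift Γ'.length))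
        (.sub (.shift Γ'.length) (σ.lifts Γ.length)) Γ
  | [], Γ, h => by
    have hw := Der.tySub_lifts hσ h
    exact ⟨.tySub_id hw.tySub_dom, (VEqSub.id_right hw).trans (.symm (.id_left hw))⟩
  | A :: Γ', Γ, h => by
    rw [List.cons_append] at h
    obtain ⟨h₁, h₂⟩ := VEqSub.lifts_shift hσ Γ' h.ctx_tail
    have hA := h.ctx_type
    have hw := Der.tySub_lifts hσ h.ctx_tail
    have hw' := Der.tySub_lifts hσ (h.ctx_of_append (Γ' := A :: Γ'))
    have hwA := Der.ty_sub_sort hw hA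
    have hk := Der.tySub_wk hwA
    have e : VEqSub Sg Δ (Γ₁.lifts σ (A :: Γ' ++ Γ)) (.sub (.shift 1) (.shift Γ'.length))
        (.shift (A :: Γ').length) (Γ₁.lifts σ Γ) := by
      obtain ⟨Φ, Φ', e₁, e₂, e₃⟩ := h₁.shift_inv
      rw [List.cons_append, Ctx.lifts, e₁]
      rw [e₁] at hwA
      have := VEqSub.shift_shift (Γ₂ := [.sub (σ.lifts (Γ' ++ Γ).length) A]) (Γ₁ := Φ) (Γ := Φ')
        (.ctx_cons hwA) e₂ rfl
      rw [List.length_cons, Nat.add_comm]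
      exact this.ctx (.eqCtx_rfl (.ctx_cons hwA)) e₃
    refine ⟨e.2.2, (VEqSub.cons_shift (.tySub_lift hw hA) rfl).trans ?_⟩
    exact ((VEqSub.assoc hk hw (.tySub_shift h.ctx_tail rfl)).symm.trans
      (.sub (.refl hk) h₂)).trans ((VEqSub.assoc hk h₁ hw').trans (.sub e (.refl hw')))

theorem Expr.sub_fixed_var (hS : Sig.ClosedIn Sg' Sg) (hσ : Der Sg (.tySub Δ Γ₁ σ [])) :
    ∀ (n : ℕ) {Γ F}, Der Sg' (.ty [] Γ (.var n) F) →
      VEq Sg Δ (Γ₁.lifts σ Γ) (.sub (σ.lifts Γ.length) (.var n)) (.var n)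
        (F.subCls (σ.lifts Γ.length))
  | 0, _, F, h => by
    have hΔ := hσ.tySub_dom.mctx_of_ctx
    have hv := h.vty_mwk hS hΔ
    have hw := Der.tySub_lifts hσ hv.1.ty_ctxWF
    obtain ⟨A, Γ', rfl, hA, c⟩ := h.var_zero_inv
    have hA' := hA.vty_mwk hS hΔ
    have hw₀ := Der.tySub_lifts hσ hA'.1.ty_ctxWF
    have hk := Der.tySub_wk (.ty_sub_sort hw₀ hA'.1)
    have c' := (c.mwk hS hΔ).subCls_right hw
    obtain ⟨-, e⟩ := VEqSub.lifts_shift hσ [A] (Γ := Γ') hv.1.ty_ctxWF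
    have c₁ := Conv.sub_square hw (.tySub_wk hA'.1) hk hw₀ e.1 (.of_ty hA'.1)
    have c₂ := (Conv.subCls_comp hk hw₀ (.of_ty hA'.1)).symm
    rw [Expr.subCls_of_ne hA.ty_ne_kind (.sub _ _)] at c₂
    rw [Expr.subCls_of_ne hA.ty_ne_kind (.shift 1)] at c₁
    exact VEq.convs (.sub_var_zero (.tySub_sub hk hw₀) hA'.1 (.ty_var_zero_sub hw₀ hA'.1))
      (c₂.trans (c₁.symm.trans c')) (hv.2.sub hw)
  | n + 1, _, F, h => by
    have hΔ := hσ.tySub_dom.mctx_of_ctx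
    have hv := h.vty_mwk hS hΔ
    have hw := Der.tySub_lifts hσ hv.1.ty_ctxWF
    obtain ⟨A, B, Γ', rfl, hB, hn, c⟩ := h.var_succ_inv
    have hB' := (hB.vty_mwk hS hΔ).1
    have hn' := hn.vty_mwk hS hΔ
    have ih := Expr.sub_fixed_var hS hσ n hn
    have hw₀ := Der.tySub_lifts hσ hB'.ty_ctxWF
    have hwB := Der.ty_sub_sort hw₀ hB'
    have hk := Der.tySub_wk hwB
    have c' := (c.mwk hS hΔ).subCls_right hw
    obtain ⟨-, e⟩ := VEqSub.lifts_shift hσ [B] (Γ := Γ') hv.1.ty_ctxWF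
    have e₁ := VEq.sub_square hw (.tySub_wk hB') hk hw₀ e.1 hn'
    have c₁ := Conv.sub_square hw (.tySub_wk hB') hk hw₀ e.1 hn'.2
    have e₂ := VEq.sub (.refl hk) ih
    have e₃ := VEq.var_succ (VTy.wk hwB ⟨ih.2.2.1, ih.2.2.2⟩)
    rw [Expr.subCls_of_ne hn.var_cls_ne_kind] at e₁ c₁
    rw [← Expr.subCls_of_ne ih.2.2.1.var_cls_ne_kind] at e₃
    exact (VEq.sub (.refl hw) (VEq.var_succ hv)).trans <| (e₁.convs c' (hv.2.sub hw)).trans <|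
      (e₂.trans e₃.symm).convs (c₁.symm.trans c') (hv.2.sub hw)

mutual

theorem Expr.sub_fixed (hS : Sig.ClosedIn Sg' Sg) (hσ : Der Sg (.tySub Δ Γ₁ σ [])) :
    ∀ (E : Expr C) {Γ F}, E.MetaFree → Der Sg' (.ty [] Γ E F) →
      VEq Sg Δ (Γ₁.lifts σ Γ) (.sub (σ.lifts Γ.length) E) E (F.subCls (σ.lifts Γ.length))
  | .sort _, Γ, _, _, h => by
    have hw := Der.tySub_lifts hσ (h.vty_mwk hS hσ.tySub_dom.mctx_of_ctx).1.ty_ctxWF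
    obtain ⟨rfl, rfl⟩ := h.sort_inv
    exact .sub_type hw
  | .const a, Γ, F, _, h => by
    have hΔ := hσ.tySub_dom.mctx_of_ctx
    have hv := h.vty_mwk hS hΔ
    have hw := Der.tySub_lifts hσ hv.1.ty_ctxWF
    obtain ⟨K, hK, c⟩ := h.const_inv
    have hK' := hS.subset _ _ hK
    obtain ⟨s, h₁, h₂, -⟩ := hS.closed a K K hK hK'
    have ha := Der.ty_const (Sg := Sg) hw.tySub_cod hK'
    have c' := (c.mwk hS hΔ).subCls_right hw
    have hk := (h₁ _ _ hw.tySub_cod).ty_ne_kind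
    rw [Expr.subCls_of_ne hk] at c'
    have t₁ := Der.ty_sub hw ha
    rw [Expr.subCls_of_ne hk] at t₁
    exact VEq.convs ⟨.eq_sub_const hw ha, t₁, .ty_conv (.ty_const hw.tySub_dom hK')
      (.eq_symm (h₂ _ _ _ _ hw)), .of_ty (.ty_sub_sort hw (h₁ _ _ hw.tySub_cod))⟩ c' (hv.2.sub hw)
  | .pi A B, Γ, F, hm, h => by
    have hΔ := hσ.tySub_dom.mctx_of_ctx
    have hv := h.vty_mwk hS hΔ
    have hw := Der.tySub_lifts hσ hv.1.ty_ctxWF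
    obtain ⟨s, hB, c⟩ := h.pi_inv
    have hB' := (hB.vty_mwk hS hΔ).1
    have hl := Der.tySub_lift hw hB'.ty_head
    have iA := (Expr.sub_fixed hS hσ A hm.1 hB.ty_head).convs (.sub_sort hw) (.sort hw.tySub_dom)
    have iB := VEq.convs (Expr.sub_fixed hS hσ B hm.2 hB) (.sub_sort hl) (.sort hl.tySub_dom)
    exact ((VEq.sub_pi hw hB').trans (.pi iA iB)).convs
      ((Conv.sub_sort hw).symm.trans ((c.mwk hS hΔ).subCls_right hw)) (hv.2.sub hw)
  | .var n, Γ, F, _, h => Expr.sub_fixed_var hS hσ n h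
  | .lam M, Γ, F, hm, h => by
    have hΔ := hσ.tySub_dom.mctx_of_ctx
    have hv := h.vty_mwk hS hΔ
    have hw := Der.tySub_lifts hσ hv.1.ty_ctxWF
    obtain ⟨A, B, hM, hB, c⟩ := h.lam_inv
    have hB' := (hB.vty_mwk hS hΔ).1
    have hM' := (hM.vty_mwk hS hΔ).1
    have hl := Der.tySub_lift hw hB'.ty_head
    have iM := Expr.sub_fixed hS hσ M hm hM
    rw [Expr.subCls_of_ne hB.ty_ne_kind] at iM
    exact ((VEq.sub_lam hw hM' hB').trans (.lam iM (.ty_sub_sort hl hB'))).convs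
      ((Conv.of_eq (.eq_symm (.eq_sub_pi hw hB'))).trans ((c.mwk hS hΔ).subCls_right hw))
      (hv.2.sub hw)
  | .app E N, Γ, F, hm, h => by
    have hΔ := hσ.tySub_dom.mctx_of_ctx
    have hv := h.vty_mwk hS hΔ
    have hw := Der.tySub_lifts hσ hv.1.ty_ctxWF
    obtain ⟨A, B, hE, hN, c⟩ := h.app_inv
    have hE' := hE.vty_mwk hS hΔ
    have hN' := (hN.vty_mwk hS hΔ).1
    obtain ⟨s, hB⟩ := hE'.pi_cod
    have hA := hB.ty_head
    have hl := Der.tySub_lift hw hA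
    have iE := (Expr.sub_fixed hS hσ E hm.1 hE).convs (.of_eq (.eq_sub_pi hw hB))
      (.pi (.ty_sub_sort hl hB))
    have iN := Expr.sub_fixed hS hσ N hm.2 hN
    rw [Expr.subCls_of_ne hA.ty_ne_kind] at iN
    have hs := Der.tySub_single hN' hA
    have c₁ := (Conv.of_eq (.eq_sub_comp_sort hw hs hB)).trans <|
      .of_eq (.eq_sub_left (.tySub_sub hw hs) (.eqSub_sub_single hw hA hN') hB)
    have c₂ := Conv.of_eq (.eq_sub_comp_sort (.tySub_single iN.2.1 (.ty_sub_sort hw hA)) hl hB)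
    have c₃ := Conv.of_eq (.eq_sub_left (.tySub_sub (.tySub_single iN.2.1 (.ty_sub_sort hw hA)) hl)
      (.eqSub_single_lift hw hA iN.2.1) hB)
    have c₄ := (c.mwk hS hΔ).subCls_right hw
    rw [Expr.subCls_of_ne (by simp)] at c₄
    exact ((VEq.sub_app hw hE' hN').convs (c₁.symm.trans c₄) (hv.2.sub hw)).trans <|
      (VEq.app iE iN).convs (c₂.trans (c₃.trans (c₁.symm.trans c₄))) (hv.2.sub hw)
  | .sub τ E, Γ, F, hm, h => by
    have hΔ := hσ.tySub_dom.mctx_of_ctx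
    have hv := h.vty_mwk hS hΔ
    have hw := Der.tySub_lifts hσ hv.1.ty_ctxWF
    obtain ⟨Ψ, F', hτ, hE, c⟩ := h.sub_inv
    have hτ' := hτ.tySub_mwk hS hΔ
    have hw' := Der.tySub_lifts hσ hτ'.tySub_cod
    obtain ⟨i₁, i₂⟩ := Sub.sub_fixed hS hσ τ hm.1 hτ
    have iE := Expr.sub_fixed hS hσ E hm.2 hE
    have e₁ := VEq.sub_square hw hτ' i₁ hw' i₂.1 (hE.vty_mwk hS hΔ)
    have c₁ := Conv.sub_square hw hτ' i₁ hw' i₂.1 (hE.vty_mwk hS hΔ).2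
    exact (e₁.trans ((VEq.sub (.refl i₁) iE).convs c₁.symm
      (((hE.vty_mwk hS hΔ).2.sub hτ').sub hw))).convs ((c.mwk hS hΔ).subCls_right hw) (hv.2.sub hw)

theorem Sub.sub_fixed (hS : Sig.ClosedIn Sg' Sg) (hσ : Der Sg (.tySub Δ Γ₁ σ [])) :
    ∀ (τ : Sub C) {Γ Ψ}, τ.MetaFree → Der Sg' (.tySub [] Γ τ Ψ) →
      Der Sg (.tySub Δ (Γ₁.lifts σ Γ) τ (Γ₁.lifts σ Ψ)) ∧
        VEqSub Sg Δ (Γ₁.lifts σ Γ) (.sub (σ.lifts Γ.length) τ) (.sub τ (σ.lifts Ψ.length)) Ψ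
  | .shift _, Γ, Ψ, _, h => by
    have hΔ := hσ.tySub_dom.mctx_of_ctx
    have hΓ := (h.tySub_mwk hS hΔ).tySub_dom
    obtain ⟨Γ', Ψ', rfl, rfl, e⟩ := h.shift_inv
    obtain ⟨h₁, h₂⟩ := VEqSub.lifts_shift hσ Γ' hΓ
    have e' := e.eqCtx_mwk hS hΔ
    rw [← e.length_eqCtx]
    exact ⟨.tySub_ctx h₁ (.eqCtx_rfl h₁.tySub_dom) (.eqCtx_lifts hσ e'),
      h₂.ctx (.eqCtx_rfl h₁.tySub_dom) e'⟩
  | .cons τ M, Γ, Ψ, hm, h => by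
    have hΔ := hσ.tySub_dom.mctx_of_ctx
    have hw := Der.tySub_lifts hσ (h.tySub_mwk hS hΔ).tySub_dom
    obtain ⟨Ψ', A, hτ, hA, hM, e⟩ := h.cons_inv
    have hτ' := hτ.tySub_mwk hS hΔ
    have hA' := hA.vty_mwk hS hΔ
    have hM' := (hM.vty_mwk hS hΔ).1
    have e' := e.eqCtx_mwk hS hΔ
    have hw' := Der.tySub_lifts hσ hτ'.tySub_cod
    have hwA := Der.ty_sub_sort hw' hA'.1
    obtain ⟨i₁, i₂⟩ := Sub.sub_fixed hS hσ τ hm.1 hτ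
    have iM := Expr.sub_fixed hS hσ M hm.2 hM
    have c := Conv.sub_square hw hτ' i₁ hw' i₂.1 (.of_ty hA'.1)
    rw [Expr.subCls_of_ne hA.ty_ne_kind, Expr.subCls_of_ne hA.ty_ne_kind] at c
    have iM' := iM.convs c (IsCls.sub i₁ (.of_ty hwA))
    rw [Expr.subCls_of_ne (by simp)] at iM'
    have hτM := Der.tySub_cons hτ' hA'.1 hM'
    have hτM' := Der.tySub_cons i₁ hwA iM'.2.2.1
    have e₁ := VEqSub.sub_cons hw hτM
    have e₃ : VEqSub Sg Δ (Γ₁.lifts σ Γ) _ _ (A :: Ψ') :=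
      ⟨.eqSub_cons_lift i₁ hw' hA'.1 iM'.2.2.1, .tySub_sub hτM' (.tySub_lift hw' hA'.1),
        .tySub_cons_sub i₁ hw' hA'.1 iM'.2.2.1⟩
    rw [Expr.subCls_of_ne (by simp)] at iM
    have iM₁ := iM.convs (.of_eq (.eq_sub_comp_sort hw hτ' hA'.1))
      (.of_ty (.ty_sub_sort (.tySub_sub hw hτ') hA'.1))
    rw [← e.length_eqCtx]
    exact ⟨.tySub_ctx hτM' (.eqCtx_rfl hw.tySub_dom) (.eqCtx_lifts hσ e'),
      (e₁.trans ((VEqSub.cons iM₁ hA'.1 i₂).trans e₃.symm)).ctx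
        (.eqCtx_rfl hw.tySub_dom) e'⟩
  | .sub τ₁ τ₂, Γ, Ψ, hm, h => by
    have hΔ := hσ.tySub_dom.mctx_of_ctx
    have hw := Der.tySub_lifts hσ (h.tySub_mwk hS hΔ).tySub_dom
    obtain ⟨Φ, h₁, h₂⟩ := h.tySub_sub_inv
    have h₁' := h₁.tySub_mwk hS hΔ
    have h₂' := h₂.tySub_mwk hS hΔ
    have hw₁ := Der.tySub_lifts hσ h₁'.tySub_cod
    have hw₂ := Der.tySub_lifts hσ h₂'.tySub_cod
    obtain ⟨i₁, e₁⟩ := Sub.sub_fixed hS hσ τ₁ hm.1 h₁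
    obtain ⟨i₂, e₂⟩ := Sub.sub_fixed hS hσ τ₂ hm.2 h₂
    exact ⟨.tySub_sub i₁ i₂, (VEqSub.assoc hw h₁' h₂').trans <| (VEqSub.sub e₁ (.refl h₂')).trans <|
      (VEqSub.assoc i₁ hw₁ h₂').symm.trans <| (VEqSub.sub (.refl i₁) e₂).trans <|
      .assoc i₁ i₂ hw₂⟩

end

theorem Der.tySub_shift_length (hΓ : Der Sg (.ctx Δ Γ)) :
    Der Sg (.tySub Δ Γ (.shift Γ.length) []) := by
  simpa using Der.tySub_shift (Sg := Sg) (Δ := Δ) (Γ := Γ) (Ψ := []) (by simpa using hΓ) rfl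

theorem Der.tyMSub_shift_length (hΔ : Der Sg (.mctx Δ)) :
    Der Sg (.tyMSub Δ (.shift Δ.length) []) := by
  simpa using Der.tyMSub_shift (Sg := Sg) (Δ := []) (Δ' := Δ) (by simpa using hΔ) rfl

/-- A closed expression over `Sg'` is a closed classifier over `Sg`. -/
theorem Der.closed (hS' : Sig.ClosedIn Sg' Sg') (hS : Sig.ClosedIn Sg' Sg)
    (h : Der Sg' (.ty [] [] K (.sort s))) : Closed Sg K := by
  obtain ⟨K', hm, e⟩ := h.exists_metaFree hS'
  have hK' := (e.veq hS').2.2.1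
  have hK : ∀ {Δ Γ}, Der Sg (.ctx Δ Γ) → Der Sg (.ty Δ Γ K (.sort s)) := fun hΓ => h.ty_wk hS hΓ
  have hsub₀ : ∀ {Δ Γ σ}, Der Sg (.tySub Δ Γ σ []) →
      Der Sg (.eq Δ Γ (.sub σ K) K (.sort s)) := by
    intro Δ Γ σ hσ
    have e₁ := (Expr.sub_fixed hS hσ K' hm hK').1
    exact .eq_trans (.eq_sub_right hσ (e.veq_wk hS hσ.tySub_cod).1)
      (.eq_trans ((Conv.sub_sort hσ).eq e₁) (.eq_symm (e.veq_wk hS hσ.tySub_dom).1))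
  have hsub : ∀ {Δ Γ σ Ψ}, Der Sg (.tySub Δ Γ σ Ψ) →
      Der Sg (.eq Δ Γ (.sub σ K) K (.sort s)) := by
    intro Δ Γ σ Ψ hσ
    have hk := Der.tySub_shift_length hσ.tySub_cod
    exact .eq_trans (.eq_sub_right hσ (.eq_symm (hsub₀ hk)))
      (.eq_trans (.eq_sub_comp_sort hσ hk (hK hk.tySub_cod)) (hsub₀ (.tySub_sub hσ hk)))
  have hmsub₀ : ∀ {Δ θ}, Der Sg (.tyMSub Δ θ []) →
      Der Sg (.eq Δ [] (.msub θ K) K (.sort s)) := by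
    intro Δ θ hθ
    have h₀ : Der Sg (.ctx [] []) := .ctx_nil .mctx_nil
    have h₁ : Der Sg (.ctx Δ []) := .ctx_nil hθ.tyMSub_dom
    have e₁ := (Expr.msub_fixed hS hθ K' hm hK').1
    exact .eq_trans (.eq_msub_right hθ h₀ (e.veq_wk hS h₀).1)
      (.eq_trans ((Conv.msub_sort hθ h₀).eq e₁) (.eq_symm (e.veq_wk hS h₁).1))
  have hmsub : ∀ {Δ θ Δ'}, Der Sg (.tyMSub Δ θ Δ') →
      Der Sg (.eq Δ [] (.msub θ K) K (.sort s)) := by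
    intro Δ θ Δ' hθ
    have hk := Der.tyMSub_shift_length hθ.tyMSub_cod
    have h₀ : Der Sg (.ctx Δ' []) := .ctx_nil hθ.tyMSub_cod
    exact .eq_trans (.eq_msub_right hθ h₀ (.eq_symm (hmsub₀ hk)))
      (.eq_trans (.eq_msub_comp_sort hθ hk (hK (.ctx_nil .mctx_nil))) (hmsub₀ (.tyMSub_msub hθ hk)))
  refine ⟨s, fun _ _ => hK, fun _ _ _ _ => hsub, fun Δ θ Δ' Γ hθ hΓ => ?_⟩
  have hk := Der.tySub_shift_length hΓ
  have hk' := Der.tySub_msub hθ hk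
  exact .eq_trans (.eq_msub_right hθ hΓ (.eq_symm (hsub hk)))
    (.eq_trans (.eq_msub_sub_sort hθ hk (hK hk.tySub_cod))
      (.eq_trans (.eq_sub_right hk' (hmsub hθ)) (hsub hk')))

theorem Sig.WF.unique : ∀ {Sg : Sig C}, Sig.WF Sg → ∀ a K K', (a, K) ∈ Sg → (a, K') ∈ Sg → K = K'
  | [], _, _, _, _, h, _ => by simp at h
  | (b, L) :: Sg, hS, a, K, K', h, h' => by
    cases hS with
    | cons hS hb _ =>
    rcases List.mem_cons.1 h with h | h <;> rcases List.mem_cons.1 h' with h' | h'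
    · cases h; cases h'; rfl
    · cases h; exact absurd h' (hb _)
    · cases h'; exact absurd h (hb _)
    · exact Sig.WF.unique hS a K K' h h'

theorem Sig.WF.closedIn : ∀ {Sg' : Sig C}, Sig.WF Sg' → ∀ {Sg : Sig C},
    (∀ a K, (a, K) ∈ Sg' → (a, K) ∈ Sg) → (∀ a K K', (a, K) ∈ Sg → (a, K') ∈ Sg → K = K') →
      Sig.ClosedIn Sg' Sg
  | [], _, _, h, _ => ⟨h, fun _ _ _ h => by simp at h⟩
  | (b, L) :: Sg', hS, Sg, h, hu => by
    have hu' := hS.unique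
    cases hS with
    | cons hS hb hL =>
    have h₀ : Sig.ClosedIn Sg' Sg' := hS.closedIn (fun _ _ h => h) hS.unique
    have h₁ : Sig.ClosedIn Sg' Sg := hS.closedIn (fun a K hK => h a K (List.mem_cons_of_mem _ hK)) hu
    refine ⟨h, fun a K K' hK hK' => ?_⟩
    obtain rfl := hu _ _ _ (h _ _ hK) hK'
    rcases List.mem_cons.1 hK with e | hK
    · cases e; exact hL.closed h₀ h₁
    · exact h₁.closed a K K hK hK'

theorem Sig.WF.closedIn_self (hS : Sig.WF Sg) : Sig.ClosedIn Sg Sg :=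
  hS.closedIn (fun _ _ h => h) hS.unique

end

end

section

variable {C : Type u} {Sg : Sig C}

/-! ### Uniqueness of sorts -/

/-- Whether the expression is a kind. -/
def Expr.isKind : Expr C → Prop
  | .sort _ => True
  | .pi _ E => E.isKind
  | .sub _ E => E.isKind
  | .msub _ E => E.isKind
  | _ => False

/-- Kinds are the expressions classified by `kind`. -/
def Judgment.KindIff : Judgment C → Prop
  | .ty _ _ E F => E.isKind ↔ F = .sort .kind
  | _ => True

theorem Der.kindIff (hS : Sig.ClosedIn Sg Sg) {J : Judgment C} (h : Der Sg J) : J.KindIff := by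
  induction h with
  | ty_type => exact ⟨fun _ => rfl, fun _ => trivial⟩
  | ty_const hΓ ha _ =>
    obtain ⟨s, h₁, -⟩ := hS.closed _ _ _ ha ha
    exact ⟨False.elim, fun e => (h₁ _ _ hΓ).ty_ne_kind e⟩
  | ty_pi _ ih =>
    refine ih.trans ⟨?_, ?_⟩ <;> intro h <;> cases h <;> rfl
  | ty_var_zero => exact ⟨False.elim, fun e => absurd e (by simp)⟩
  | ty_var_succ => exact ⟨False.elim, fun e => absurd e (by simp)⟩
  | ty_mvar_zero => exact ⟨False.elim, fun e => absurd e (by simp)⟩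
  | ty_mvar_succ => exact ⟨False.elim, fun e => absurd e (by simp)⟩
  | ty_lam => exact ⟨False.elim, fun e => absurd e (by simp)⟩
  | ty_app => exact ⟨False.elim, fun e => absurd e (by simp)⟩
  | ty_sub _ _ _ ih => exact ih.trans Expr.subCls_eq_kind.symm
  | ty_msub _ _ _ ih => exact ih.trans Expr.msubCls_eq_kind.symm
  | ty_conv _ h ih _ =>
    exact ih.trans ⟨fun e => absurd e h.eq_ne_kind.1, fun e => absurd e h.eq_ne_kind.2⟩
  | ty_ctx _ _ ih => exact ih
  | _ => trivial

section

variable {Δ Δ' Δ'' : MCtx C} {Γ Γ' Ψ Φ : Ctx C} {σ σ' τ : Sub C} {θ θ' : MSub C}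
  {A A' B B' E E' F F' : Expr C} {s s' : Srt}

theorem Der.sort_unique (hS : Sig.ClosedIn Sg Sg) (h : Der Sg (.ty Δ Γ E (.sort s)))
    (h' : Der Sg (.ty Δ Γ E (.sort s'))) : s = s' := by
  have e := (h.kindIff hS).symm.trans (h'.kindIff hS)
  cases s <;> cases s' <;> simp_all

theorem Conv.eq_sort (hS : Sig.ClosedIn Sg Sg) (c : Conv Sg Δ Γ E E')
    (h : Der Sg (.ty Δ Γ E (.sort s))) : Der Sg (.eq Δ Γ E E' (.sort s)) := by
  induction c with
  | refl => exact .eq_refl h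
  | tail _ e ih =>
    obtain ⟨s', e⟩ := e
    obtain rfl := Der.sort_unique hS (ih.veq hS).2.2.1 (e.veq hS).2.1
    exact .eq_trans ih e

/-! ### Injectivity of function types -/

/-- The head of a type or kind. -/
inductive Head (C : Type u) : Type u
  | sort (s : Srt)
  | pi (A B : Expr C)
  | other

/-- Propagation of a substitution into a head. -/
def Head.sub (σ : Sub C) : Head C → Head C
  | .sort s => .sort s
  | .pi A B => .pi (.sub σ A) (.sub σ.lift B)
  | .other => .other

/-- Propagation of a meta-substitution into a head. -/
def Head.msub (θ : MSub C) : Head C → Head C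
  | .sort s => .sort s
  | .pi A B => .pi (.msub θ A) (.msub θ B)
  | .other => .other

/-- The head of an expression. -/
def Expr.head : Expr C → Head C
  | .sort s => .sort s
  | .pi A B => .pi A B
  | .sub σ E => E.head.sub σ
  | .msub θ E => E.head.msub θ
  | _ => .other

/-- Typing of heads. -/
def Head.Ty (Sg : Sig C) (Δ : MCtx C) (Γ : Ctx C) (F : Expr C) : Head C → Prop
  | .sort s => s = .type ∧ F = .sort .kind
  | .pi A B => ∃ s, Der Sg (.ty Δ (A :: Γ) B (.sort s)) ∧ F.head = .sort s
  | .other => True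

/-- Componentwise equality of heads. -/
def Head.Eq (Sg : Sig C) (Δ : MCtx C) (Γ : Ctx C) : Head C → Head C → Prop
  | .sort s, .sort s' => s = s'
  | .pi A B, .pi A' B' =>
    VEq Sg Δ Γ A A' (.sort .type) ∧ ∃ s, VEq Sg Δ (A :: Γ) B B' (.sort s)
  | .other, .other => True
  | _, _ => False

variable {H H' H'' : Head C}

theorem VEq.head (h : VEq Sg Δ Γ A A' (.sort .type)) : Der Sg (.eqCtx Δ (A :: Γ) (A' :: Γ)) :=
  .eqCtx_head h.2.1 h.2.2.1 h.1

namespace Head.Eq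

theorem refl (h : H.Ty Sg Δ Γ F) : H.Eq Sg Δ Γ H := by
  cases H with
  | sort => rfl
  | other => trivial
  | pi A B =>
    obtain ⟨s, h, -⟩ := h
    exact ⟨.refl ⟨h.ty_head, .sort h.ty_head.ty_ctxWF⟩, s, .refl ⟨h, .sort h.ty_ctxWF⟩⟩

theorem symm (h : H.Eq Sg Δ Γ H') : H'.Eq Sg Δ Γ H := by
  match H, H', h with
  | .sort _, .sort _, h => exact _root_.Eq.symm h
  | .other, .other, _ => trivial
  | .pi A B, .pi A' B', ⟨h₁, s, h₂⟩ => exact ⟨h₁.symm, s, h₂.symm.ctx h₁.head⟩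

theorem trans (hS : Sig.ClosedIn Sg Sg) (h : H.Eq Sg Δ Γ H') (h' : H'.Eq Sg Δ Γ H'') :
    H.Eq Sg Δ Γ H'' := by
  match H, H', H'', h, h' with
  | .sort _, .sort _, .sort _, h, h' => exact _root_.Eq.trans h h'
  | .other, .other, .other, _, _ => trivial
  | .pi A B, .pi A' B', .pi A'' B'', ⟨h₁, s, h₂⟩, ⟨h₁', s', h₂'⟩ =>
    have h₃ := h₂'.ctx h₁.symm.head
    obtain rfl := Der.sort_unique hS h₂.2.2.1 h₃.2.1
    exact ⟨h₁.trans h₁', s, h₂.trans h₃⟩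

theorem ctx (h : H.Eq Sg Δ Γ H') (e : Der Sg (.eqCtx Δ Γ Γ')) : H.Eq Sg Δ Γ' H' := by
  match H, H', h with
  | .sort _, .sort _, h => exact h
  | .other, .other, _ => trivial
  | .pi A B, .pi A' B', ⟨h₁, s, h₂⟩ =>
    exact ⟨h₁.ctx e, s, h₂.ctx (.eqCtx_cons e h₁.2.1 (.ty_ctx h₁.2.1 e) (.eq_refl h₁.2.1))⟩

theorem sub (e : VEqSub Sg Δ Γ σ σ' Ψ) (h : H.Eq Sg Δ Ψ H') :
    (H.sub σ).Eq Sg Δ Γ (H'.sub σ') := by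
  match H, H', h with
  | .sort _, .sort _, h => exact h
  | .other, .other, _ => trivial
  | .pi A B, .pi A' B', ⟨h₁, s, h₂⟩ =>
    have e₁ := (VEq.sub e h₁).convs (.sub_sort e.2.1) (.sort e.2.1.tySub_dom)
    have hl := Der.tySub_lift e.2.1 h₁.2.1
    have hl' := Der.tySub_ctx (Der.tySub_lift e.2.2 h₁.2.1)
      (.eqCtx_head (.ty_sub_sort e.2.2 h₁.2.1) (.ty_sub_sort e.2.1 h₁.2.1)
        (.eq_symm (.eq_sub_left e.2.1 e.1 h₁.2.1))) (.eqCtx_rfl hl.tySub_cod)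
    exact ⟨e₁, s, (VEq.sub ⟨.eqSub_lift e.2.1 e.1 h₁.2.1, hl, hl'⟩ h₂).convs (.sub_sort hl)
      (.sort hl.tySub_dom)⟩

theorem msub (e : VEqMSub Sg Δ θ θ' Δ') (hΓ : Der Sg (.ctx Δ' Γ)) (h : H.Eq Sg Δ' Γ H') :
    (H.msub θ).Eq Sg Δ (Ctx.msub θ Γ) (H'.msub θ') := by
  match H, H', h with
  | .sort _, .sort _, h => exact h
  | .other, .other, _ => trivial
  | .pi A B, .pi A' B', ⟨h₁, s, h₂⟩ =>
    exact ⟨(VEq.msub e h₁).convs (.msub_sort e.2.1 hΓ) (.sort (.ctx_msub e.2.1 hΓ)), s,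
      (VEq.msub e h₂).convs (.msub_sort e.2.1 h₂.2.1.ty_ctxWF)
        (.sort (.ctx_msub e.2.1 h₂.2.1.ty_ctxWF))⟩

theorem sub_id (h : H.Ty Sg Δ Γ F) : (H.sub (.shift 0)).Eq Sg Δ Γ H := by
  match H, h with
  | .sort _, h => rfl
  | .other, _ => trivial
  | .pi A B, ⟨s, h, _⟩ =>
    have hA : VTy Sg Δ Γ A (.sort .type) := ⟨h.ty_head, .sort h.ty_head.ty_ctxWF⟩
    have e := VEq.sub_id hA
    have hB : VTy Sg Δ (A :: Γ) B (.sort s) := ⟨h, .sort h.ty_ctxWF⟩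
    have hl := Der.tySub_lift (.tySub_id hA.1.ty_ctxWF) hA.1
    have hid : Der Sg (.tySub Δ (.sub (.shift 0) A :: Γ) (.shift 0) (A :: Γ)) :=
      .tySub_ctx (.tySub_id h.ty_ctxWF) e.symm.head (.eqCtx_rfl h.ty_ctxWF)
    exact ⟨e, s, ((VEq.sub ⟨.eqSub_lift_id hA.1, hl, hid⟩ (.refl hB)).convs (.sub_sort hl)
      (.sort hl.tySub_dom)).trans ((VEq.sub_id hB).ctx e.symm.head)⟩

theorem sub_comp (hσ : Der Sg (.tySub Δ Γ σ Ψ)) (hτ : Der Sg (.tySub Δ Ψ τ Φ))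
    (h : H.Ty Sg Δ Φ F) : ((H.sub τ).sub σ).Eq Sg Δ Γ (H.sub (.sub σ τ)) := by
  match H, h with
  | .sort _, h => rfl
  | .other, _ => trivial
  | .pi A B, ⟨s, h, _⟩ =>
    have hA := h.ty_head
    have hc := Der.tySub_sub hσ hτ
    have e := (VEq.sub_comp hσ hτ ⟨hA, .sort hA.ty_ctxWF⟩).convs (.sub_sort hc)
      (.sort hc.tySub_dom)
    have hl₂ := Der.tySub_lift hτ hA
    have hl₁ := Der.tySub_lift hσ (.ty_sub_sort hτ hA)
    have hll := Der.tySub_sub hl₁ hl₂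
    have hl : Der Sg (.tySub Δ (.sub σ (.sub τ A) :: Γ) (Sub.lift (.sub σ τ)) (A :: Φ)) :=
      .tySub_ctx (.tySub_lift hc hA) e.symm.head (.eqCtx_rfl h.ty_ctxWF)
    have hB : VTy Sg Δ (A :: Φ) B (.sort s) := ⟨h, .sort h.ty_ctxWF⟩
    exact ⟨e, s, ((VEq.sub_comp hl₁ hl₂ hB).trans
      (VEq.sub ⟨.eqSub_lift_comp hσ hτ hA, hll, hl⟩ (.refl hB))).convs (.sub_sort hll)
      (.sort hll.tySub_dom)⟩

theorem msub_id (h : H.Ty Sg Δ Γ F) : (H.msub (.shift 0)).Eq Sg Δ Γ H := by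
  match H, h with
  | .sort _, h => rfl
  | .other, _ => trivial
  | .pi A B, ⟨s, h, _⟩ =>
    have e := VEq.msub_id ⟨h.ty_head, .sort h.ty_head.ty_ctxWF⟩
    exact ⟨e, s, (VEq.msub_id ⟨h, .sort h.ty_ctxWF⟩).ctx e.symm.head⟩

theorem msub_comp (hθ : Der Sg (.tyMSub Δ θ Δ')) (hθ' : Der Sg (.tyMSub Δ' θ' Δ''))
    (h : H.Ty Sg Δ'' Γ F) :
    ((H.msub θ').msub θ).Eq Sg Δ (Ctx.msub (.msub θ θ') Γ) (H.msub (.msub θ θ')) := by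
  match H, h with
  | .sort _, h => rfl
  | .other, _ => trivial
  | .pi A B, ⟨s, h, _⟩ =>
    have hc := Der.tyMSub_msub hθ hθ'
    have hA := h.ty_head
    have e := (VEq.msub_comp hθ hθ' ⟨hA, .sort hA.ty_ctxWF⟩).convs (.msub_sort hc hA.ty_ctxWF)
      (.sort (.ctx_msub hc hA.ty_ctxWF))
    exact ⟨e, s, ((VEq.msub_comp hθ hθ' ⟨h, .sort h.ty_ctxWF⟩).convs (.msub_sort hc h.ty_ctxWF)
      (.sort (.ctx_msub hc h.ty_ctxWF))).ctx e.symm.head⟩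

theorem msub_sub (hθ : Der Sg (.tyMSub Δ θ Δ')) (hσ : Der Sg (.tySub Δ' Γ σ Ψ))
    (h : H.Ty Sg Δ' Ψ F) :
    ((H.sub σ).msub θ).Eq Sg Δ (Ctx.msub θ Γ) ((H.msub θ).sub (.msub θ σ)) := by
  match H, h with
  | .sort _, h => rfl
  | .other, _ => trivial
  | .pi A B, ⟨s, h, _⟩ =>
    have hA := h.ty_head
    have hσ' := Der.tySub_msub hθ hσ
    have hσA := Der.ty_sub_sort hσ hA
    have e : VEq Sg Δ (Ctx.msub θ Γ) (.msub θ (.sub σ A)) (.sub (.msub θ σ) (.msub θ A))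
        (.sort .type) :=
      ⟨.eq_msub_sub_sort hθ hσ hA, .ty_msub_sort hθ hσA, .ty_sub_sort hσ' (.ty_msub_sort hθ hA),
        .sort hσ'.tySub_dom⟩
    have hl := Der.tySub_lift hσ hA
    have hml := Der.tySub_msub hθ hl
    have hl' : Der Sg (.tySub Δ (.msub θ (.sub σ A) :: Ctx.msub θ Γ) (Sub.lift (.msub θ σ))
        (Ctx.msub θ (A :: Ψ))) :=
      .tySub_ctx (.tySub_lift hσ' (.ty_msub_sort hθ hA)) e.symm.head (.eqCtx_rfl hml.tySub_cod)
    have hB := Der.ty_msub_sort hθ h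
    have e' : VEqSub Sg Δ (Ctx.msub θ (.sub σ A :: Γ)) (.msub θ σ.lift) (Sub.lift (.msub θ σ))
        (Ctx.msub θ (A :: Ψ)) := ⟨.eqSub_msub_lift hθ hσ hA, hml, hl'⟩
    exact ⟨e, s, .eq_trans (.eq_msub_sub_sort hθ hl h) (.eq_sub_left hml e'.1 hB),
      .ty_msub_sort hθ (.ty_sub_sort hl h), .ty_sub_sort hl' hB, .sort hl'.tySub_dom⟩

end Head.Eq

theorem Head.Ty.sub (hσ : Der Sg (.tySub Δ Γ σ Ψ)) (h : H.Ty Sg Δ Ψ F) :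
    (H.sub σ).Ty Sg Δ Γ (F.subCls σ) := by
  match H, h with
  | .sort _, ⟨h₁, h₂⟩ => exact ⟨h₁, Expr.subCls_eq_kind.2 h₂⟩
  | .other, _ => trivial
  | .pi A B, ⟨s, h, e⟩ =>
    refine ⟨s, .ty_sub_sort (.tySub_lift hσ h.ty_head) h, ?_⟩
    by_cases hF : F = .sort .kind
    · subst hF; exact e
    · rw [Expr.subCls_of_ne hF, Expr.head, e]; rfl

theorem Head.Ty.msub (hθ : Der Sg (.tyMSub Δ θ Δ')) (h : H.Ty Sg Δ' Γ F) :
    (H.msub θ).Ty Sg Δ (Ctx.msub θ Γ) (F.msubCls θ) := by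
  match H, h with
  | .sort _, ⟨h₁, h₂⟩ => exact ⟨h₁, Expr.msubCls_eq_kind.2 h₂⟩
  | .other, _ => trivial
  | .pi A B, ⟨s, h, e⟩ =>
    refine ⟨s, .ty_msub_sort hθ h, ?_⟩
    by_cases hF : F = .sort .kind
    · subst hF; exact e
    · rw [Expr.msubCls_of_ne hF, Expr.head, e]; rfl

theorem Head.Ty.conv (h : H.Ty Sg Δ Γ F) (hF : F ≠ .sort .kind)
    (e : F.head.Eq Sg Δ Γ F'.head) : H.Ty Sg Δ Γ F' := by
  match H, h with
  | .sort _, ⟨_, h⟩ => exact absurd h hF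
  | .other, _ => trivial
  | .pi A B, ⟨s, h, e'⟩ =>
    refine ⟨s, h, ?_⟩
    rw [e'] at e
    revert e
    cases F'.head <;> simp [Head.Eq, eq_comm]

theorem Head.Ty.ctx (h : H.Ty Sg Δ Γ F) (e : Der Sg (.eqCtx Δ Γ Γ')) : H.Ty Sg Δ Γ' F := by
  match H, h with
  | .sort _, h => exact h
  | .other, _ => trivial
  | .pi A B, ⟨s, h, e'⟩ =>
    have hA := h.ty_head
    exact ⟨s, .ty_ctx h (.eqCtx_cons e hA (.ty_ctx hA e) (.eq_refl hA)), e'⟩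

theorem Head.Ty.eq_other (h : H.Ty Sg Δ Γ F) (hF : ∀ s, F.head ≠ .sort s) : H = .other := by
  match H, h with
  | .sort _, ⟨_, h⟩ => subst h; exact absurd rfl (hF _)
  | .other, _ => rfl
  | .pi A B, ⟨s, _, e⟩ => exact absurd e (hF s)

theorem Head.Ty.ne_sort (h : H.Ty Sg Δ Γ (.sort .type)) (s : Srt) : H ≠ .sort s := by
  rintro rfl; cases h.2

theorem Head.sub_ne_sort (h : ∀ s, H ≠ .sort s) (s : Srt) : H.sub σ ≠ .sort s := by
  cases H <;> simp_all [Head.sub]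

theorem Head.msub_ne_sort (h : ∀ s, H ≠ .sort s) (s : Srt) : H.msub θ ≠ .sort s := by
  cases H <;> simp_all [Head.msub]

/-- The heads of a typed expression, and of the sides of an equation. -/
def Judgment.Heads (Sg : Sig C) : Judgment C → Prop
  | .ty Δ Γ E F => E.head.Ty Sg Δ Γ F
  | .eq Δ Γ E E' _ => E.head.Eq Sg Δ Γ E'.head
  | _ => True

theorem Der.heads (hS : Sig.ClosedIn Sg Sg) {J : Judgment C} (h : Der Sg J) : J.Heads Sg := by
  induction h with dsimp only [Judgment.Heads, Expr.head] at *
  | ty_type => exact ⟨rfl, rfl⟩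
  | ty_const => trivial
  | ty_pi h => exact ⟨_, h, rfl⟩
  | ty_var_zero => trivial
  | ty_var_succ => trivial
  | ty_mvar_zero => trivial
  | ty_mvar_succ => trivial
  | ty_lam => trivial
  | ty_app => trivial
  | ty_sub hσ _ _ ih => exact ih.sub hσ
  | ty_msub hθ _ _ ih => exact ih.msub hθ
  | ty_conv _ h ih ih' => exact ih.conv h.eq_ne_kind.1 ih'
  | ty_ctx _ e ih => exact ih.ctx e
  | eq_ctx _ e ih => exact ih.ctx e
  | eq_refl _ ih => exact .refl ih
  | eq_symm _ ih => exact ih.symm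
  | eq_trans _ _ ih ih' => exact ih.trans hS ih'
  | eq_conv _ _ ih _ => exact ih
  | eq_pi h _ h' => exact ⟨h.veq hS, _, h'.veq hS⟩
  | eq_lam => trivial
  | eq_app => trivial
  | eq_sub h _ _ ih => exact ih.sub (h.veqSub hS)
  | eq_msub h h' _ ih => exact ih.msub (h.veqMSub hS) (h'.veq hS).2.1.ty_ctxWF
  | eq_beta _ _ _ ih ih' => rw [ih.eq_other ih'.ne_sort]; trivial
  | eq_eta _ _ ih => rw [ih.eq_other (by simp [Expr.head])]; trivial
  | eq_sub_id _ ih => exact .sub_id ih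
  | eq_sub_comp h h' _ _ _ ih => exact .sub_comp h h' ih
  | eq_sub_type => rfl
  | eq_sub_const => trivial
  | eq_sub_var_zero hσ _ _ _ ih ih' =>
    rw [ih'.eq_other (Head.sub_ne_sort ih.ne_sort)]; trivial
  | eq_var_succ => trivial
  | eq_sub_pi h h' => exact .refl (F := .sort _) ⟨_, .ty_sub_sort (.tySub_lift h h'.ty_head) h', rfl⟩
  | eq_sub_lam => trivial
  | eq_sub_app => trivial
  | eq_msub_id _ ih => exact .msub_id ih
  | eq_msub_comp h h' _ _ _ ih => exact .msub_comp h h' ih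
  | eq_msub_type => rfl
  | eq_msub_const => trivial
  | eq_msub_var => trivial
  | eq_msub_mvar_zero hθ _ _ _ ih ih' =>
    rw [ih'.eq_other (Head.msub_ne_sort ih.ne_sort)]; trivial
  | eq_mvar_succ => trivial
  | eq_msub_pi h h' => exact .refl (F := .sort _) ⟨_, .ty_msub_sort h h', rfl⟩
  | eq_msub_lam => trivial
  | eq_msub_app => trivial
  | eq_msub_sub h h' _ _ _ ih => exact .msub_sub h h' ih

theorem Der.pi_inj (hS : Sig.ClosedIn Sg Sg) (h : Der Sg (.eq Δ Γ (.pi A B) (.pi A' B') F)) :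
    VEq Sg Δ Γ A A' (.sort .type) ∧ ∃ s, VEq Sg Δ (A :: Γ) B B' (.sort s) :=
  h.heads hS

theorem Conv.pi_inj (hS : Sig.ClosedIn Sg Sg) (h : Der Sg (.ty Δ Γ E (.pi A B)))
    (c : Conv Sg Δ Γ (.pi A B) (.pi A' B')) :
    VEq Sg Δ Γ A A' (.sort .type) ∧ ∃ s, VEq Sg Δ (A :: Γ) B B' (.sort s) := by
  obtain ⟨s, hB⟩ := h.pi_cod hS
  exact (c.eq_sort hS (.ty_pi hB)).pi_inj hS

end

end

section

variable {C : Type u} {Sg : Sig C}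

/-! ### Soundness of weak head evaluation -/

section

variable {Δ Δ' Δ'' : MCtx C} {Γ Γ' Ψ Φ : Ctx C} {σ τ : Sub C} {θ : MSub C}
  {A B E F M N : Expr C} {s : Srt} {m n : ℕ}

/-! #### Meta-environments -/

theorem VEqMSub.shift_comp (h : Der Sg (.tyMSub Δ (.shift n) Δ'))
    (h' : Der Sg (.tyMSub Δ' (.shift m) Δ'')) :
    VEqMSub Sg Δ (.msub (.shift n) (.shift m)) (.shift (n + m)) Δ'' := by
  obtain ⟨Δ₂, rfl, rfl⟩ := h.tyMSub_shift_inv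
  obtain ⟨Δ₁, rfl, rfl⟩ := h'.tyMSub_shift_inv
  exact .shift_shift h.tyMSub_dom rfl rfl

theorem MEnv.drop_sound : ∀ (η : MEnv C) {n : ℕ} {Δ' : MCtx C}, Der Sg (.tyMSub Δ η.toMSub Δ') →
    Der Sg (.tyMSub Δ' (.shift n) Δ'') →
      VEqMSub Sg Δ (.msub η.toMSub (.shift n)) (η.drop n).toMSub Δ''
  | .shift _, _, _, h, h' => .shift_comp h h'
  | .cons _ _, 0, _, h, h' => by
    obtain ⟨Δ₂, rfl, e⟩ := h'.tyMSub_shift_inv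
    obtain rfl := List.length_eq_zero_iff.1 e
    exact .id_right h
  | .cons η M, n + 1, _, h, h' => by
    obtain ⟨_ | ⟨⟨Ψ, A⟩, Δ₂⟩, rfl, e⟩ := h'.tyMSub_shift_inv
    · simp at e
    · have e' : Δ₂.length = n := by simpa using e
      have h₁ := h.tyMSub_cons_inv.1
      exact (VEqMSub.cons_shift h e').trans
        (MEnv.drop_sound η h₁ (.tyMSub_shift h₁.tyMSub_cod e'))

theorem MEnv.eval_sound : ∀ (θ : MSub C) {η : MEnv C} {Δ' Δ'' : MCtx C},
    Der Sg (.tyMSub Δ η.toMSub Δ') → Der Sg (.tyMSub Δ' θ Δ'') →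
      VEqMSub Sg Δ (.msub η.toMSub θ) (η.eval θ).toMSub Δ''
  | .shift _, η, _, _, h, h' => by
    rw [MEnv.eval]; exact MEnv.drop_sound η h h'
  | .cons θ M, η, _, _, h, h' => by
    cases h' with
    | tyMSub_cons h₁ h₂ h₃ =>
    have h' := Der.tyMSub_cons h₁ h₂ h₃
    have e := VEqMSub.msub_cons h h'
    rw [MEnv.eval]
    have hM := e.2.2.tyMSub_cons_inv.2.2
    exact e.trans (.cons (MEnv.eval_sound θ h h₁) h₂
      (.refl ⟨hM, .of_ty (.ty_msub_sort (.tyMSub_msub h h₁) h₂)⟩))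
  | .msub θ θ', η, _, _, h, h' => by
    obtain ⟨Δ₀, h₁, h₂⟩ := h'.tyMSub_msub_inv
    have e := MEnv.eval_sound θ h h₁
    rw [MEnv.eval]
    exact (VEqMSub.assoc h h₁ h₂).trans ((VEqMSub.msub e (.refl h₂)).trans
      (MEnv.eval_sound θ' e.2.2 h₂))

theorem VEq.shift_mvar (hS : Sig.ClosedIn Sg Sg) : ∀ {n : ℕ} {Δ : MCtx C},
    Der Sg (.tyMSub Δ (.shift n) Δ') → VTy Sg Δ' Γ (.mvar m) F →
      VEq Sg Δ (Ctx.msub (.shift n) Γ) (.msub (.shift n) (.mvar m)) (.mvar (n + m))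
        (F.msubCls (.shift n))
  | 0, _, h, hm => by
    obtain ⟨Δ₂, rfl, e⟩ := h.tyMSub_shift_inv
    obtain rfl := List.length_eq_zero_iff.1 e
    have hΓ := hm.1.ty_ctxWF
    rw [Nat.zero_add]
    exact ((VEq.msub_id hm).ctx (Der.eqCtx_msub_id hΓ).eqCtx_symm).convs
      ((Conv.msubCls_id hm.2).symm.ctx (Der.eqCtx_msub_id hΓ).eqCtx_symm) (hm.2.msub h)
  | n + 1, _, h, hm => by
    obtain ⟨_ | ⟨⟨Ψ, A⟩, Δ₂⟩, rfl, e⟩ := h.tyMSub_shift_inv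
    · simp at e
    have hA := h.tyMSub_dom.mctx_type
    have hw := Der.tyMSub_wk hA
    have h₂ : Der Sg (.tyMSub (Δ₂ ++ Δ') (.shift n) Δ') :=
      .tyMSub_shift hw.tyMSub_cod (by simpa using e)
    have ih := VEq.shift_mvar hS h₂ hm
    have hΓ := hm.1.ty_ctxWF
    have ec := VEqMSub.shift_comp hw h₂
    rw [Nat.add_comm 1] at ec
    have e₁ := Der.eqCtx_msub ec.2.1 ec.2.2 ec.1 hΓ
    have e₂ := Der.eqCtx_msub_comp hw h₂ hΓ
    have e₃ := e₂.eqCtx_trans e₁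
    have c := (Conv.msubCls_comp hw h₂ hm.2).trans (.msubCls_left hΓ hm.2 ec.2.1 ec.1)
    have hv := VTy.mwk hA ⟨ih.2.2.1, ih.2.2.2⟩
    have e₄ := VEq.mvar_succ hv
    rw [← Expr.msubCls_of_ne ih.2.2.1.mvar_cls_ne_kind] at e₄
    have e₅ := ((VEq.msub (.refl hw) ih).trans e₄.symm).ctx e₃
    have c' := c.ctx e₁
    have e₆ := (VEq.msub_comp hw h₂ hm).trans (.msub ec (.refl hm))
    rw [Nat.add_right_comm]
    exact (((e₆.convs (.msubCls_left hΓ hm.2 ec.2.1 ec.1)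
      ((hm.2.msub ec.2.2).ctx e₁.eqCtx_symm)).ctx e₁).symm.trans (e₅.convs c' (hm.2.msub ec.2.2)))

theorem MEnv.lookup_sound (hS : Sig.ClosedIn Sg Sg) : ∀ (η : MEnv C) {m : ℕ} {Δ' : MCtx C}
    {Γ : Ctx C} {F}, Der Sg (.tyMSub Δ η.toMSub Δ') → VTy Sg Δ' Γ (.mvar m) F →
      VEq Sg Δ (Ctx.msub η.toMSub Γ) (.msub η.toMSub (.mvar m)) (η.lookup m)
        (F.msubCls η.toMSub)
  | .shift n, _, _, _, _, h, hm => .shift_mvar hS h hm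
  | .cons η M, 0, _, Γ, F, h, hm => by
    obtain ⟨Δ', Ψ, A, rfl, hA, e, c⟩ := hm.1.mvar_zero_inv
    obtain ⟨h₁, h₂, h₃⟩ := h.tyMSub_cons_inv
    have e₁ := (Der.eqCtx_msub_cons_wk h hA.ty_ctxWF).eqCtx_symm.eqCtx_trans
      (.eqCtx_msub_right h e)
    have c' := (Conv.msubCls_cons_wk h hA.ty_ctxWF (.of_ty hA)).symm.ctx e₁
    rw [Expr.msubCls_of_ne hA.ty_ne_kind, Expr.msubCls_of_ne hA.ty_ne_kind] at c'
    exact ((VEq.msub_mvar_zero h₁ hA h₃).ctx e₁).convs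
      (c'.trans (c.msubCls_right h hm.1.ty_ctxWF)) (hm.2.msub h)
  | .cons η M, m + 1, _, Γ, F, h, hm => by
    obtain ⟨Δ', Ψ, B, Γ', A, rfl, hB, hA, e, c⟩ := hm.1.mvar_succ_inv
    have hv := hA.vty hS
    obtain ⟨h₁, h₂, h₃⟩ := h.tyMSub_cons_inv
    have e₁ := (Der.eqCtx_msub_cons_wk h hA.ty_ctxWF).eqCtx_symm.eqCtx_trans
      (.eqCtx_msub_right h e)
    have e₂ := ((VEq.msub_cons_wk h hv).trans (MEnv.lookup_sound hS η h₁ hv)).ctx e₁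
    have c' := (Conv.msubCls_cons_wk h hA.ty_ctxWF hv.2).symm.ctx e₁
    rw [Expr.msubCls_of_ne hA.mvar_cls_ne_kind (.shift 1)] at c'
    exact (VEq.msub (.refl h) (VEq.mvar_succ hm)).trans
      (e₂.convs (c'.trans (c.msubCls_right h hm.1.ty_ctxWF)) (hm.2.msub h))

/-! #### Environments -/

theorem VEqSub.shift_comp (h : Der Sg (.tySub Δ Γ (.shift n) Ψ))
    (h' : Der Sg (.tySub Δ Ψ (.shift m) Φ)) :
    VEqSub Sg Δ Γ (.sub (.shift n) (.shift m)) (.shift (n + m)) Φ := by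
  obtain ⟨Γ₂, Γ₁, rfl, rfl, e⟩ := h.shift_inv
  obtain ⟨Γ₃, Γ₄, rfl, rfl, e'⟩ := h'.shift_inv
  obtain ⟨Γ₃', Γ₄', rfl, hl, e''⟩ := e.eqCtx_symm.eqCtx_append_inv
  exact (VEqSub.shift_shift h.tySub_dom hl rfl).ctx (.eqCtx_rfl h.tySub_dom)
    (e''.eqCtx_symm.eqCtx_trans e')

theorem VEq.shift_var : ∀ {n : ℕ} {Γ : Ctx C}, Der Sg (.tySub Δ Γ (.shift n) Ψ) →
    VTy Sg Δ Ψ (.var m) F →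
      VEq Sg Δ Γ (.sub (.shift n) (.var m)) (.var (n + m)) (F.subCls (.shift n))
  | 0, _, h, hm => by
    obtain ⟨Γ₂, Γ₁, rfl, e', e⟩ := h.shift_inv
    obtain rfl := List.length_eq_zero_iff.1 e'
    rw [Nat.zero_add]
    exact ((VEq.sub_id hm).convs (Conv.subCls_id hm.2).symm
      (hm.2.sub (.tySub_id hm.1.ty_ctxWF))).ctx e.eqCtx_symm
  | n + 1, _, h, hm => by
    obtain ⟨_ | ⟨A, Γ₂⟩, Γ₁, rfl, e', e⟩ := h.shift_inv
    · simp at e'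
    have hA := h.tySub_dom.ctx_type
    have hw := Der.tySub_wk hA
    have h₂ : Der Sg (.tySub Δ (Γ₂ ++ Γ₁) (.shift n) Ψ) :=
      .tySub_ctx (.tySub_shift hw.tySub_cod (by simpa using e')) (.eqCtx_rfl hw.tySub_cod) e
    have ih := VEq.shift_var h₂ hm
    have ec := VEqSub.shift_comp hw h₂
    rw [Nat.add_comm 1] at ec
    have c := (Conv.subCls_comp hw h₂ hm.2).trans (.subCls_left hm.2 ec.2.1 ec.1)
    have e₄ := VEq.var_succ (VTy.wk hA ⟨ih.2.2.1, ih.2.2.2⟩)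
    rw [← Expr.subCls_of_ne ih.2.2.1.var_cls_ne_kind] at e₄
    have e₅ := (VEq.sub (.refl hw) ih).trans e₄.symm
    have e₆ := (VEq.sub_comp hw h₂ hm).trans (.sub ec (.refl hm))
    rw [Nat.add_right_comm]
    exact (e₆.convs (.subCls_left hm.2 ec.2.1 ec.1) (hm.2.sub ec.2.2)).symm.trans
      (e₅.convs c (hm.2.sub ec.2.2))

/-- Composition of closures. -/
theorem VEq.sub_sub_convs (hσ : Der Sg (.tySub Δ Γ σ Ψ)) (hτ : Der Sg (.tySub Δ Ψ τ Φ))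
    (h : VTy Sg Δ Φ E F) :
    VEq Sg Δ Γ (.sub σ (.sub τ E)) (.sub (.sub σ τ) E) ((F.subCls τ).subCls σ) :=
  (VEq.sub_comp hσ hτ h).convs (Conv.subCls_comp hσ hτ h.2).symm ((h.2.sub hτ).sub hσ)

theorem Closure.shift_sound (hS : Sig.ClosedIn Sg Sg) (L : Closure C)
    (h : Der Sg (.tySub Δ Γ (.shift n) Ψ)) (hL : Der Sg (.ty Δ Ψ L.toExpr F)) :
    VEq Sg Δ Γ (.sub (.shift n) L.toExpr) (L.shift n).toExpr (F.subCls (.shift n)) := by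
  have hv := hL.vty hS
  cases L with
  | var m => exact .shift_var h hv
  | clo ρ η E =>
    obtain ⟨Φ, F', hρ, hE, c⟩ := hL.sub_inv
    exact (VEq.sub_sub_convs h hρ (hE.vty hS)).convs (c.subCls_right h) (hv.2.sub h)

theorem VEq.sub_cons_wk (h : Der Sg (.tySub Δ Γ (.cons σ M) (A :: Ψ))) (hE : VTy Sg Δ Ψ E F) :
    VEq Sg Δ Γ (.sub (.cons σ M) (.sub (.shift 1) E)) (.sub σ E) (F.subCls σ) := by
  obtain ⟨h₁, h₂, h₃⟩ := h.tySub_cons_inv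
  have hw := Der.tySub_wk h₂
  have e : VEqSub Sg Δ Γ _ _ Ψ := ⟨.eqSub_cons_wk h h₁, .tySub_sub h hw, h₁⟩
  exact ((VEq.sub_comp h hw hE).trans (.sub e (.refl hE))).convs (.subCls_left hE.2 e.2.1 e.1)
    (hE.2.sub h₁)

theorem Conv.subCls_cons_wk (h : Der Sg (.tySub Δ Γ (.cons σ M) (A :: Ψ)))
    (hF : IsCls Sg Δ Ψ F) :
    Conv Sg Δ Γ ((F.subCls (.shift 1)).subCls (.cons σ M)) (F.subCls σ) := by
  obtain ⟨h₁, h₂, h₃⟩ := h.tySub_cons_inv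
  have hw := Der.tySub_wk h₂
  exact (Conv.subCls_comp h hw hF).trans
    (.subCls_left hF (.tySub_sub h hw) (.eqSub_cons_wk h h₁))

theorem Env.lookup_sound (hS : Sig.ClosedIn Sg Sg) : ∀ (ρ : Env C) {m : ℕ} {Γ Ψ : Ctx C} {F},
    Der Sg (.tySub Δ Γ ρ.toSub Ψ) → VTy Sg Δ Ψ (.var m) F →
      VEq Sg Δ Γ (.sub ρ.toSub (.var m)) (ρ.lookup m).toExpr (F.subCls ρ.toSub)
  | .shift n, _, _, _, _, h, hm => .shift_var h hm
  | .cons ρ L, 0, _, _, _, h, hm => by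
    obtain ⟨A, Γ', rfl, hA, c⟩ := hm.1.var_zero_inv
    obtain ⟨h₁, h₂, h₃⟩ := h.tySub_cons_inv
    have c' := (Conv.subCls_cons_wk h (.of_ty hA)).symm
    rw [Expr.subCls_of_ne hA.ty_ne_kind, Expr.subCls_of_ne hA.ty_ne_kind] at c'
    exact (VEq.sub_var_zero h₁ hA h₃).convs (c'.trans (c.subCls_right h)) (hm.2.sub h)
  | .cons ρ L, m + 1, _, _, _, h, hm => by
    obtain ⟨A, B, Γ', rfl, hB, hA, c⟩ := hm.1.var_succ_inv
    have hv := hA.vty hS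
    obtain ⟨h₁, h₂, h₃⟩ := h.tySub_cons_inv
    have e := (VEq.sub_cons_wk h hv).trans (Env.lookup_sound hS ρ h₁ hv)
    have c' := (Conv.subCls_cons_wk h hv.2).symm
    rw [Expr.subCls_of_ne hA.var_cls_ne_kind (.shift 1)] at c'
    exact (VEq.sub (.refl h) (VEq.var_succ hm)).trans
      (e.convs (c'.trans (c.subCls_right h)) (hm.2.sub h))
  | .shifted n ρ, m, _, _, _, h, hm => by
    obtain ⟨Φ, h₁, h₂⟩ := h.tySub_sub_inv
    have ih := Env.lookup_sound hS ρ h₂ hm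
    have e := (VEq.sub (.refl h₁) ih).trans (Closure.shift_sound hS _ h₁ ih.2.2.1)
    exact (VEq.sub_comp h₁ h₂ hm).symm.trans (e.convs (Conv.subCls_comp h₁ h₂ hm.2) (hm.2.sub h))

end

end

section

variable {C : Type u} {Sg : Sig C}

section

variable {Δ Δ' Δ'' : MCtx C} {Γ Γ' Ψ Φ : Ctx C} {σ τ : Sub C} {θ : MSub C}
  {A B E F M N : Expr C} {s : Srt} {m n : ℕ}

theorem VEqSub.msub_shift' (hθ : Der Sg (.tyMSub Δ θ Δ')) (h : Der Sg (.tySub Δ' Γ (.shift n) Ψ)) :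
    VEqSub Sg Δ (Ctx.msub θ Γ) (.msub θ (.shift n)) (.shift n) (Ctx.msub θ Ψ) := by
  obtain ⟨Γ₂, Γ₁, rfl, rfl, e⟩ := h.shift_inv
  exact (VEqSub.msub_shift hθ h.tySub_dom rfl).ctx (.eqCtx_rfl (.ctx_msub hθ h.tySub_dom))
    (.eqCtx_msub_right hθ e)

theorem VEqSub.cons_shift' (h : Der Sg (.tySub Δ Γ (.cons σ M) (A :: Φ)))
    (h' : Der Sg (.tySub Δ (A :: Φ) (.shift (n + 1)) Ψ)) :
    Der Sg (.tySub Δ Φ (.shift n) Ψ) ∧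
      VEqSub Sg Δ Γ (.sub (.cons σ M) (.shift (n + 1))) (.sub σ (.shift n)) Ψ := by
  obtain ⟨_ | ⟨B, Γ₂⟩, Γ₁, e₁, e₂, e⟩ := h'.shift_inv
  · simp at e₂
  · rw [List.cons_append, List.cons.injEq] at e₁
    obtain ⟨rfl, rfl⟩ := e₁
    have e₂' : Γ₂.length = n := by simpa using e₂
    have hΦ := h'.tySub_dom.ctx_tail
    exact ⟨.tySub_ctx (.tySub_shift hΦ e₂') (.eqCtx_rfl hΦ) e,
      (VEqSub.cons_shift h e₂').ctx (.eqCtx_rfl h.tySub_dom) e⟩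

theorem Env.eval_sound (hS : Sig.ClosedIn Sg Sg) (ρ : Env C) (η : MEnv C) (σ : Sub C) :
    ∀ {Δ' : MCtx C} {Γ Γ' Ψ : Ctx C}, Der Sg (.tyMSub Δ η.toMSub Δ') →
    Der Sg (.tySub Δ Γ ρ.toSub (Ctx.msub η.toMSub Γ')) → Der Sg (.tySub Δ' Γ' σ Ψ) →
      VEqSub Sg Δ Γ (.sub ρ.toSub (.msub η.toMSub σ)) (Env.eval ρ η σ).toSub
        (Ctx.msub η.toMSub Ψ) := by
  induction ρ, η, σ using Env.eval.induct with
  | case1 k ρ η σ ih =>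
    intro Δ' Γ Γ' Ψ hη hρ hσ
    obtain ⟨Φ, h₁, h₂⟩ := hρ.tySub_sub_inv
    rw [Env.eval]
    exact (VEqSub.assoc h₁ h₂ (.tySub_msub hη hσ)).symm.trans (.sub (.refl h₁) (ih hη h₂ hσ))
  | case2 ρ η h =>
    intro Δ' Γ Γ' Ψ hη hρ hσ
    rw [Env.eval]
    · obtain ⟨Γ₂, Γ₁, rfl, e', e⟩ := hσ.shift_inv
      obtain rfl := List.length_eq_zero_iff.1 e'
      have e₁ := VEqSub.msub_shift' hη hσ
      have e₂ := Der.eqCtx_msub_right hη e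
      exact (VEqSub.sub (.refl hρ) e₁).trans
        ((VEqSub.id_right hρ).ctx (.eqCtx_rfl hρ.tySub_dom) e₂)
    · exact h
  | case3 k η n =>
    intro Δ' Γ Γ' Ψ hη hρ hσ
    rw [Env.eval]
    have e := VEqSub.msub_shift' hη hσ
    exact (VEqSub.sub (.refl hρ) e).trans (.shift_comp hρ e.2.2)
  | case4 ρ L η n ih =>
    intro Δ' Γ Γ' Ψ hη hρ hσ
    rw [Env.eval]
    obtain ⟨_ | ⟨A, Γ₂⟩, Γ₁, rfl, e₂, e⟩ := hσ.shift_inv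
    · simp at e₂
    have e₁ := VEqSub.msub_shift' hη hσ
    obtain ⟨h₁, e₃⟩ := VEqSub.cons_shift' hρ e₁.2.2
    have hΓ := hσ.tySub_dom.ctx_tail
    have h₂ : Der Sg (.tySub Δ' (Γ₂ ++ Γ₁) (.shift n) Ψ) :=
      .tySub_ctx (.tySub_shift hΓ (by simpa using e₂)) (.eqCtx_rfl hΓ) e
    have h₃ := hρ.tySub_cons_inv.1
    exact ((VEqSub.sub (.refl hρ) e₁).trans e₃).trans
      ((VEqSub.sub (.refl h₃) (.msub_shift' hη h₂)).symm.trans (ih hη h₃ h₂))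
  | case5 ρ η σ M h ih =>
    intro Δ' Γ Γ' Ψ hη hρ hσ
    rw [Env.eval]
    · obtain ⟨Ψ', A, hσ, hA, hM, e⟩ := hσ.cons_inv
      have e₁ := VEqSub.msub_cons hη hσ hA hM
      have e₂ := VEqSub.sub_cons hρ e₁.2.2
      obtain ⟨h₁, h₂, h₃⟩ := e₂.2.2.tySub_cons_inv
      exact ((VEqSub.sub (.refl hρ) e₁).trans (e₂.trans (.cons (.refl (h₃.vty hS)) h₂
        (ih hη hρ hσ)))).ctx (.eqCtx_rfl hρ.tySub_dom) (.eqCtx_msub_right hη e)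
    · exact h
  | case6 ρ η σ τ h ih ih' =>
    intro Δ' Γ Γ' Ψ hη hρ hσ
    rw [Env.eval]
    · obtain ⟨Φ, h₁, h₂⟩ := hσ.tySub_sub_inv
      have e := ih hη hρ h₁
      exact ((VEqSub.sub (.refl hρ) (.msub_sub hη h₁ h₂)).trans
        (.assoc hρ (.tySub_msub hη h₁) (.tySub_msub hη h₂))).trans
        ((VEqSub.sub e (.refl (.tySub_msub hη h₂))).trans (ih' hη e.2.2 h₂))
    · exact h
  | case7 ρ η θ σ h ih =>
    intro Δ' Γ Γ' Ψ hη hρ hσ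
    rw [Env.eval]
    · obtain ⟨Δ'', Γ'', Ψ'', hθ, hσ, e, e'⟩ := hσ.tySub_msub_inv
      have eη := MEnv.eval_sound θ hη hθ
      have c : ∀ {Φ Φ'}, Der Sg (.ctx Δ'' Φ) → Der Sg (.eqCtx Δ' (Ctx.msub θ Φ) Φ') →
          Der Sg (.eqCtx Δ (Ctx.msub (.msub η.toMSub θ) Φ) (Ctx.msub η.toMSub Φ')) ∧
          Der Sg (.eqCtx Δ (Ctx.msub (η.eval θ).toMSub Φ) (Ctx.msub η.toMSub Φ')) := by
        intro Φ Φ' hΦ e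
        have c₁ := (Der.eqCtx_msub_comp hη hθ hΦ).eqCtx_symm.eqCtx_trans (.eqCtx_msub_right hη e)
        exact ⟨c₁, (Der.eqCtx_msub eη.2.1 eη.2.2 eη.1 hΦ).eqCtx_symm.eqCtx_trans c₁⟩
      have c₁ := c hσ.tySub_dom e
      have c₂ := c hσ.tySub_cod e'
      have hρ' := Der.tySub_ctx hρ (.eqCtx_rfl hρ.tySub_dom) c₁.2.eqCtx_symm
      have e₁ := ((VEqSub.msub_msub hη hθ hσ).trans (.msub eη (.refl hσ))).ctx c₁.1 c₂.1
      exact (VEqSub.sub (.refl hρ) e₁).trans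
        ((ih eη.2.2 hρ' hσ).ctx (.eqCtx_rfl hρ.tySub_dom) c₂.2)
    · exact h

/-! #### Closures -/

variable {ρ : Env C} {η : MEnv C}

theorem Der.clo_inv {Γ F} (h : Der Sg (.ty Δ Γ (.sub σ (.msub θ E)) F)) :
    ∃ Δ' Γ' F', Der Sg (.tyMSub Δ θ Δ') ∧ Der Sg (.tySub Δ Γ σ (Ctx.msub θ Γ')) ∧
      Der Sg (.ty Δ' Γ' E F') ∧ Conv Sg Δ Γ ((F'.msubCls θ).subCls σ) F := by
  obtain ⟨Ψ, F', hσ, hE, c⟩ := h.sub_inv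
  obtain ⟨Δ', Γ', F'', hθ, hE, e, c'⟩ := hE.msub_inv
  exact ⟨Δ', Γ', F'', hθ, .tySub_ctx hσ (.eqCtx_rfl hσ.tySub_dom) e.eqCtx_symm, hE,
    (c'.subCls_right hσ).trans c⟩

/-- Inversion of the typing of a closure of an abstraction. -/
theorem Der.clo_lam_inv (h : Der Sg (.ty Δ Γ (.sub σ (.msub θ (.lam M))) F)) :
    ∃ Ψ A B, Der Sg (.tySub Δ Γ σ Ψ) ∧ Der Sg (.ty Δ (A :: Ψ) (.msub θ M) B) ∧
      Der Sg (.ty Δ (A :: Ψ) B (.sort .type)) ∧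
      Conv Sg Δ Γ (.pi (.sub σ A) (.sub σ.lift B)) F ∧
      VEq Sg Δ Γ (.sub σ (.msub θ (.lam M))) (.lam (.sub σ.lift (.msub θ M)))
        (.pi (.sub σ A) (.sub σ.lift B)) := by
  obtain ⟨Δ', Γ', F', hθ, hσ, hE, c⟩ := h.clo_inv
  obtain ⟨A, B, hM, hB, c'⟩ := hE.lam_inv
  have hM' := Der.ty_msub hθ hM
  rw [Expr.msubCls_of_ne hB.ty_ne_kind] at hM'
  have hB' := Der.ty_msub_sort hθ hB
  have e₁ := VEq.msub_lam hθ hM hB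
  have e₂ := VEq.sub_lam hσ hM' hB'
  have c₁ := Conv.of_eq (.eq_sub_pi hσ hB')
  have e₃ := VEq.sub (.refl hσ) e₁
  rw [Expr.subCls_of_ne (by simp)] at e₃
  refine ⟨_, _, _, hσ, hM', hB', ?_, (e₃.convs c₁ e₂.2.2.2).trans e₂⟩
  have c₂ := (((Conv.of_eq (.eq_msub_pi hθ hB)).symm.trans
    ((c'.msubCls_right hθ hE.ty_ctxWF))).subCls_right hσ).trans c
  rw [Expr.subCls_of_ne (by simp)] at c₂
  exact c₁.symm.trans c₂

/-- Inversion of the typing of a closure of a function type. -/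
theorem Der.clo_pi_inv (h : Der Sg (.ty Δ Γ (.sub σ (.msub θ (.pi A B))) F)) :
    ∃ s, Conv Sg Δ Γ (.sort s) F ∧
      VEq Sg Δ Γ (.sub σ (.msub θ (.pi A B)))
        (.pi (.sub σ (.msub θ A)) (.sub σ.lift (.msub θ B))) (.sort s) := by
  obtain ⟨Δ', Γ', F', hθ, hσ, hE, c⟩ := h.clo_inv
  obtain ⟨s, hB, c'⟩ := hE.pi_inv
  have hB' := Der.ty_msub_sort hθ hB
  refine ⟨s, ?_, ((VEq.sub (.refl hσ) (VEq.msub_pi hθ hB)).convs (.sub_sort hσ)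
    (.sort hσ.tySub_dom)).trans (.sub_pi hσ hB')⟩
  have c₁ := ((Conv.msub_sort hθ hE.ty_ctxWF).symm.trans (c'.msubCls_right hθ hE.ty_ctxWF))
  exact (Conv.sub_sort hσ).symm.trans ((c₁.subCls_right hσ).trans c)

mutual

theorem Whnf.sound (hS : Sig.ClosedIn Sg Sg) : ∀ {L : Closure C} {W : Whn C}, Whnf L W →
    ∀ {Γ F}, Der Sg (.ty Δ Γ L.toExpr F) → VEq Sg Δ Γ L.toExpr W.toExpr F
  | _, _, .gvar, Γ, F, h => .refl (h.vty hS)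
  | _, _, .sort, Γ, F, h => by
    obtain ⟨Δ', Γ', F', hη, hρ, hE, c⟩ := h.clo_inv
    obtain ⟨rfl, rfl⟩ := hE.sort_inv
    exact ((VEq.sub (.refl hρ) (.msub_type hη hE.ty_ctxWF)).trans (.sub_type hρ)).convs c
      (h.valid hS)
  | _, _, .const (a := a), Γ, F, h => by
    obtain ⟨Δ', Γ', F', hη, hρ, hE, c⟩ := h.clo_inv
    have hcl := fun K hK => hS.closed a K K hK hK
    have e₁ := VEq.msub_const hcl hη (hE.vty hS)
    obtain ⟨K, hK, cK⟩ := hE.const_inv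
    obtain ⟨s, h₁, -⟩ := hcl K hK
    rw [Expr.msubCls_of_ne (cK.eq_kind_iff.not.1 (h₁ _ _ hE.ty_ctxWF).ty_ne_kind)] at c
    have e₂ := VEq.sub (.refl hρ) e₁
    have e₃ := VEq.sub_const hcl hρ ⟨e₁.2.2.1, e₁.2.2.2⟩
    rw [← Expr.subCls_of_ne (by simp)] at e₃
    exact (e₂.trans e₃).convs c (h.valid hS)
  | _, _, .var (ρ := ρ) h', Γ, F, h => by
    obtain ⟨Δ', Γ', F', hη, hρ, hE, c⟩ := h.clo_inv
    have e₁ := VEq.msub_var hη (hE.vty hS)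
    rw [← Expr.msubCls_of_ne hE.var_cls_ne_kind] at e₁
    have e := ((VEq.sub (.refl hρ) e₁).trans (Env.lookup_sound hS ρ hρ
      ⟨e₁.2.2.1, e₁.2.2.2⟩)).convs c (h.valid hS)
    exact e.trans (Whnf.sound hS h' e.2.2.1)
  | _, _, .mvar_id, Γ, F, h => by
    obtain ⟨Δ', Γ', F', hη, hρ, hE, c⟩ := h.clo_inv
    obtain ⟨Δ₂, rfl, e'⟩ := hη.tyMSub_shift_inv
    obtain rfl := List.length_eq_zero_iff.1 e'
    have hv := hE.vty hS
    have e₁ := (Der.eqCtx_msub_id hE.ty_ctxWF).eqCtx_symm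
    have e₂ := ((VEq.msub_id hv).ctx e₁).convs ((Conv.msubCls_id hv.2).symm.ctx e₁) (hv.2.msub hη)
    exact (VEq.sub (.refl hρ) e₂).convs c (h.valid hS)
  | _, _, .mvar (η := η) _ h', Γ, F, h => by
    obtain ⟨Δ', Γ', F', hη, hρ, hE, c⟩ := h.clo_inv
    have e₁ := MEnv.lookup_sound hS η hη (hE.vty hS)
    have e₂ := VEq.msub_id ⟨e₁.2.2.1, e₁.2.2.2⟩
    have e := (VEq.sub (.refl hρ) (e₁.trans e₂.symm)).convs c (h.valid hS)
    exact e.trans (Whnf.sound hS h' e.2.2.1)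
  | _, _, .pi, Γ, F, h => .refl (h.vty hS)
  | _, _, .lam, Γ, F, h => .refl (h.vty hS)
  | _, _, .app (N := N) h₁ h₂, Γ, F, h => by
    obtain ⟨Δ', Γ', F', hη, hρ, hE, c⟩ := h.clo_inv
    obtain ⟨A, B, hM, hN, c'⟩ := hE.app_inv
    obtain ⟨s, hB⟩ := hM.pi_cod hS
    have hB' := Der.ty_msub_sort hη hB
    have hM' := ((Conv.of_eq (.eq_msub_pi hη hB)).ty (.ty_msub hη hM)).vty hS
    have hN' := Der.ty_msub hη hN
    rw [Expr.msubCls_of_ne hB.ty_head.ty_ne_kind] at hN'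
    have hs := Der.tySub_single hN' hB'.ty_head
    have e₁ := VEq.sub (.refl hρ) (VEq.msub_app hη (hM.vty hS) hN)
    rw [Expr.subCls_of_ne (by simp)] at e₁
    have c₁ := (Conv.of_eq (.eq_sub_left (.tySub_sub hρ hs)
      (.eqSub_sub_single hρ hB'.ty_head hN') hB')).symm.trans <|
      .of_eq (.eq_symm (.eq_sub_comp_sort hρ hs hB'))
    have c₂ := ((Conv.of_eq (.eq_msub_single hη hN hB)).symm.trans
      (c'.msubCls_right hη hE.ty_ctxWF)).subCls_right hρ
    rw [Expr.subCls_of_ne (by simp)] at c₂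
    have e := (e₁.trans ((VEq.sub_app hρ hM' hN').convs c₁ e₁.2.2.2)).convs (c₂.trans c) (h.valid hS)
    obtain ⟨A₁, B₁, h₃, h₄, c₃⟩ := e.2.2.1.app_inv
    have e₂ := (VEq.app (Whnf.sound hS h₁ h₃) (.refl (h₄.vty hS))).convs c₃ (h.valid hS)
    exact (e.trans e₂).trans (WApp.sound hS h₂ e₂.2.2.1)
  | _, _, .sub (ρ := ρ) (η := η) (σ := σ) h', Γ, F, h => by
    obtain ⟨Δ', Γ', F', hη, hρ, hE, c⟩ := h.clo_inv
    obtain ⟨Φ, F'', hσ, hM, c'⟩ := hE.sub_inv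
    have hv := hM.vty hS
    have e₁ := VEq.msub_sub hη hσ hv
    have e₂ := Env.eval_sound hS ρ η σ hη hρ hσ
    have hv' := VTy.msub hη hv
    have hσ' := Der.tySub_msub hη hσ
    have e₃ := (VEq.sub_comp hρ hσ' hv').trans (.sub e₂ (.refl hv'))
    have e₄ := (VEq.sub (.refl hρ) e₁).trans (e₃.convs (Conv.subCls_comp hρ hσ' hv'.2).symm
      ((hv'.2.sub hσ').sub hρ))
    have c₁ := ((Conv.msubCls_subCls hη hσ hv.2).symm.trans
      (c'.msubCls_right hη hE.ty_ctxWF)).subCls_right hρ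
    have e := e₄.convs (c₁.trans c) (h.valid hS)
    exact e.trans (Whnf.sound hS h' e.2.2.1)
  | _, _, .msub (η := η) (θ := θ) h', Γ, F, h => by
    obtain ⟨Δ', Γ', F', hη, hρ, hE, c⟩ := h.clo_inv
    obtain ⟨Δ'', Γ'', F'', hθ, hM, e', c'⟩ := hE.msub_inv
    have hv := hM.vty hS
    have hΓ := hM.ty_ctxWF
    have eη := MEnv.eval_sound θ hη hθ
    have c₁ := (Der.eqCtx_msub_comp hη hθ hΓ).eqCtx_symm.eqCtx_trans (.eqCtx_msub_right hη e')
    have e₁ := ((VEq.msub_comp hη hθ hv).trans (.msub eη (.refl hv))).ctx c₁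
    have c₂ := ((Conv.msubCls_comp hη hθ hv.2).symm.ctx c₁).trans
      (c'.msubCls_right hη hE.ty_ctxWF)
    have e := (VEq.sub (.refl hρ) e₁).convs ((c₂.subCls_right hρ).trans c) (h.valid hS)
    exact e.trans (Whnf.sound hS h' e.2.2.1)

theorem WApp.sound (hS : Sig.ClosedIn Sg Sg) : ∀ {W : Whn C} {L : Closure C} {W' : Whn C},
    WApp W L W' → ∀ {Γ F}, Der Sg (.ty Δ Γ (.app W.toExpr L.toExpr) F) →
      VEq Sg Δ Γ (.app W.toExpr L.toExpr) W'.toExpr F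
  | _, _, _, .neu, Γ, F, h => .refl (h.vty hS)
  | _, L, _, .beta (ρ := ρ) h', Γ, F, h => by
    obtain ⟨A, B, hE, hL, c⟩ := h.app_inv
    obtain ⟨Ψ, A', B', hρ, hM, hB, c', e⟩ := hE.clo_lam_inv
    obtain ⟨eA, s, eB⟩ := Conv.pi_inj hS e.2.1 c'
    have hL' := Der.ty_conv hL eA.symm.1
    have hl := Der.tySub_lift hρ hB.ty_head
    have hs := Der.tySub_single hL' eA.2.1
    have hv := hM.vty hS
    have hB₁ := Der.ty_sub_sort hl hB
    have hM₁ := Der.ty_sub hl hM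
    rw [Expr.subCls_of_ne hB.ty_ne_kind] at hM₁
    have e₁ : VEqSub Sg Δ Γ _ _ (A' :: Ψ) := ⟨.eqSub_single_lift hρ hB.ty_head hL',
      .tySub_sub hs hl, .tySub_cons hρ hB.ty_head hL'⟩
    have c₁ := (Conv.subCls_comp hs hl hv.2).symm
    rw [Expr.subCls_of_ne hB.ty_ne_kind (Sub.lift _), Expr.subCls_of_ne (F := .sub _ _) (by simp)] at c₁
    have e₂ := ((VEq.sub_comp hs hl hv).trans (.sub e₁ (.refl hv))).convs c₁
      (.of_ty (.ty_sub_sort hs hB₁))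
    have c₂ := (Conv.of_eq (.eq_sub_right hs eB.1)).trans c
    have e₃ := ((VEq.app e (.refl (hL'.vty hS))).trans
      ((VEq.beta hM₁ hB₁ hL').trans e₂)).convs c₂ (h.valid hS)
    exact e₃.trans (Whnf.sound hS h' e₃.2.2.1)

end

end

end

section

variable {C : Type u} {Sg : Sig C}

/-! ### Soundness of algorithmic equality -/

section

variable {Δ : MCtx C} {Γ Γ' Ψ Φ : Ctx C} {σ τ : Sub C} {ρ : Env C} {η : MEnv C} {L : Closure C}
  {A B E F F' M N : Expr C} {s s' : Srt} {k k' m n : ℕ}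

theorem Conv.sort_inj (c : Conv Sg Δ Γ (.sort s) (.sort s')) : s = s' := by
  have := c.eq_kind_iff
  cases s <;> cases s' <;> simp_all

theorem Neu.not_isKind : ∀ H : Neu C, ¬ H.toExpr.isKind
  | .const _ => id
  | .var _ => id
  | .mvar _ _ => id
  | .app _ _ => id

theorem Neu.shift_sound (hS : Sig.ClosedIn Sg Sg) : ∀ (H : Neu C) {F : Expr C},
    Der Sg (.ty Δ Γ (.sub (.shift n) H.toExpr) F) →
      VEq Sg Δ Γ (.sub (.shift n) H.toExpr) (H.shift n).toExpr F
  | .const a, F, h => by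
    obtain ⟨Ψ, F', hσ, hE, c⟩ := h.sub_inv
    have hcl := fun K hK => hS.closed a K K hK hK
    obtain ⟨K, hK, cK⟩ := hE.const_inv
    obtain ⟨s, h₁, -⟩ := hcl K hK
    rw [Expr.subCls_of_ne (cK.eq_kind_iff.not.1 (h₁ _ _ hE.ty_ctxWF).ty_ne_kind)] at c
    exact (VEq.sub_const hcl hσ (hE.vty hS)).convs c (h.valid hS)
  | .var m, F, h => by
    obtain ⟨Ψ, F', hσ, hE, c⟩ := h.sub_inv
    exact (VEq.shift_var hσ (hE.vty hS)).convs c (h.valid hS)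
  | .mvar ρ m, F, h => by
    obtain ⟨Ψ, F', hσ, hE, c⟩ := h.sub_inv
    obtain ⟨Φ, F'', hρ, hm, c'⟩ := hE.sub_inv
    exact (VEq.sub_sub_convs hσ hρ (hm.vty hS)).convs ((c'.subCls_right hσ).trans c) (h.valid hS)
  | .app H L, F, h => by
    obtain ⟨Ψ, F', hσ, hE, c⟩ := h.sub_inv
    obtain ⟨A, B, hH, hL, c'⟩ := hE.app_inv
    obtain ⟨s, hB⟩ := hH.pi_cod hS
    have hs := Der.tySub_single hL hB.ty_head
    have c₁ := (Conv.of_eq (.eq_sub_left (.tySub_sub hσ hs)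
      (.eqSub_sub_single hσ hB.ty_head hL) hB)).symm.trans <|
      .of_eq (.eq_symm (.eq_sub_comp_sort hσ hs hB))
    have c₂ := c'.subCls_right hσ
    rw [Expr.subCls_of_ne (by simp)] at c₂
    have e := (VEq.sub_app hσ (hH.vty hS) hL).convs (c₁.trans (c₂.trans c)) (h.valid hS)
    obtain ⟨A₁, B₁, h₁, h₂, c₃⟩ := e.2.2.1.app_inv
    have e₁ := Neu.shift_sound hS H h₁
    obtain ⟨Ψ', A', hσ', hL', c₄⟩ := h₂.sub_inv
    have e₂ := (Closure.shift_sound hS L hσ' hL').convs c₄ (h₂.valid hS)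
    exact e.trans ((VEq.app e₁ e₂).convs c₃ (h.valid hS))

theorem Env.cons_sound (hS : Sig.ClosedIn Sg Sg)
    (h : Der Sg (.tySub Δ Γ (.sub (.shift k) (Env.cons ρ L).toSub) Ψ)) :
    ∃ A Ψ', Ψ = A :: Ψ' ∧ VEqSub Sg Δ Γ (.sub (.shift k) (Env.cons ρ L).toSub)
      (.cons (.sub (.shift k) ρ.toSub) (L.shift k).toExpr) Ψ := by
  obtain ⟨Φ, hk, hc⟩ := h.tySub_sub_inv
  obtain ⟨Ψ', A', -, -, -, e⟩ := hc.cons_inv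
  obtain ⟨A, Ψ₀, rfl, -⟩ := e.eqCtx_inv
  refine ⟨A, Ψ₀, rfl, ?_⟩
  obtain ⟨hρ, hA, hL⟩ := hc.tySub_cons_inv
  have e₁ := Closure.shift_sound hS L hk hL
  rw [Expr.subCls_of_ne (by simp)] at e₁
  exact (VEqSub.sub_cons hk hc).trans (.cons (e₁.convs (.of_eq (.eq_sub_comp_sort hk hρ hA))
    (.of_ty (.ty_sub_sort (.tySub_sub hk hρ) hA))) hA (.refl (.tySub_sub hk hρ)))

theorem VEqSub.shift_eta (h : Der Sg (.tySub Δ Γ (.shift n) (A :: Ψ))) :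
    VEqSub Sg Δ Γ (.shift n) (.cons (.shift (n + 1)) (.var n)) (A :: Ψ) := by
  obtain ⟨Γ₂, Γ₁, rfl, e', e⟩ := h.shift_inv
  obtain ⟨A', Ψ', rfl, -⟩ := e.eqCtx_symm.eqCtx_inv
  exact (VEqSub.eta h.tySub_dom e').ctx (.eqCtx_rfl h.tySub_dom) e

theorem Env.cons_shift_sound (hS : Sig.ClosedIn Sg Sg) {W : Whn C}
    (h : Der Sg (.tySub Δ Γ (.sub (.shift k) (Env.cons ρ L).toSub) Ψ))
    (h' : Der Sg (.tySub Δ Γ (.sub (.shift k') (.shift n)) Ψ)) (hW : Whnf (L.shift k) W)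
    (ih : ∀ {Ψ}, Der Sg (.tySub Δ Γ (.sub (.shift k) ρ.toSub) Ψ) →
      Der Sg (.tySub Δ Γ (.sub (.shift k') (.shift (n + 1))) Ψ) →
        VEqSub Sg Δ Γ (.sub (.shift k) ρ.toSub) (.sub (.shift k') (.shift (n + 1))) Ψ)
    (ih' : ∀ {F}, Der Sg (.ty Δ Γ W.toExpr F) → Der Sg (.ty Δ Γ (.var (k' + n)) F) →
      VEq Sg Δ Γ W.toExpr (.var (k' + n)) F) :
    VEqSub Sg Δ Γ (.sub (.shift k) (Env.cons ρ L).toSub) (.sub (.shift k') (.shift n)) Ψ := by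
  obtain ⟨A, Ψ', rfl, e⟩ := Env.cons_sound hS h
  obtain ⟨Φ, hk, hn⟩ := h'.tySub_sub_inv
  obtain ⟨hρ, hA, hL⟩ := e.2.2.tySub_cons_inv
  have e₁ := VEqSub.shift_comp hk hn
  have e₂ := VEqSub.shift_eta e₁.2.2
  have hn' := (VEqSub.shift_eta hn).2.2.tySub_cons_inv.1
  have e₃ := (ih hρ (.tySub_sub hk hn')).trans (.shift_comp hk hn')
  have hv := e₂.2.2.tySub_cons_inv.2.2
  have e₄ := Whnf.sound hS hW hL
  have e₅ := e₄.trans (ih' e₄.2.2.1 (.ty_conv hv (.eq_symm (.eq_sub_left e₃.2.1 e₃.1 hA))))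
  exact e.trans ((VEqSub.cons e₅ hA e₃).trans (e₁.trans e₂).symm)

theorem Whn.lam_neu_sound (hS : Sig.ClosedIn Sg Sg) {H : Neu C} {W : Whn C}
    (h : Der Sg (.ty Δ Γ (Whn.lam ρ η M).toExpr F)) (h' : Der Sg (.ty Δ Γ H.toExpr F))
    (hW : Whnf (.clo ρ.lift η M) W)
    (ih : ∀ {Γ F}, Der Sg (.ty Δ Γ W.toExpr F) →
      Der Sg (.ty Δ Γ (.app (H.shift 1).toExpr (.var 0)) F) →
        VEq Sg Δ Γ W.toExpr (.app (H.shift 1).toExpr (.var 0)) F) :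
    VEq Sg Δ Γ (Whn.lam ρ η M).toExpr H.toExpr F := by
  obtain ⟨Ψ, A, B, hρ, hM, hB, c, e⟩ := Der.clo_lam_inv h
  have hl := Der.tySub_lift hρ hB.ty_head
  have hM₁ := Der.ty_sub hl hM
  rw [Expr.subCls_of_ne hB.ty_ne_kind] at hM₁
  have hB₁ := Der.ty_sub_sort hl hB
  have hH := c.symm.ty h'
  have hb := hH.ty_eta_body hB₁
  obtain ⟨A₁, B₁, h₁, h₂, c₁⟩ := hb.app_inv
  have e₁ := (VEq.app (Neu.shift_sound hS H h₁) (.refl (h₂.vty hS))).convs c₁ (.of_ty hB₁)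
  have e₂ := Whnf.sound hS hW hM₁
  have e₃ := (e₂.trans (ih e₂.2.2.1 e₁.2.2.1)).trans e₁.symm
  exact (e.trans ((VEq.lam e₃ hB₁).trans (VEq.eta hH hB₁).symm)).convs c (h.valid hS)

mutual

theorem AEqN.sound (hSg : Sig.WF Sg) : ∀ {H H' : Neu C}, AEqN H H' → ∀ {Γ F F'},
    Der Sg (.ty Δ Γ H.toExpr F) → Der Sg (.ty Δ Γ H'.toExpr F') →
      Conv Sg Δ Γ F F' ∧ VEq Sg Δ Γ H.toExpr H'.toExpr F
  | _, _, .const, Γ, F, F', h, h' => by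
    obtain ⟨K, hK, c⟩ := h.const_inv
    obtain ⟨K', hK', c'⟩ := h'.const_inv
    obtain rfl := hSg.unique _ _ _ hK hK'
    exact ⟨c.symm.trans c', .refl (h.vty hSg.closedIn_self)⟩
  | _, _, .var, Γ, F, F', h, h' => by
    refine ⟨?_, .refl (h.vty hSg.closedIn_self)⟩
    obtain ⟨Γ₂, A, Γ₁, rfl, rfl, c⟩ := h.var_inv
    obtain ⟨Γ₂', A', Γ₁', e, e', c'⟩ := h'.var_inv
    obtain ⟨rfl, e₂⟩ := List.append_inj e e'.symm
    cases e₂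
    exact c.symm.trans c'
  | _, _, .mvar (ρ := ρ) (ρ' := ρ') (m := m) h₁, Γ, F, F', h, h' => by
    have hS := hSg.closedIn_self
    obtain ⟨Ψ, F₁, hρ, hm, c⟩ := h.sub_inv
    obtain ⟨Ψ', F₁', hρ', hm', c'⟩ := h'.sub_inv
    obtain ⟨Δ₂, Φ, A, Δ₁, e, hl, e₁, c₁⟩ := hm.mvar_inv
    obtain ⟨Δ₂', Φ', A', Δ₁', e', hl', e₁', c₁'⟩ := hm'.mvar_inv
    obtain ⟨rfl, e₂⟩ := List.append_inj (e.symm.trans e') (hl.trans hl'.symm)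
    cases e₂
    have hρ₁ := Der.tySub_ctx hρ' (.eqCtx_rfl hρ.tySub_dom) (e₁'.eqCtx_symm.eqCtx_trans e₁)
    have hid := Der.tySub_id hρ.tySub_dom
    have e₂ := (VEqSub.id_left hρ).symm.trans ((AEqEnv.sound hSg h₁ (.tySub_sub hid hρ)
      (.tySub_sub hid hρ₁)).trans (VEqSub.id_left hρ₁))
    have e₃ := VEq.sub e₂ (.refl (hm.vty hS))
    have c₂ := c₁.symm.trans ((c₁'.ctx (e₁'.eqCtx_symm.eqCtx_trans e₁)))
    have c₃ := (Conv.subCls_left (hm.valid hS) hρ e₂.1).trans (c₂.subCls_right hρ₁)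
    exact ⟨c.symm.trans (c₃.trans c'), e₃.convs c (h.valid hS)⟩
  | _, _, .app h₁ hW hW' h₂, Γ, F, F', h, h' => by
    have hS := hSg.closedIn_self
    obtain ⟨A, B, hH, hL, c⟩ := h.app_inv
    obtain ⟨A', B', hH', hL', c'⟩ := h'.app_inv
    obtain ⟨cp, e⟩ := AEqN.sound hSg h₁ hH hH'
    obtain ⟨eA, s, eB⟩ := cp.pi_inj hS hH
    have e₁ := Whnf.sound hS hW hL
    have e₂ := Whnf.sound hS hW' (.ty_conv hL' eA.symm.1)
    have e₃ := (e₁.trans (AEqW.sound hSg h₂ e₁.2.2.1 e₂.2.2.1)).trans e₂.symm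
    have c₁ := Conv.of_eq (.eq_sub_sort (.tySub_single hL eA.2.1) (.eqSub_single e₃.1 eA.2.1) eB.1)
    exact ⟨c.symm.trans (c₁.trans c'), (VEq.app e e₃).convs c (h.valid hS)⟩

theorem AEqW.sound (hSg : Sig.WF Sg) : ∀ {W W' : Whn C}, AEqW W W' → ∀ {Γ F},
    Der Sg (.ty Δ Γ W.toExpr F) → Der Sg (.ty Δ Γ W'.toExpr F) →
      VEq Sg Δ Γ W.toExpr W'.toExpr F
  | _, _, .sort, Γ, F, h, _ => .refl (h.vty hSg.closedIn_self)
  | _, _, .neu h₁, Γ, F, h, h' => (AEqN.sound hSg h₁ h h').2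
  | _, _, .pi hV hV' h₁ hW hW' h₂, Γ, F, h, h' => by
    have hS := hSg.closedIn_self
    obtain ⟨s, c, e⟩ := Der.clo_pi_inv h
    obtain ⟨s', c', e'⟩ := Der.clo_pi_inv h'
    obtain rfl := (c.trans c'.symm).sort_inj
    obtain ⟨s₁, hB, c₁⟩ := e.2.2.1.pi_inv
    obtain ⟨s₂, hB', c₂⟩ := e'.2.2.1.pi_inv
    obtain rfl := c₁.sort_inj
    obtain rfl := c₂.sort_inj
    have e₁ := Whnf.sound hS hV hB.ty_head
    have e₂ := Whnf.sound hS hV' hB'.ty_head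
    have eA := (e₁.trans (AEqW.sound hSg h₁ e₁.2.2.1 e₂.2.2.1)).trans e₂.symm
    have e₃ := Whnf.sound hS hW hB
    have e₄ := Whnf.sound hS hW' (.ty_ctx hB' eA.symm.head)
    have eB := (e₃.trans (AEqW.sound hSg h₂ e₃.2.2.1 e₄.2.2.1)).trans e₄.symm
    exact ((e.trans (.pi eA eB)).trans e'.symm).convs c (h.valid hS)
  | _, _, .lam hW hW' h₁, Γ, F, h, h' => by
    have hS := hSg.closedIn_self
    obtain ⟨Ψ, A, B, hρ, hM, hB, c, e⟩ := Der.clo_lam_inv h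
    obtain ⟨Ψ', A', B', hρ', hM', hB', c', e'⟩ := Der.clo_lam_inv h'
    have cp := c.trans c'.symm
    obtain ⟨eA, s, eB⟩ := cp.pi_inj hS e.2.1
    have hl := Der.tySub_lift hρ hB.ty_head
    have hl' := Der.tySub_lift hρ' hB'.ty_head
    have h₂ := Der.ty_sub hl hM
    have h₃ := Der.ty_sub hl' hM'
    rw [Expr.subCls_of_ne hB.ty_ne_kind] at h₂
    rw [Expr.subCls_of_ne hB'.ty_ne_kind] at h₃
    have e₁ := Whnf.sound hS hW h₂
    have e₂ := Whnf.sound hS hW' (.ty_conv (.ty_ctx h₃ eA.symm.head) eB.symm.1)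
    have e₃ := (e₁.trans (AEqW.sound hSg h₁ e₁.2.2.1 e₂.2.2.1)).trans e₂.symm
    exact ((e.trans (.lam e₃ (.ty_sub_sort hl hB))).trans
      (e'.convs cp.symm e.2.2.2).symm).convs c (h.valid hS)
  | _, _, .lam_neu hW h₁, Γ, F, h, h' =>
    Whn.lam_neu_sound hSg.closedIn_self h h' hW fun h₂ h₃ => AEqW.sound hSg h₁ h₂ h₃
  | _, _, .neu_lam hW h₁, Γ, F, h, h' =>
    (Whn.lam_neu_sound hSg.closedIn_self h' h hW
      fun h₂ h₃ => (AEqW.sound hSg h₁ h₃ h₂).symm).symm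

theorem AEqEnv.sound (hSg : Sig.WF Sg) : ∀ {k k' : ℕ} {ρ ρ' : Env C}, AEqEnv k k' ρ ρ' → ∀ {Γ Ψ},
    Der Sg (.tySub Δ Γ (.sub (.shift k) ρ.toSub) Ψ) →
    Der Sg (.tySub Δ Γ (.sub (.shift k') ρ'.toSub) Ψ) →
      VEqSub Sg Δ Γ (.sub (.shift k) ρ.toSub) (.sub (.shift k') ρ'.toSub) Ψ
  | _, _, _, _, .shift e, Γ, Ψ, h, h' => by
    obtain ⟨Φ, h₁, h₂⟩ := h.tySub_sub_inv
    obtain ⟨Φ', h₁', h₂'⟩ := h'.tySub_sub_inv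
    have e₁ := VEqSub.shift_comp h₁ h₂
    rw [e] at e₁
    exact e₁.trans (VEqSub.shift_comp h₁' h₂').symm
  | _, _, _, _, .shifted_left h₁, Γ, Ψ, h, h' => by
    obtain ⟨Φ, h₂, h₃⟩ := h.tySub_sub_inv
    obtain ⟨Φ', h₃, h₄⟩ := h₃.tySub_sub_inv
    have e := (VEqSub.assoc h₂ h₃ h₄).trans (.sub (.shift_comp h₂ h₃) (.refl h₄))
    exact e.trans (AEqEnv.sound hSg h₁ e.2.2 h')
  | _, _, _, _, .shifted_right h₁, Γ, Ψ, h, h' => by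
    obtain ⟨Φ, h₂, h₃⟩ := h'.tySub_sub_inv
    obtain ⟨Φ', h₃, h₄⟩ := h₃.tySub_sub_inv
    have e := (VEqSub.assoc h₂ h₃ h₄).trans (.sub (.shift_comp h₂ h₃) (.refl h₄))
    exact (AEqEnv.sound hSg h₁ h e.2.2).trans e.symm
  | _, _, _, _, .cons h₁ hW hW' h₂, Γ, Ψ, h, h' => by
    have hS := hSg.closedIn_self
    obtain ⟨A, Ψ', rfl, e⟩ := Env.cons_sound hS h
    obtain ⟨A', Ψ'', e₁, e'⟩ := Env.cons_sound hS h'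
    cases e₁
    obtain ⟨hρ, hA, hL⟩ := e.2.2.tySub_cons_inv
    obtain ⟨hρ', -, hL'⟩ := e'.2.2.tySub_cons_inv
    have e₁ := AEqEnv.sound hSg h₁ hρ hρ'
    have e₂ := Whnf.sound hS hW hL
    have e₃ := Whnf.sound hS hW' (.ty_conv hL' (.eq_symm (.eq_sub_left hρ e₁.1 hA)))
    have e₄ := (e₂.trans (AEqW.sound hSg h₂ e₂.2.2.1 e₃.2.2.1)).trans e₃.symm
    exact (e.trans (.cons e₄ hA e₁)).trans e'.symm
  | _, _, _, _, .cons_shift h₁ hW h₂, Γ, Ψ, h, h' =>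
    Env.cons_shift_sound hSg.closedIn_self h h' hW (fun h₃ h₄ => AEqEnv.sound hSg h₁ h₃ h₄)
      fun h₃ h₄ => AEqW.sound hSg h₂ h₃ h₄
  | _, _, _, _, .shift_cons h₁ hW h₂, Γ, Ψ, h, h' =>
    (Env.cons_shift_sound hSg.closedIn_self h' h hW
      (fun h₃ h₄ => (AEqEnv.sound hSg h₁ h₄ h₃).symm)
      fun h₃ h₄ => (AEqW.sound hSg h₂ h₄ h₃).symm).symm

end

theorem Neu.eqAtSort (hS : Sig.ClosedIn Sg Sg) {H : Neu C} (h : Der Sg (.ty Δ Γ H.toExpr F))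
    (c : Conv Sg Δ Γ F F') : EqAtSort Sg Δ Γ F F' := by
  rcases h.valid hS with e | ⟨s, hF⟩
  · exact absurd ((h.kindIff hS).2 e) H.not_isKind
  · exact ⟨s, c.eq_sort hS hF⟩

end

end

end CMTT

theorem mainTheorem2 {C : Type*} (Sg : CMTT.Sig C) (hSg : CMTT.Sig.WF Sg) :
    (∀ (H H' : CMTT.Neu C), CMTT.AEqN H H' →
      ∀ (Δ : CMTT.MCtx C) (Γ : CMTT.Ctx C) (F F' : CMTT.Expr C),
        CMTT.Der Sg (.ty Δ Γ H.toExpr F) → CMTT.Der Sg (.ty Δ Γ H'.toExpr F') →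
          CMTT.EqAtSort Sg Δ Γ F F' ∧ CMTT.Der Sg (.eq Δ Γ H.toExpr H'.toExpr F)) ∧
    (∀ (W W' : CMTT.Whn C), CMTT.AEqW W W' →
      ∀ (Δ : CMTT.MCtx C) (Γ : CMTT.Ctx C) (F : CMTT.Expr C),
        CMTT.Der Sg (.ty Δ Γ W.toExpr F) → CMTT.Der Sg (.ty Δ Γ W'.toExpr F) →
          CMTT.Der Sg (.eq Δ Γ W.toExpr W'.toExpr F)) ∧
    (∀ (k k' : ℕ) (ρ ρ' : CMTT.Env C), CMTT.AEqEnv k k' ρ ρ' →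
      ∀ (Δ : CMTT.MCtx C) (Γ Ψ : CMTT.Ctx C),
        CMTT.Der Sg (.tySub Δ Γ (.sub (.shift k) ρ.toSub) Ψ) →
        CMTT.Der Sg (.tySub Δ Γ (.sub (.shift k') ρ'.toSub) Ψ) →
          CMTT.Der Sg (.eqSub Δ Γ (.sub (.shift k) ρ.toSub) (.sub (.shift k') ρ'.toSub) Ψ)) := by
  have hS := hSg.closedIn_self
  refine ⟨fun H H' h Δ Γ F F' h₁ h₂ => ?_, fun W W' h Δ Γ F h₁ h₂ => (h.sound hSg h₁ h₂).1,
    fun k k' ρ ρ' h Δ Γ Ψ h₁ h₂ => (h.sound hSg h₁ h₂).1⟩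
  obtain ⟨c, e⟩ := h.sound hSg h₁ h₂
  exact ⟨CMTT.Neu.eqAtSort hS h₁ c, e.1⟩
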